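/- Let $g\in\mathbb N$. By \emph{spectral data} of genus $g$ (of a periodic solution of the sinh-Gordon equation, with non-singular spectral curve) we mean a pair $(a,b)$ of complex polynomials in $\lambda$ such that: (1) $\deg a=2g$, $a$ has only simple roots, $|a(0)|=\tfrac1{16}$, $\lambda^{2g}\,\overline{a(\bar\lambda^{-1})}=a(\lambda)$ for $\lambda\neq0$, and $\lambda^{-g}a(\lambda)\le 0$ for $|\lambda|=1$; (2) $\deg b=g+1$ and $\lambda^{g+1}\,\overline{b(\bar\lambda^{-1})}=-b(\lambda)$ for $\lambda\neq 0$; (3) on $\Sigma^*=\{(\lambda,\nu)\in\mathbb C^*\times\mathbb C:\nu^2=\lambda^{-1}a(\lambda)\}$ there is a nowhere vanishing function $\mu=f(\lambda)\,\nu+k(\lambda)$, with $f,k$ holomorphic on $\mathbb C^*$, such that $d\ln\mu=\dfrac{b\,d\lambda}{\nu\lambda^2}$, $\sigma^*\mu=\mu^{-1}$, $\rho^*\mu=\bar\mu^{-1}$, $\eta^*\mu=\bar\mu$, and $\mu=\pm1$ at the roots of $a$, where $\sigma(\lambda,\nu)=(\lambda,-\nu)$, $\rho(\lambda,\nu)=(\bar\lambda^{-1},-\bar\lambda^{1-g}\bar\nu)$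 and $\eta(\lambda,\nu)=(\bar\lambda^{-1},\bar\lambda^{1-g}\bar\nu)$. Let $(a_0,b_0)$ be spectral data of genus $g$ such that $a_0$ and $b_0$ have at least one common root. Let $U$ be an open neighbourhood of $(a_0,b_0)$ in the real vector space of pairs $(a,b)$ of complex polynomials with $\deg a\le 2g$, $\deg b\le g+1$, and let $c$ be a $C^\infty$ map (in the real sense) from $U$ to the complex polynomials of degree at most $g+1$, whose value $c=c(a,b)$ at all spectral data $(a,b)\in U$ satisfies the reality condition $\lambda^{g+1}\,\overline{c(\bar\lambda^{-1})}=c(\lambda)$ for $\lambda\ne0$. Assume that $c(a_0,b_0)$ does not vanish at any common root of $a_0$ and $b_0$. Then there are $\epsilon>0$ and a continuous curve $t\mapsto(a_t,b_t)\in U$, $t\in(-\epsilon,\epsilon)$, of spectral data of genus $g$, equal to $(a_0,b_0)$ at $t=0$ and $C^\infty$ on $(-\epsilon,\epsilon)\setminus\{0\}$, which for every $t\neq0$ is an integral curve of the Whitham flow induced by $c$, that is, with $a=a_t$, $b=b_t$, $c=c(a_t,b_t)$, with dots for $\partial_t$ and primes for $\partial_\lambda$, $$-2\dot b\,a+b\,\dot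 a=-2\lambda a c'+a c+\lambda a' c .$$ Moreover, for every $t\in(-\epsilon,\epsilon)\setminus\{0\}$ the polynomials $a_t$ and $b_t$ have no common root. -/

import Mathlib

open Polynomial
open scoped ComplexConjugate ContDiff Topology

noncomputable section

namespace WhithamFlow

/-- The polynomial `v 0 + v 1 λ + ⋯ + v (n-1) λ ^ (n-1)` with coefficient vector `v`. -/
def poly {n : ℕ} (v : Fin n → ℂ) : ℂ[X] := ∑ i : Fin n, C (v i) * X ^ (i : ℕ)

/-- Pairs `(a, b)` of complex polynomials with `deg a ≤ 2g` and `deg b ≤ g + 1`, given by their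
coefficients; this is a finite dimensional real normed space. -/
abbrev PolyPair (g : ℕ) : Type := (Fin (2 * g + 1) → ℂ) × (Fin (g + 2) → ℂ)

/-- The polynomial `a` of a pair `(a, b)`. -/
def aPoly {g : ℕ} (p : PolyPair g) : ℂ[X] := poly p.1

/-- The polynomial `b` of a pair `(a, b)`. -/
def bPoly {g : ℕ} (p : PolyPair g) : ℂ[X] := poly p.2

/-- The punctured affine spectral curve `Σ* = {(λ, ν) | λ ≠ 0, ν² = λ⁻¹ a(λ)}`. -/
def spectralCurve (a : ℂ[X]) : Set (ℂ × ℂ) :=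
  {q | q.1 ≠ 0 ∧ q.2 ^ 2 = q.1⁻¹ * a.eval q.1}

/-- The hyperelliptic involution `(λ, ν) ↦ (λ, -ν)`. -/
def sigmaInv (q : ℂ × ℂ) : ℂ × ℂ := (q.1, -q.2)

/-- The antiholomorphic involution `(λ, ν) ↦ (1 / conj λ, -(conj λ) ^ (1 - g) * conj ν)`. -/
def rhoInv (g : ℕ) (q : ℂ × ℂ) : ℂ × ℂ :=
  ((conj q.1)⁻¹, -((conj q.1) ^ (1 - (g : ℤ)) * conj q.2))

/-- The antiholomorphic involution `(λ, ν) ↦ (1 / conj λ, (conj λ) ^ (1 - g) * conj ν)`. -/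
def etaInv (g : ℕ) (q : ℂ × ℂ) : ℂ × ℂ :=
  ((conj q.1)⁻¹, (conj q.1) ^ (1 - (g : ℤ)) * conj q.2)

/-- `μ` is a single valued monodromy eigenvalue on the spectral curve of `a` with
`d ln μ = b dλ / (ν λ²)`. The last field expresses this identity in the local coordinate `λ`,
along every local holomorphic branch `ν` of `√(λ⁻¹ a(λ))` at points that are not branch points. -/
structure IsMonodromyEigenvalue (g : ℕ) (a b : ℂ[X]) (μ : ℂ × ℂ → ℂ) : Prop where
  holomorphic : ∃ f k : ℂ → ℂ, DifferentiableOn ℂ f {z | z ≠ 0} ∧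
    DifferentiableOn ℂ k {z | z ≠ 0} ∧ ∀ q ∈ spectralCurve a, μ q = f q.1 * q.2 + k q.1
  ne_zero : ∀ q ∈ spectralCurve a, μ q ≠ 0
  sigma : ∀ q ∈ spectralCurve a, μ (sigmaInv q) = (μ q)⁻¹
  rho : ∀ q ∈ spectralCurve a, μ (rhoInv g q) = (conj (μ q))⁻¹
  eta : ∀ q ∈ spectralCurve a, μ (etaInv g q) = conj (μ q)
  branch : ∀ z : ℂ, z ≠ 0 → a.eval z = 0 → μ (z, 0) = 1 ∨ μ (z, 0) = -1
  dlog : ∀ (z : ℂ) (ν : ℂ → ℂ), AnalyticAt ℂ ν z → ν z ≠ 0 →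
    (∀ᶠ w in 𝓝 z, (w, ν w) ∈ spectralCurve a) →
      HasDerivAt (fun w => μ (w, ν w)) (μ (z, ν z) * (b.eval z / (ν z * z ^ 2))) z

/-- Spectral data `(a, b)` of genus `g` of a periodic solution of the sinh-Gordon equation, with
non-singular spectral curve (`a` has only simple roots). -/
structure IsSpectralData (g : ℕ) (p : PolyPair g) : Prop where
  degree_a : (aPoly p).natDegree = 2 * g
  degree_b : (bPoly p).natDegree = g + 1
  norm_a : ‖(aPoly p).eval 0‖ = 1 / 16
  real_a : ∀ z : ℂ, z ≠ 0 → z ^ (2 * g) * conj ((aPoly p).eval (conj z)⁻¹) = (aPoly p).eval z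
  nonpos_a : ∀ z : ℂ, ‖z‖ = 1 →
    ((z ^ g)⁻¹ * (aPoly p).eval z).im = 0 ∧ ((z ^ g)⁻¹ * (aPoly p).eval z).re ≤ 0
  simple_a : ∀ z : ℂ, (aPoly p).eval z = 0 → (derivative (aPoly p)).eval z ≠ 0
  real_b : ∀ z : ℂ, z ≠ 0 → z ^ (g + 1) * conj ((bPoly p).eval (conj z)⁻¹) = -(bPoly p).eval z
  periodic : ∃ μ : ℂ × ℂ → ℂ, IsMonodromyEigenvalue g (aPoly p) (bPoly p) μ

/-- The reality condition `λ ^ (g+1) * conj (c (1 / conj λ)) = c λ` for a polynomial `c` of degree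
at most `g + 1`, given by its coefficients. -/
def IsRealC (g : ℕ) (c : Fin (g + 2) → ℂ) : Prop :=
  ∀ z : ℂ, z ≠ 0 → z ^ (g + 1) * conj ((poly c).eval (conj z)⁻¹) = (poly c).eval z

/-- The Whitham equation `-2 ḃ a + b ȧ = -2 λ a c' + a c + λ a' c` for a tangent vector
`v = (ȧ, ḃ)` at `p = (a, b)`. -/
def WhithamEq {g : ℕ} (c : Fin (g + 2) → ℂ) (p v : PolyPair g) : Prop :=
  -2 * bPoly v * aPoly p + bPoly p * aPoly v =
    -2 * X * aPoly p * derivative (poly c) + aPoly p * poly c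
      + X * derivative (aPoly p) * poly c

/-- `z` is a common root of `a` and `b`. -/
def IsCommonRoot {g : ℕ} (p : PolyPair g) (z : ℂ) : Prop :=
  (aPoly p).eval z = 0 ∧ (bPoly p).eval z = 0

end WhithamFlow

end

noncomputable section

namespace WhithamFlow

/-! ### Existence for differential equations that are singular at the initial time -/

section Peano

open MeasureTheory Set Filter

variable {E : Type*} [NormedAddCommGroup E] {f : ℝ → E → E} {T M : ℝ}

/-! Normal form. The coordinate `moebius λ` carries the unit circle to the real line. In it the
roots of `a` form pairs r_j, conj r_j that determine `a`, and `b` becomes, up to the factor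
`rootScale r * I`, a real polynomial F (`IsSpectralData.exists_pairOf`). The Whitham equation
follows from r_i' F(r_i) = -(1/2)(1 + r_i²) K(r_i) and F' = `fieldVec r K` - (1/2) Σ r_i' D_{r_i} F,
where D_ρ is the divided difference at ρ and K comes from `c` (`whithamEq_pairOf`). Common roots of
`a` and `b` are the zeros F(r_i) = 0, where the velocity r_i' is singular.

Desingularisation. Write r = r₀ + x and F = ∏ (1 - x_i D_{r₀,i})^(1/2) w, the product running over
all roots and their conjugates. The resolvent identity for divided differences gives ∂F/∂x_i =
-(1/2) D_{r_i} F at fixed w (`hasDerivAt_rootTwist`). Hence the singular velocities cancel from the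
equation for w, whose right hand side is smooth in (x, w). What remains singular is x_j' F(r_j) =
N_j, and N_j(0) ≠ 0 at the common roots by the hypothesis on `c`.

Leading order. Let d_j be the multiplicity of r₀,j as a root of F₀. Then F(r_j) = x_j^(d_j) k_j up
to O(Σ |x_i|^(d_i + 1) + |w - F₀|), and k_j has a nonzero limit because the partial sums of the
Taylor coefficients of (1 - Y)^(1/2) do not vanish (`exists_eval_twisted_asymptotics`). So x_j^(d_j
+ 1) should grow linearly in t. After the substitution x_j^(d_j + 1) = t u_j the right hand side is
bounded and continuous for t > 0, and Peano's theorem in a narrow cone gives a solution leaving the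
origin (`exists_singular_solution`). Uniqueness is not needed. This solution has F(r_j) ≠ 0 for t >
0, so the common roots disappear at once.

Periods. The algebraic conditions on spectral data are built into the normal form, apart from open
conditions. The function μ is transported: away from the roots of `a` one integrates ∂ₜ ln μ = c /
(ν λ) (`exists_transported_dlog`), and across small discs around the moving roots μ extends because
there it agrees up to sign with the exponential of an odd function (`exists_extension_to_ball`). The
antiholomorphic symmetries hold on the unit circle and spread by the identity theorem
(`exists_isMonodromyEigenvalue_of_whitham`). Negative times come from the same construction for
`-c`, run backwards. -/

lemma intervalIntegrable_comp_of_bounded (hf : ContinuousOn (Function.uncurry f) (Ioc 0 T ×ˢ univ))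
    (hM : ∀ t ∈ Ioc 0 T, ∀ u, ‖f t u‖ ≤ M) {y : ℝ → E} (hy : ContinuousOn y (Ioc 0 T)) {a b : ℝ}
    (ha : a ∈ Icc 0 T) (hb : b ∈ Icc 0 T) :
    IntervalIntegrable (fun τ => f τ (y τ)) volume a b := by
  have hsub : Set.uIoc a b ⊆ Ioc 0 T := by
    intro x hx
    rw [Set.uIoc, Set.mem_Ioc] at hx
    exact ⟨lt_of_le_of_lt (le_min ha.1 hb.1) hx.1, hx.2.trans (max_le ha.2 hb.2)⟩
  have hc : ContinuousOn (fun τ => f τ (y τ)) (Ioc 0 T) :=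
    hf.comp (continuousOn_id.prodMk hy) fun x hx => ⟨hx, mem_univ _⟩
  rw [intervalIntegrable_iff]
  refine IntegrableOn.of_bound (C := M) (by simp [Set.uIoc]) ?_ ?_
  · exact ((hc.mono hsub).aestronglyMeasurable measurableSet_uIoc)
  · exact (ae_restrict_mem measurableSet_uIoc).mono fun x hx => hM x (hsub hx) _

variable [NormedSpace ℝ E]

/-- The integral operator with delay `h` whose iterates stabilise to the Tonelli approximations of a
solution of `y' = f t y`, `y 0 = 0`. -/
def tonelliStep (f : ℝ → E → E) (T h : ℝ) (y : ℝ → E) (t : ℝ) : E :=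
  ∫ τ in (0 : ℝ)..(max 0 (min t T)), f τ (y (τ - h))

/-- The bound `M` on `f` bounds the slope, and clamping the upper limit to `[0, T]` is 1-Lipschitz.
The constant does not depend on `h`, which later gives equicontinuity. -/
lemma tonelliStep_lipschitz (hT : 0 < T)
    (hf : ContinuousOn (Function.uncurry f) (Ioc 0 T ×ˢ univ))
    (hM : ∀ t ∈ Ioc 0 T, ∀ u, ‖f t u‖ ≤ M) {y : ℝ → E} (hy : Continuous y) (h s t : ℝ) :
    ‖tonelliStep f T h y t - tonelliStep f T h y s‖ ≤ M * |t - s| := by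
  have hM0 : 0 ≤ M := (norm_nonneg _).trans (hM T ⟨hT, le_rfl⟩ 0)
  have hcl : ∀ r : ℝ, max 0 (min r T) ∈ Icc 0 T := fun r =>
    ⟨le_max_left _ _, max_le hT.le (min_le_right _ _)⟩
  have hy' : ContinuousOn (fun τ => y (τ - h)) (Ioc 0 T) := by fun_prop
  have hint : ∀ r : ℝ, IntervalIntegrable (fun τ => f τ (y (τ - h))) volume 0 (max 0 (min r T)) :=
    fun r => intervalIntegrable_comp_of_bounded (f := f) hf hM hy' ⟨le_rfl, hT.le⟩ (hcl r)
  rw [tonelliStep, tonelliStep, intervalIntegral.integral_interval_sub_left (hint t) (hint s)]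
  refine (intervalIntegral.norm_integral_le_of_norm_le_const (C := M) fun x hx => ?_).trans ?_
  · refine hM x ?_ _
    rw [Set.uIoc, Set.mem_Ioc] at hx
    exact ⟨lt_of_le_of_lt (le_min (hcl _).1 (hcl _).1) hx.1, hx.2.trans (max_le (hcl _).2 (hcl _).2)⟩
  · refine mul_le_mul_of_nonneg_left ?_ hM0
    refine (abs_max_sub_max_le_max _ _ _ _).trans (max_le (by simp) ?_)
    exact (abs_min_sub_min_le_max _ _ _ _).trans (max_le le_rfl (by simp))

/-- Continuous solutions of the delay equation `y' = f t (y (t - h))`. -/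
lemma exists_delay_solution (hT : 0 < T)
    (hf : ContinuousOn (Function.uncurry f) (Ioc 0 T ×ˢ univ))
    (hM : ∀ t ∈ Ioc 0 T, ∀ u, ‖f t u‖ ≤ M) {h : ℝ} (hh : 0 < h) :
    ∃ y : ℝ → E, (∀ s t, ‖y t - y s‖ ≤ M * |t - s|) ∧ y 0 = 0 ∧
      ∀ t ∈ Icc 0 T, y t = ∫ τ in (0 : ℝ)..t, f τ (y (τ - h)) := by
  have hM0 : 0 ≤ M := (norm_nonneg _).trans (hM T ⟨hT, le_rfl⟩ 0)
  set Z : ℕ → ℝ → E := fun k => (tonelliStep f T h)^[k] 0 with hZ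
  have hZs : ∀ k, Z (k + 1) = tonelliStep f T h (Z k) := fun k =>
    Function.iterate_succ_apply' _ _ _
  have hcont : ∀ k, (∀ s t, ‖Z k t - Z k s‖ ≤ M * |t - s|) ∧ Continuous (Z k) := by
    have key : ∀ y : ℝ → E, (∀ s t, ‖y t - y s‖ ≤ M * |t - s|) → Continuous y := by
      intro y hy
      refine (LipschitzWith.of_dist_le_mul (K := M.toNNReal) fun s t => ?_).continuous
      rw [dist_eq_norm, Real.dist_eq, Real.coe_toNNReal _ hM0]
      exact hy t s
    intro k
    induction k with
    | zero =>
      refine ⟨fun s t => ?_, continuous_const⟩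
      simpa [hZ] using mul_nonneg hM0 (abs_nonneg _)
    | succ k ih =>
      have h1 : ∀ s t, ‖Z (k + 1) t - Z (k + 1) s‖ ≤ M * |t - s| := by
        intro s t
        rw [hZs]
        exact tonelliStep_lipschitz hT hf hM ih.2 h s t
      exact ⟨h1, key _ h1⟩
  -- Because of the delay, the values up to time (k + 1) h only involve the previous iterate up to
  -- time k h, so each iteration settles one more interval of length h.
  have hstab : ∀ k : ℕ, ∀ t ≤ k * h, Z (k + 1) t = Z k t := by
    intro k
    induction k with
    | zero =>
      intro t ht
      have : max 0 (min t T) = 0 := max_eq_left ((min_le_left _ _).trans (by simpa using ht))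
      simp [hZ, tonelliStep, this]
    | succ k ih =>
      intro t ht
      rw [hZs (k + 1), hZs k, tonelliStep, tonelliStep]
      refine intervalIntegral.integral_congr fun τ hτ => ?_
      rw [Set.uIcc_of_le (le_max_left _ _)] at hτ
      have h0 : τ ≤ (k + 1) * h := by
        refine hτ.2.trans (max_le (by positivity) ((min_le_left _ _).trans (by simpa using ht)))
      rw [← hZs k, ih (τ - h) (by linarith)]
  obtain ⟨k, hk⟩ := exists_nat_gt (T / h)
  rw [div_lt_iff₀ hh] at hk
  have hmain : ∀ t ≤ T, Z k t = ∫ τ in (0 : ℝ)..(max 0 (min t T)), f τ (Z k (τ - h)) := by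
    intro t ht
    rw [← hstab k t (ht.trans hk.le), hZs]
    rfl
  refine ⟨Z k, (hcont k).1, ?_, fun t ht => ?_⟩
  · rw [hmain 0 hT.le]
    simp [hT.le]
  · have := hmain t ht.2
    rwa [min_eq_left ht.2, max_eq_right ht.1] at this

/-- Peano's existence theorem for a right hand side that is bounded, and continuous for positive
times only. -/
theorem exists_peano_solution [FiniteDimensional ℝ E] (hT : 0 < T)
    (hf : ContinuousOn (Function.uncurry f) (Ioc 0 T ×ˢ univ))
    (hM : ∀ t ∈ Ioc 0 T, ∀ u, ‖f t u‖ ≤ M) :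
    ∃ y : ℝ → E, (∀ t ∈ Icc 0 T, ‖y t‖ ≤ M * t) ∧
      ∀ t ∈ Ioo 0 T, HasDerivAt y (f t (y t)) t := by
  have hM0 : 0 ≤ M := (norm_nonneg _).trans (hM T ⟨hT, le_rfl⟩ 0)
  choose y hyl hy0 hyi using fun n : ℕ =>
    exists_delay_solution hT hf hM (h := 1 / ((n : ℝ) + 1)) (by positivity)
  have hylip : ∀ n, LipschitzWith M.toNNReal (y n) := fun n =>
    LipschitzWith.of_dist_le_mul fun s t => by
      rw [dist_eq_norm, Real.dist_eq, Real.coe_toNNReal _ hM0]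
      exact hyl n t s
  have hyc : ∀ n, Continuous (y n) := fun n => (hylip n).continuous
  -- Arzelà–Ascoli applies to the restrictions to [0, T]; the limit is extended constantly outside
  -- by `projIcc`.
  let Y : ℕ → BoundedContinuousFunction (Icc (0 : ℝ) T) E := fun n =>
    BoundedContinuousFunction.mkOfCompact ⟨fun x => y n x, (hyc n).comp continuous_subtype_val⟩
  have hb : ∀ n, ∀ t ∈ Icc 0 T, ‖y n t‖ ≤ M * t := by
    intro n t ht
    have := hyl n 0 t
    rwa [hy0, sub_zero, sub_zero, abs_of_nonneg ht.1] at this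
  have hcomp : IsCompact (closure (Set.range Y)) := by
    refine BoundedContinuousFunction.arzela_ascoli (Metric.closedBall (0 : E) (M * T))
      (isCompact_closedBall _ _) _ ?_ ?_
    · rintro _ x ⟨n, rfl⟩
      rw [mem_closedBall_zero_iff]
      exact (hb n x x.2).trans (mul_le_mul_of_nonneg_left x.2.2 hM0)
    · refine (LipschitzWith.uniformEquicontinuous _ M.toNNReal ?_).equicontinuous
      rintro ⟨_, n, rfl⟩
      exact LipschitzWith.of_dist_le_mul fun s t => (hylip n).dist_le_mul s t
  obtain ⟨Z, -, φ, hφ, hZ⟩ := hcomp.tendsto_subseq (x := Y) fun n =>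
    subset_closure ⟨n, rfl⟩
  have hpt : ∀ t (ht : t ∈ Icc 0 T), Tendsto (fun n => y (φ n) t) atTop (𝓝 (Z ⟨t, ht⟩)) := by
    intro t ht
    exact ((BoundedContinuousFunction.lipschitz_eval_const
      (⟨t, ht⟩ : Icc (0 : ℝ) T)).continuous.tendsto Z).comp hZ
  set w : ℝ → E := fun t => Z (Set.projIcc 0 T hT.le t) with hw
  have hwc : Continuous w := Z.continuous.comp continuous_projIcc
  have hwt : ∀ t (ht : t ∈ Icc 0 T), w t = Z ⟨t, ht⟩ := fun t ht => by
    simp only [hw, Set.projIcc_of_mem hT.le ht]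
  have hwint : ∀ t ∈ Icc 0 T, w t = ∫ τ in (0 : ℝ)..t, f τ (w τ) := by
    intro t ht
    have hsub : Set.uIoc 0 t ⊆ Ioc 0 T := by
      rw [Set.uIoc_of_le ht.1]; exact Set.Ioc_subset_Ioc_right ht.2
    have hlim : Tendsto (fun n => ∫ τ in (0 : ℝ)..t,
        f τ (y (φ n) (τ - 1 / ((φ n : ℝ) + 1)))) atTop (𝓝 (∫ τ in (0 : ℝ)..t, f τ (w τ))) := by
      refine intervalIntegral.tendsto_integral_filter_of_dominated_convergence (fun _ => M)
        (Eventually.of_forall fun n => ?_) (Eventually.of_forall fun n => ?_) ?_ ?_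
      · have := intervalIntegrable_comp_of_bounded (f := f) hf hM
          (y := fun τ => y (φ n) (τ - 1 / ((φ n : ℝ) + 1)))
          ((hyc (φ n)).comp (by fun_prop)).continuousOn ⟨le_rfl, hT.le⟩ ht
        exact (intervalIntegrable_iff.1 this).aestronglyMeasurable
      · exact Eventually.of_forall fun x hx => hM x (hsub hx) _
      · simp
      · refine Eventually.of_forall fun τ hτ => ?_
        have hτ' := hsub hτ
        have hτc : τ ∈ Icc 0 T := Set.Ioc_subset_Icc_self hτ'
        -- The common Lipschitz constant makes the vanishing delay harmless in the limit.
        have h1 : Tendsto (fun n => y (φ n) (τ - 1 / ((φ n : ℝ) + 1))) atTop (𝓝 (w τ)) := by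
          have h2 : Tendsto (fun n => M * (1 / ((φ n : ℝ) + 1))) atTop (𝓝 0) := by
            have := (tendsto_one_div_add_atTop_nhds_zero_nat (𝕜 := ℝ)).comp hφ.tendsto_atTop
            simpa using this.const_mul M
          have h3 : Tendsto (fun n => y (φ n) (τ - 1 / ((φ n : ℝ) + 1)) - y (φ n) τ) atTop
              (𝓝 0) := by
            refine squeeze_zero_norm (fun n => ?_) h2
            refine (hyl _ _ _).trans (mul_le_mul_of_nonneg_left (le_of_eq ?_) hM0)
            rw [sub_sub_cancel_left, abs_neg, abs_of_pos (by positivity)]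
          have := h3.add (hpt τ hτc)
          rw [hwt τ hτc]
          simpa using this
        have hfc : Tendsto (Function.uncurry f) (𝓝[Ioc 0 T ×ˢ univ] (τ, w τ)) (𝓝 (f τ (w τ))) :=
          hf (τ, w τ) ⟨hτ', mem_univ _⟩
        refine hfc.comp (tendsto_nhdsWithin_iff.2 ⟨tendsto_const_nhds.prodMk_nhds h1, ?_⟩)
        exact Eventually.of_forall fun n => ⟨hτ', mem_univ _⟩
    have h1 : Tendsto (fun n => y (φ n) t) atTop (𝓝 (w t)) := by
      rw [hwt t ht]; exact hpt t ht
    refine tendsto_nhds_unique h1 (hlim.congr fun n => ?_)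
    rw [hyi (φ n) t ht]
  refine ⟨w, fun t ht => ?_, fun t ht => ?_⟩
  · rw [hwt t ht]
    exact le_of_tendsto (hpt t ht).norm (Eventually.of_forall fun n => hb _ t ht)
  · have hIoo : Ioo 0 T ∈ 𝓝 t := isOpen_Ioo.mem_nhds ht
    have hcont : ContinuousOn (fun τ => f τ (w τ)) (Ioc 0 T) :=
      hf.comp (continuousOn_id.prodMk hwc.continuousOn) fun x hx => ⟨hx, mem_univ _⟩
    have hcat : ContinuousOn (fun τ => f τ (w τ)) (Ioo 0 T) := hcont.mono Ioo_subset_Ioc_self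
    have hd := intervalIntegral.integral_hasDerivAt_right (a := 0) (b := t)
      (f := fun τ => f τ (w τ))
      (intervalIntegrable_comp_of_bounded hf hM hwc.continuousOn ⟨le_rfl, hT.le⟩
        (Ioo_subset_Icc_self ht))
      (hcat.stronglyMeasurableAtFilter isOpen_Ioo t ht) (hcat.continuousAt hIoo)
    refine hd.congr_of_eventuallyEq ?_
    filter_upwards [hIoo] with s hs using hwint s (Ioo_subset_Icc_self hs)

/-- The radial retraction of a normed space onto a closed ball. -/
def ballRetract (V : E) (ε : ℝ) (u : E) : E := V + (ε / max ε ‖u - V‖) • (u - V)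

lemma continuous_ballRetract (V : E) {ε : ℝ} (hε : 0 < ε) : Continuous (ballRetract V ε) := by
  unfold ballRetract
  have : ∀ u : E, max ε ‖u - V‖ ≠ 0 := fun u => (lt_max_of_lt_left hε).ne'
  fun_prop (disch := exact this _)

lemma ballRetract_mem (V : E) {ε : ℝ} (hε : 0 < ε) (u : E) :
    ballRetract V ε u ∈ Metric.closedBall V ε := by
  have h0 : 0 < max ε ‖u - V‖ := lt_max_of_lt_left hε
  rw [mem_closedBall_iff_norm, ballRetract, add_sub_cancel_left, norm_smul, Real.norm_eq_abs,
    abs_of_nonneg (by positivity), div_mul_eq_mul_div, div_le_iff₀ h0]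
  exact mul_le_mul_of_nonneg_left (le_max_right _ _) hε.le

lemma ballRetract_of_mem {V : E} {ε : ℝ} (hε : 0 < ε) {u : E} (hu : u ∈ Metric.closedBall V ε) :
    ballRetract V ε u = u := by
  rw [mem_closedBall_iff_norm] at hu
  rw [ballRetract, max_eq_left hu, div_self hε.ne', one_smul, add_sub_cancel]

/-- A solution of `w' = Φ t (w / t)` inside the cone `‖w - t V‖ ≤ ε t`, on which the right hand side
is continuous away from the vertex and `ε`-close to `V`. -/
theorem exists_solution_in_cone [FiniteDimensional ℝ E] {Φ : ℝ → E → E} {V : E} {ε : ℝ}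
    (hε : 0 < ε) (hT : 0 < T)
    (hΦ : ContinuousOn (Function.uncurry Φ) (Ioc 0 T ×ˢ Metric.closedBall V ε))
    (hV : ∀ t ∈ Ioc 0 T, ∀ u ∈ Metric.closedBall V ε, ‖Φ t u - V‖ ≤ ε) :
    ∃ w : ℝ → E, (∀ t ∈ Ioo 0 T, t⁻¹ • w t ∈ Metric.closedBall V ε) ∧
      ∀ t ∈ Ioo 0 T, HasDerivAt w (Φ t (t⁻¹ • w t)) t := by
  have h1 : ContinuousOn (fun p : ℝ × E => (p.1, ballRetract V ε (V + p.1⁻¹ • p.2)))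
      (Ioc 0 T ×ˢ univ) := by
    refine continuousOn_fst.prodMk ((continuous_ballRetract V hε).comp_continuousOn ?_)
    refine continuousOn_const.add (ContinuousOn.smul ?_ continuousOn_snd)
    exact continuousOn_fst.inv₀ fun p hp => hp.1.1.ne'
  -- The unknown is y = w - t V. Its slope is at most ε, so y stays within ε t of 0, which is
  -- exactly the cone; the retraction is therefore inactive along the solution.
  obtain ⟨y, hy, hyd⟩ := exists_peano_solution (T := T) (M := ε)
    (f := fun t y => Φ t (ballRetract V ε (V + t⁻¹ • y)) - V) hT
    ((hΦ.comp h1 fun p hp => ⟨hp.1, ballRetract_mem V hε _⟩).sub continuousOn_const)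
    fun t ht u => hV t ht _ (ballRetract_mem V hε _)
  have key : ∀ t ∈ Ioo 0 T, t⁻¹ • (t • V + y t) = V + t⁻¹ • y t := fun t ht => by
    rw [smul_add, smul_smul, inv_mul_cancel₀ ht.1.ne', one_smul]
  have hmem : ∀ t ∈ Ioo 0 T, V + t⁻¹ • y t ∈ Metric.closedBall V ε := by
    intro t ht
    rw [mem_closedBall_iff_norm, add_sub_cancel_left, norm_smul, norm_inv, Real.norm_eq_abs,
      abs_of_pos ht.1, inv_mul_le_iff₀ ht.1, mul_comm]
    exact hy t (Ioo_subset_Icc_self ht)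
  refine ⟨fun t => t • V + y t, fun t ht => ?_, fun t ht => ?_⟩
  · rw [key t ht]; exact hmem t ht
  · have h1 := ((hasDerivAt_id t).smul_const V).add (hyd t ht)
    rw [key t ht]
    rw [ballRetract_of_mem hε (hmem t ht), one_smul, add_sub_cancel] at h1
    exact h1

/-- Solutions of an autonomous smooth differential equation are smooth. -/
lemma contDiffOn_of_hasDerivAt {y : ℝ → E} {G : E → E} {O : Set E} {s : Set ℝ} (hs : IsOpen s)
    (hG : ContDiffOn ℝ ∞ G O) (hy : ∀ t ∈ s, y t ∈ O)
    (hd : ∀ t ∈ s, HasDerivAt y (G (y t)) t) : ContDiffOn ℝ ∞ y s := by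
  rw [contDiffOn_infty]
  intro n
  induction n with
  | zero =>
    exact contDiffOn_zero.2 fun t ht => (hd t ht).continuousAt.continuousWithinAt
  | succ n ih =>
    rw [show ((n + 1 : ℕ) : WithTop ℕ∞) = (n : WithTop ℕ∞) + 1 by norm_cast,
      contDiffOn_succ_iff_deriv_of_isOpen hs]
    refine ⟨fun t ht => (hd t ht).differentiableAt.differentiableWithinAt, by simp, ?_⟩
    -- Bootstrapping: if y is of class C^n, so is its derivative G ∘ y.
    refine ((hG.of_le (by exact_mod_cast le_top)).comp ih hy).congr fun t ht => (hd t ht).deriv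

end Peano

/-! ### Blow-up of a singular system at its initial point -/

section SingularODE

open Set Filter Asymptotics

/-- A holomorphic branch of the root `u ↦ u ^ (1 / (d + 1))` near a closed ball around `V` that
avoids the origin if `d ≠ 0`. -/
lemma exists_root_branch (d : ℕ) (V : ℂ) {ε : ℝ} (hε : d ≠ 0 → ε < ‖V‖) :
    ∃ ψ : ℂ → ℂ, ∀ u ∈ Metric.closedBall V ε, DifferentiableAt ℂ ψ u ∧ ψ u ^ (d + 1) = u := by
  -- For d = 0 no root has to be extracted, and the ball may contain the origin.
  by_cases hd : d = 0
  · subst hd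
    exact ⟨id, fun u _ => ⟨differentiableAt_id, by simp⟩⟩
  have hpow : ∀ z : ℂ, (z ^ (((d + 1 : ℕ) : ℂ)⁻¹)) ^ (d + 1) = z := fun z =>
    Complex.cpow_nat_inv_pow z (Nat.succ_ne_zero d)
  refine ⟨fun u => V ^ (((d + 1 : ℕ) : ℂ)⁻¹) * (u / V) ^ (((d + 1 : ℕ) : ℂ)⁻¹), fun u hu => ?_⟩
  rw [mem_closedBall_iff_norm] at hu
  have hlt := hu.trans_lt (hε hd)
  have hV : V ≠ 0 := fun h => by simp [h] at hlt; linarith [norm_nonneg u]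
  have hslit : u / V ∈ Complex.slitPlane := by
    refine Complex.ball_one_subset_slitPlane ?_
    rw [mem_ball_iff_norm, div_sub_one hV, norm_div, div_lt_one (norm_pos_iff.2 hV)]
    exact hlt
  refine ⟨?_, ?_⟩
  · have : DifferentiableAt ℂ (fun u : ℂ => u / V) u := by fun_prop
    exact (this.cpow_const hslit).const_mul _
  · rw [mul_pow, hpow, hpow, mul_div_cancel₀ _ hV]

variable {ι E : Type*} [NormedAddCommGroup E] [NormedSpace ℝ E]

/-- The blow up `(t, u) ↦ (x, e)` with `x i ^ (d i + 1) = t * u i` and `e = t • u`. -/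
def blowUp (d : ι → ℕ) (ψ : ι → ℂ → ℂ) (q : ℝ × ((ι → ℂ) × E)) : (ι → ℂ) × E :=
  (fun i => ((q.1 ^ ((d i : ℝ) + 1)⁻¹ : ℝ) : ℂ) * ψ i (q.2.1 i), q.1 • q.2.2)

lemma blowUp_pow {d : ι → ℕ} {ψ : ι → ℂ → ℂ} {q : ℝ × ((ι → ℂ) × E)} (hq : 0 ≤ q.1) (i : ι)
    (hψ : ψ i (q.2.1 i) ^ (d i + 1) = q.2.1 i) :
    (blowUp d ψ q).1 i ^ (d i + 1) = q.1 * q.2.1 i := by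
  rw [blowUp, mul_pow, hψ]
  congr 1
  rw [← Complex.ofReal_pow, ← Real.rpow_natCast, ← Real.rpow_mul hq]
  push_cast
  rw [inv_mul_cancel₀ (by positivity), Real.rpow_one]

variable [Fintype ι] [FiniteDimensional ℝ E]

/-- Solutions emanating from the origin of the singular system `x i' * β i = N i`, `e' = Y`, where
`β i` vanishes to order `d i` along `x i` up to a remainder that is of first order in time. -/
theorem exists_singular_solution (d : ι → ℕ) {O : Set ((ι → ℂ) × E)} (hO : IsOpen O)
    (h0 : (0 : (ι → ℂ) × E) ∈ O) {β N : (ι → ℂ) × E → ι → ℂ} {Y : (ι → ℂ) × E → E}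
    (hβ : ContDiffOn ℝ ∞ β O) (hN : ContDiffOn ℝ ∞ N O) (hY : ContDiffOn ℝ ∞ Y O)
    {κ : ι → ℂ} (hκ : ∀ i, κ i ≠ 0) (hN0 : ∀ i, d i ≠ 0 → N 0 i ≠ 0)
    {k : ι → (ι → ℂ) × E → ℂ} (hk : ∀ i, Tendsto (k i) (𝓝 0) (𝓝 (κ i)))
    (hβk : ∀ i, (fun p => β p i - p.1 i ^ d i * k i p) =O[𝓝 0]
      fun p => ∑ j, ‖p.1 j‖ ^ (d j + 1) + ‖p.2‖) :
    ∃ T > 0, ∃ y : ℝ → (ι → ℂ) × E, y 0 = 0 ∧ ContinuousOn y (Ico 0 T) ∧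
      ContDiffOn ℝ ∞ y (Ioo 0 T) ∧ ∀ t ∈ Ioo 0 T, y t ∈ O ∧ (∀ i, β (y t) i ≠ 0) ∧
        HasDerivAt y (fun i => N (y t) i / β (y t) i, Y (y t)) t := by
  classical
  -- The leading order balance κ x^d x' = N(0) gives (x^(d + 1))' = (d + 1) N(0) / κ: this is the
  -- axis of the cone.
  set V : (ι → ℂ) × E := (fun i => ((d i : ℂ) + 1) * (N 0 i / κ i), Y 0) with hV
  have hV0 : ∀ i, d i ≠ 0 → V.1 i ≠ 0 := fun i hi =>
    mul_ne_zero (Nat.cast_add_one_ne_zero (d i)) (div_ne_zero (hN0 i hi) (hκ i))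
  obtain ⟨ε, hε, hεV⟩ : ∃ ε > 0, ∀ i, d i ≠ 0 → ε < ‖V.1 i‖ := by
    have : ∀ᶠ ε in 𝓝[>] (0 : ℝ), ∀ i, d i ≠ 0 → ε < ‖V.1 i‖ := by
      rw [eventually_all]
      intro i
      by_cases hi : d i = 0
      · simp [hi]
      · exact ((eventually_lt_nhds (norm_pos_iff.2 (hV0 i hi))).filter_mono
          nhdsWithin_le_nhds).mono fun ε h _ => h
    obtain ⟨ε, h1, h2⟩ := (this.and self_mem_nhdsWithin).exists
    exact ⟨ε, h2, h1⟩
  choose ψ hψ using fun i => exists_root_branch (d i) (V.1 i) (hεV i)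
  have hball : ∀ u ∈ Metric.closedBall V ε, ∀ i, u.1 i ∈ Metric.closedBall (V.1 i) ε := by
    intro u hu i
    rw [mem_closedBall_iff_norm] at hu ⊢
    exact ((norm_le_pi_norm (u.1 - V.1) i).trans (norm_fst_le (u - V))).trans hu
  set Ξ := blowUp (E := E) d ψ with hΞ
  have hpow : ∀ t ≥ 0, ∀ u ∈ Metric.closedBall V ε, ∀ i,
      (Ξ (t, u)).1 i ^ (d i + 1) = t * u.1 i := fun t ht u hu i =>
    blowUp_pow ht i (hψ i _ (hball u hu i)).2
  -- Limits along `l` are limits as t ↓ 0, uniform over u in the ball.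
  set l : Filter (ℝ × ((ι → ℂ) × E)) := 𝓝[>] 0 ×ˢ 𝓟 (Metric.closedBall V ε) with hl
  have hlt : Tendsto (fun q : ℝ × ((ι → ℂ) × E) => q.1) l (𝓝 0) :=
    (tendsto_fst (f := 𝓝[>] (0 : ℝ))).mono_right nhdsWithin_le_nhds
  have hlpos : ∀ᶠ q in l, 0 < q.1 ∧ q.2 ∈ Metric.closedBall V ε := by
    rw [hl, eventually_prod_principal_iff]
    filter_upwards [self_mem_nhdsWithin] with t ht u hu using ⟨ht, hu⟩
  have hubd : ∀ u ∈ Metric.closedBall V ε, ‖u‖ ≤ ‖V‖ + ε := fun u hu => by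
    have := norm_le_norm_add_norm_sub' u V
    rw [mem_closedBall_iff_norm] at hu
    linarith
  have hxO : ∀ i, (fun q => ‖(Ξ q).1 i‖ ^ (d i + 1)) =O[l] fun q => q.1 := by
    intro i
    refine IsBigO.of_bound (‖V‖ + ε) ?_
    filter_upwards [hlpos] with q hq
    rw [← norm_pow, hpow q.1 hq.1.le q.2 hq.2 i, norm_norm, norm_mul, Complex.norm_real, mul_comm]
    exact mul_le_mul_of_nonneg_right (((norm_le_pi_norm q.2.1 i).trans (norm_fst_le q.2)).trans
      (hubd q.2 hq.2)) (norm_nonneg _)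
  have hx0 : ∀ i, Tendsto (fun q => (Ξ q).1 i) l (𝓝 0) := by
    intro i
    have h1 := (hxO i).trans_tendsto hlt
    rw [tendsto_zero_iff_norm_tendsto_zero]
    have h2 := h1.rpow_const (p := ((d i : ℝ) + 1)⁻¹) (Or.inr (by positivity))
    rw [Real.zero_rpow (by positivity)] at h2
    refine h2.congr fun q => ?_
    rw [← Real.rpow_natCast, ← Real.rpow_mul (norm_nonneg _)]
    push_cast
    rw [mul_inv_cancel₀ (by positivity), Real.rpow_one]
  have heO : (fun q => ‖(Ξ q).2‖) =O[l] fun q => q.1 := by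
    refine IsBigO.of_bound (‖V‖ + ε) ?_
    filter_upwards [hlpos] with q hq
    rw [norm_norm, hΞ, blowUp, norm_smul, mul_comm]
    exact mul_le_mul_of_nonneg_right ((norm_snd_le q.2).trans (hubd q.2 hq.2)) (norm_nonneg _)
  have hΞ0 : Tendsto Ξ l (𝓝 0) := by
    refine Prod.tendsto_iff _ _ |>.2 ⟨tendsto_pi_nhds.2 hx0, ?_⟩
    exact tendsto_zero_iff_norm_tendsto_zero.2 (heO.trans_tendsto hlt)
  -- If d ≠ 0 then u_i stays away from 0, so |x_i|^(d + 1) is comparable to t and x_i^d dominates t.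
  -- This makes the first order remainder of β negligible.
  have htx : ∀ i, (fun q : ℝ × ((ι → ℂ) × E) => q.1) =o[l] fun q => (Ξ q).1 i ^ d i := by
    intro i
    by_cases hi : d i = 0
    · simp only [hi, pow_zero]
      exact (isLittleO_one_iff ℂ).2 hlt
    · have hm : 0 < ‖V.1 i‖ - ε := sub_pos.2 (hεV i hi)
      have h1 : (fun q : ℝ × ((ι → ℂ) × E) => q.1) =O[l] fun q => (Ξ q).1 i ^ (d i + 1) := by
        refine IsBigO.of_bound (‖V.1 i‖ - ε)⁻¹ ?_
        filter_upwards [hlpos] with q hq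
        rw [hpow q.1 hq.1.le q.2 hq.2 i, norm_mul ((q.1 : ℝ) : ℂ), Complex.norm_real, inv_mul_eq_div,
          le_div_iff₀ hm]
        refine mul_le_mul_of_nonneg_left ?_ (norm_nonneg _)
        have h2 := hball q.2 hq.2 i
        rw [mem_closedBall_iff_norm] at h2
        linarith [norm_sub_norm_le (V.1 i) (q.2.1 i), norm_sub_rev (V.1 i) (q.2.1 i)]
      refine h1.trans_isLittleO ?_
      have h3 := (isLittleO_one_iff ℂ).2 (hx0 i)
      simpa [pow_succ] using (isBigO_refl (fun q => (Ξ q).1 i ^ d i) l).mul_isLittleO h3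
  have hquot : ∀ i, Tendsto (fun q => β (Ξ q) i / (Ξ q).1 i ^ d i) l (𝓝 (κ i)) := by
    intro i
    have h1 : (fun q => β (Ξ q) i - (Ξ q).1 i ^ d i * k i (Ξ q)) =o[l] fun q => (Ξ q).1 i ^ d i := by
      refine ((hβk i).comp_tendsto hΞ0).trans_isLittleO (IsBigO.trans_isLittleO ?_ (htx i))
      have h2 : (fun q => ∑ j, ‖(Ξ q).1 j‖ ^ (d j + 1)) =O[l] fun q => q.1 :=
        (IsBigO.sum fun j _ => hxO j).congr_left fun q => Finset.sum_apply _ _ _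
      exact h2.add heO
    have h2 := h1.tendsto_div_nhds_zero.add ((hk i).comp hΞ0)
    rw [zero_add] at h2
    refine h2.congr' ?_
    filter_upwards [hlpos] with q hq
    have hne : (Ξ q).1 i ^ d i ≠ 0 := by
      by_cases hi : d i = 0
      · simp [hi]
      · intro h
        have h4 := hpow q.1 hq.1.le q.2 hq.2 i
        rw [pow_succ, h, zero_mul] at h4
        have h5 := hball q.2 hq.2 i
        rcases mul_eq_zero.1 h4.symm with h6 | h6
        · exact hq.1.ne' (by exact_mod_cast h6)
        · rw [h6, mem_closedBall_iff_norm, zero_sub, norm_neg] at h5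
          linarith [hεV i hi]
    simp only [Function.comp]
    field_simp
    ring
  -- The equation satisfied by w = t u, where w_i = x_i^(d_i + 1) and the other component of w is e.
  set Φ : ℝ → (ι → ℂ) × E → (ι → ℂ) × E := fun t u =>
    (fun i => ((d i : ℂ) + 1) * (N (Ξ (t, u)) i / (β (Ξ (t, u)) i / (Ξ (t, u)).1 i ^ d i)),
      Y (Ξ (t, u))) with hΦ
  have hNc : ContinuousAt N 0 := hN.continuousOn.continuousAt (hO.mem_nhds h0)
  have hYc : ContinuousAt Y 0 := hY.continuousOn.continuousAt (hO.mem_nhds h0)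
  have hΦV : Tendsto (fun q => Φ q.1 q.2) l (𝓝 V) := by
    refine Prod.tendsto_iff _ _ |>.2 ⟨tendsto_pi_nhds.2 fun i => ?_, hYc.tendsto.comp hΞ0⟩
    exact ((((continuous_apply i).tendsto _).comp (hNc.tendsto.comp hΞ0)).div (hquot i)
      (hκ i)).const_mul _
  have hev : ∀ᶠ q in l, ‖Φ q.1 q.2 - V‖ ≤ ε ∧ Ξ q ∈ O ∧
      ∀ i, β (Ξ q) i / (Ξ q).1 i ^ d i ≠ 0 := by
    refine ((hΦV.eventually (Metric.closedBall_mem_nhds V hε)).mono fun q hq => ?_).and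
      ((hΞ0.eventually (hO.mem_nhds h0)).and (eventually_all.2 fun i =>
        (hquot i).eventually (isOpen_ne.mem_nhds (hκ i))))
    exact mem_closedBall_iff_norm.1 hq
  rw [hl, eventually_prod_principal_iff] at hev
  obtain ⟨T', hT', hev'⟩ := mem_nhdsGT_iff_exists_Ioo_subset.1 hev
  have hT'0 : (0 : ℝ) < T' := hT'
  -- Halving leaves the closed right endpoint inside the open interval where the estimates hold.
  set T := T' / 2 with hT
  have hTpos : 0 < T := by positivity
  have hall : ∀ t ∈ Ioc 0 T, ∀ u ∈ Metric.closedBall V ε, ‖Φ t u - V‖ ≤ ε ∧ Ξ (t, u) ∈ O ∧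
      ∀ i, β (Ξ (t, u)) i / (Ξ (t, u)).1 i ^ d i ≠ 0 := fun t ht u hu =>
    hev' ⟨ht.1, by linarith [ht.2]⟩ u hu
  have hψc : ∀ i, ContinuousOn (fun q : ℝ × ((ι → ℂ) × E) => ψ i (q.2.1 i))
      (Ioc 0 T ×ˢ Metric.closedBall V ε) := fun i q hq =>
    ContinuousAt.comp_continuousWithinAt (hψ i _ (hball q.2 hq.2 i)).1.continuousAt
      (by fun_prop)
  have hΞc : ContinuousOn Ξ (Ioc 0 T ×ˢ Metric.closedBall V ε) := by
    refine ContinuousOn.prodMk (continuousOn_pi.2 fun i => ContinuousOn.mul ?_ (hψc i)) (by fun_prop)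
    refine Complex.continuous_ofReal.comp_continuousOn ?_
    exact continuousOn_fst.rpow_const fun q hq => Or.inl hq.1.1.ne'
  have hΞO : MapsTo Ξ (Ioc 0 T ×ˢ Metric.closedBall V ε) O := fun q hq =>
    (hall q.1 hq.1 q.2 hq.2).2.1
  have hne : ∀ t ∈ Ioc 0 T, ∀ u ∈ Metric.closedBall V ε, ∀ i, (Ξ (t, u)).1 i ^ d i ≠ 0 ∧
      β (Ξ (t, u)) i ≠ 0 := fun t ht u hu i =>
    ⟨fun h => (hall t ht u hu).2.2 i (by rw [h, div_zero]),
      fun h => (hall t ht u hu).2.2 i (by rw [h, zero_div])⟩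
  have hΦc : ContinuousOn (Function.uncurry Φ) (Ioc 0 T ×ˢ Metric.closedBall V ε) := by
    refine ContinuousOn.prodMk (continuousOn_pi.2 fun i => continuousOn_const.mul ?_)
      (hY.continuousOn.comp hΞc hΞO)
    have h1 : ContinuousOn (fun q => (Ξ q).1 i) (Ioc 0 T ×ˢ Metric.closedBall V ε) :=
      ((continuous_apply i).comp continuous_fst).comp_continuousOn hΞc
    have h2 := (continuous_apply i).comp_continuousOn (hβ.continuousOn.comp hΞc hΞO)
    have h3 := (continuous_apply i).comp_continuousOn (hN.continuousOn.comp hΞc hΞO)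
    exact h3.div (h2.div (h1.pow _) fun q hq => (hne q.1 hq.1 q.2 hq.2 i).1) fun q hq =>
      (hall q.1 hq.1 q.2 hq.2).2.2 i
  obtain ⟨w, hw, hwd⟩ := exists_solution_in_cone hε hTpos hΦc fun t ht u hu => (hall t ht u hu).1
  set y : ℝ → (ι → ℂ) × E := fun t => Ξ (t, t⁻¹ • w t) with hy
  have hy0 : y 0 = 0 := by
    refine Prod.ext (funext fun i => ?_) ?_
    · simp only [hy, hΞ, blowUp]
      rw [Real.zero_rpow (by positivity)]
      simp
    · simp [hy, hΞ, blowUp]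
  have hyd : ∀ t ∈ Ioo 0 T, HasDerivAt y (fun i => N (y t) i / β (y t) i, Y (y t)) t := by
    intro t ht
    have htc := Ioo_subset_Ioc_self ht
    have hnhds : Ioo 0 T ∈ 𝓝 t := isOpen_Ioo.mem_nhds ht
    have hwt := hwd t ht
    have hwf : HasDerivAt (fun s => (w s).1) (Φ t (t⁻¹ • w t)).1 t :=
      (ContinuousLinearMap.fst ℝ (ι → ℂ) E).hasFDerivAt.comp_hasDerivAt t hwt
    have hws : HasDerivAt (fun s => (w s).2) (Φ t (t⁻¹ • w t)).2 t :=
      (ContinuousLinearMap.snd ℝ (ι → ℂ) E).hasFDerivAt.comp_hasDerivAt t hwt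
    refine HasDerivAt.prodMk (hasDerivAt_pi.2 fun i => ?_) ?_
    · have hwi := hasDerivAt_pi.1 hwf i
      have hui : DifferentiableAt ℝ (fun s : ℝ => (s⁻¹ • w s).1 i) t := by
        simp only [Prod.smul_fst, Pi.smul_apply]
        exact (differentiableAt_inv ht.1.ne').smul hwi.differentiableAt
      have hdiff : DifferentiableAt ℝ (fun s => (y s).1 i) t := by
        simp only [hy, hΞ, blowUp]
        refine DifferentiableAt.mul ?_ ?_
        · exact Complex.ofRealCLM.differentiableAt.comp t
            (Real.hasDerivAt_rpow_const (Or.inl ht.1.ne')).differentiableAt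
        · exact ((hψ i _ (hball _ (hw t ht) i)).1.restrictScalars ℝ).comp t hui
      have hpw : ∀ s ∈ Ioo 0 T, (y s).1 i ^ (d i + 1) = (w s).1 i := by
        intro s hs
        rw [hy, hpow s hs.1.le _ (hw s hs) i, Prod.smul_fst, Pi.smul_apply, Complex.real_smul,
          ← mul_assoc, ← Complex.ofReal_mul, mul_inv_cancel₀ hs.1.ne', Complex.ofReal_one, one_mul]
      -- The derivative of x_i^(d_i + 1) is known both from the chain rule and from the equation for
      -- w. Comparing the two determines x_i', since x_i^(d_i) ≠ 0.
      have h1 := hdiff.hasDerivAt.pow (d i + 1)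
      have h2 : HasDerivAt (fun s => (y s).1 i ^ (d i + 1)) ((Φ t (t⁻¹ • w t)).1 i) t := by
        refine hwi.congr_of_eventuallyEq ?_
        filter_upwards [hnhds] with s hs using hpw s hs
      have h3 := h1.unique h2
      obtain ⟨hx, hb⟩ := hne t htc _ (hw t ht) i
      simp only [hΦ, add_tsub_cancel_right] at h3
      have h4 : ((d i : ℂ) + 1) ≠ 0 := Nat.cast_add_one_ne_zero (d i)
      have h5 : deriv (fun s => (y s).1 i) t = N (y t) i / β (y t) i := by
        change ((d i + 1 : ℕ) : ℂ) * (y t).1 i ^ d i * deriv (fun s => (y s).1 i) t =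
          ((d i : ℂ) + 1) * (N (y t) i / (β (y t) i / (y t).1 i ^ d i)) at h3
        change (y t).1 i ^ d i ≠ 0 at hx
        change β (y t) i ≠ 0 at hb
        push_cast at h3
        refine mul_left_cancel₀ (mul_ne_zero h4 hx) (h3.trans ?_)
        field_simp
      rw [← h5]
      exact hdiff.hasDerivAt
    · refine hws.congr_of_eventuallyEq ?_
      filter_upwards [hnhds] with s hs
      change s • s⁻¹ • (w s).2 = _
      rw [smul_smul, mul_inv_cancel₀ hs.1.ne', one_smul]
  have hyO : ∀ t ∈ Ioo 0 T, y t ∈ O ∧ ∀ i, β (y t) i ≠ 0 := fun t ht =>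
    ⟨(hall t (Ioo_subset_Ioc_self ht) _ (hw t ht)).2.1,
      fun i => (hne t (Ioo_subset_Ioc_self ht) _ (hw t ht) i).2⟩
  refine ⟨T, hTpos, y, hy0, ?_, ?_, fun t ht => ⟨(hyO t ht).1, (hyO t ht).2, hyd t ht⟩⟩
  · intro t ht
    rcases ht.1.eq_or_lt with rfl | htp
    · have h1 : Tendsto (fun t => (t, t⁻¹ • w t)) (𝓝[>] 0) l := by
        refine tendsto_id.prodMk (tendsto_principal.2 ?_)
        filter_upwards [Ioo_mem_nhdsGT hTpos] with t ht using hw t ht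
      have h2 : ContinuousWithinAt y (Ioi 0) 0 := by
        rw [ContinuousWithinAt, hy0]
        exact hΞ0.comp h1
      exact (continuousWithinAt_Ioi_iff_Ici.1 h2).mono Ico_subset_Ici_self
    · exact (hyd t ⟨htp, ht.2⟩).continuousAt.continuousWithinAt
  · have hG : ContDiffOn ℝ ∞ (fun p => ((fun i => N p i / β p i : ι → ℂ), Y p))
        (O ∩ {p | ∀ i, β p i ≠ 0}) := by
      refine ContDiffOn.prodMk (contDiffOn_pi.2 fun i => ?_) (hY.mono inter_subset_left)
      have h1 := (contDiffOn_pi.1 hN i).mono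
        (inter_subset_left (s := O) (t := {p | ∀ i, β p i ≠ 0}))
      have h2 := (contDiffOn_pi.1 hβ i).mono
        (inter_subset_left (s := O) (t := {p | ∀ i, β p i ≠ 0}))
      exact (h1.mul (h2.inv fun p hp => hp.2 i)).congr fun p _ => div_eq_mul_inv _ _
    exact contDiffOn_of_hasDerivAt isOpen_Ioo hG hyO hyd

end SingularODE

/-! ### The entire functions cosh √z and sinh √z / √z -/

section Entire

/-- A local analytic square root with prescribed value. -/
lemma exists_analyticAt_sqrt {N : ℂ → ℂ} {z c : ℂ} (hN : AnalyticAt ℂ N z) (hz : N z ≠ 0)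
    (hc : c ^ 2 = N z) :
    ∃ ν : ℂ → ℂ, AnalyticAt ℂ ν z ∧ ν z = c ∧ ∀ᶠ w in 𝓝 z, ν w ^ 2 = N w := by
  refine ⟨fun w => c * (N w / N z) ^ ((2 : ℕ) : ℂ)⁻¹, ?_, ?_, Filter.Eventually.of_forall fun w => ?_⟩
  · refine analyticAt_const.mul ((hN.div analyticAt_const hz).cpow analyticAt_const ?_)
    change N z / N z ∈ _
    rw [div_self hz]
    exact Complex.one_mem_slitPlane
  · simp only
    rw [div_self hz, Complex.one_cpow, mul_one]
  · rw [mul_pow, Complex.cpow_nat_inv_pow _ two_ne_zero, hc, mul_div_cancel₀ _ hz]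

/-- The entire function `z ↦ cosh √z`. -/
def coshSqrt (z : ℂ) : ℂ := Complex.cosh (z ^ ((2 : ℕ) : ℂ)⁻¹)

lemma coshSqrt_sq (n : ℂ) : coshSqrt (n ^ 2) = Complex.cosh n := by
  have h : ((n ^ 2) ^ ((2 : ℕ) : ℂ)⁻¹) ^ 2 = n ^ 2 := Complex.cpow_nat_inv_pow _ two_ne_zero
  rcases sq_eq_sq_iff_eq_or_eq_neg.1 h with h | h
  · rw [coshSqrt, h]
  · rw [coshSqrt, h, Complex.cosh_neg]

lemma exists_sq_eq' (z : ℂ) : ∃ n : ℂ, n ^ 2 = z :=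
  ⟨z ^ ((2 : ℕ) : ℂ)⁻¹, Complex.cpow_nat_inv_pow _ two_ne_zero⟩

/-- As cosh is even, any local analytic square root may replace the principal one away from 0. At 0
the function is continuous, so the singularity is removable. -/
lemma differentiable_coshSqrt : Differentiable ℂ coshSqrt := by
  have h1 : ∀ z : ℂ, z ≠ 0 → DifferentiableAt ℂ coshSqrt z := by
    intro z hz
    obtain ⟨c, hc⟩ := exists_sq_eq' z
    obtain ⟨ν, hν, -, hν2⟩ := exists_analyticAt_sqrt (N := fun z => z) analyticAt_id hz hc
    refine (Complex.differentiable_cosh.differentiableAt.comp z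
      hν.differentiableAt).congr_of_eventuallyEq ?_
    filter_upwards [hν2] with w hw
    rw [Function.comp, ← coshSqrt_sq, hw]
  have h2 : ContinuousAt coshSqrt 0 := by
    refine Complex.continuous_cosh.continuousAt.comp ?_
    have : ContinuousAt (fun z : ℂ => z ^ ((2 : ℕ) : ℂ)⁻¹) 0 := by
      rw [ContinuousAt, Complex.zero_cpow (by norm_num), tendsto_zero_iff_norm_tendsto_zero]
      have h3 : Filter.Tendsto (fun z : ℂ => √‖z‖) (𝓝 0) (𝓝 0) := by
        have : Continuous fun z : ℂ => √‖z‖ := by fun_prop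
        simpa using this.tendsto 0
      refine h3.congr fun z => ?_
      rw [Real.sqrt_eq_iff_mul_self_eq (norm_nonneg _) (norm_nonneg _), ← sq, ← norm_pow,
        Complex.cpow_nat_inv_pow _ two_ne_zero]
    exact this
  have h3 := (Complex.differentiableOn_compl_singleton_and_continuousAt_iff
    (f := coshSqrt) (s := Set.univ) (c := 0) Filter.univ_mem).1
    ⟨fun z hz => (h1 z hz.2).differentiableWithinAt, h2⟩
  exact differentiableOn_univ.1 h3

/-- The entire function `z ↦ sinh √z / √z`. -/
def sinhcSqrt (z : ℂ) : ℂ := 2 * deriv coshSqrt z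

lemma differentiable_sinhcSqrt : Differentiable ℂ sinhcSqrt := by
  have h : AnalyticOnNhd ℂ coshSqrt Set.univ :=
    fun z _ => differentiable_coshSqrt.analyticAt z
  exact fun z => (h.deriv z (Set.mem_univ z)).differentiableAt.const_mul 2

lemma hasDerivAt_coshSqrt (z : ℂ) : HasDerivAt coshSqrt (sinhcSqrt z / 2) z := by
  rw [sinhcSqrt, mul_div_cancel_left₀ _ two_ne_zero]
  exact (differentiable_coshSqrt z).hasDerivAt

lemma mul_sinhcSqrt_sq (n : ℂ) : n * sinhcSqrt (n ^ 2) = Complex.sinh n := by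
  have h1 : HasDerivAt (fun n : ℂ => coshSqrt (n ^ 2)) (sinhcSqrt (n ^ 2) / 2 * (2 * n)) n := by
    refine HasDerivAt.comp (h₂ := coshSqrt) (h := fun n : ℂ => n ^ 2) n (hasDerivAt_coshSqrt (n ^ 2)) ?_
    simpa using hasDerivAt_pow 2 n
  simp_rw [coshSqrt_sq] at h1
  rw [← h1.unique (Complex.hasDerivAt_cosh n)]
  ring

lemma coshSqrt_sq_sub (z : ℂ) : coshSqrt z ^ 2 - z * sinhcSqrt z ^ 2 = 1 := by
  obtain ⟨n, rfl⟩ := exists_sq_eq' z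
  rw [← mul_pow, mul_sinhcSqrt_sq, coshSqrt_sq, Complex.cosh_sq_sub_sinh_sq]

/-- The derivative of n · `sinhcSqrt (n ^ 2)` = sinh n, written at z = n². -/
lemma sinhcSqrt_add_deriv (z : ℂ) :
    sinhcSqrt z + 2 * z * deriv sinhcSqrt z = coshSqrt z := by
  obtain ⟨n, rfl⟩ := exists_sq_eq' z
  have h1 : HasDerivAt (fun n : ℂ => n * sinhcSqrt (n ^ 2))
      (1 * sinhcSqrt (n ^ 2) + n * (deriv sinhcSqrt (n ^ 2) * (2 * n))) n := by
    refine (hasDerivAt_id n).mul ?_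
    refine HasDerivAt.comp (h₂ := sinhcSqrt) (h := fun n : ℂ => n ^ 2) n
      (differentiable_sinhcSqrt (n ^ 2)).hasDerivAt ?_
    simpa using hasDerivAt_pow 2 n
  simp_rw [mul_sinhcSqrt_sq] at h1
  rw [coshSqrt_sq, ← h1.unique (Complex.hasDerivAt_sinh n)]
  ring

lemma coshSqrt_conj (z : ℂ) : coshSqrt (conj z) = conj (coshSqrt z) := by
  obtain ⟨n, rfl⟩ := exists_sq_eq' z
  rw [map_pow, coshSqrt_sq, coshSqrt_sq, Complex.cosh_conj]

lemma sinhcSqrt_conj (z : ℂ) : sinhcSqrt (conj z) = conj (sinhcSqrt z) := by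
  have h0 : sinhcSqrt 0 = 1 := by
    have h := sinhcSqrt_add_deriv 0
    have h2 : coshSqrt 0 = 1 := by simpa using coshSqrt_sq 0
    simpa [h2] using h
  obtain ⟨n, rfl⟩ := exists_sq_eq' z
  by_cases hn : n = 0
  · simp [hn, h0]
  · rw [map_pow]
    have hn' : conj n ≠ 0 := by simpa using hn
    refine mul_left_cancel₀ hn' ?_
    rw [mul_sinhcSqrt_sq, ← map_mul, mul_sinhcSqrt_sq, Complex.sinh_conj]

end Entire

/-! ### Even and odd parts of μ: calculus on the double cover without choosing a branch -/

section DlogPair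

/-- The function `μ = f ν + k` on the double cover `ν² = N` satisfies `μ σ^*μ = 1` and
`d ln μ = (w / ν) dz`, written in terms of the even and odd parts of `μ`. -/
structure DlogAt (N w f k : ℂ → ℂ) (z : ℂ) : Prop where
  df : DifferentiableAt ℂ f z
  dk : DifferentiableAt ℂ k z
  norm_eq : k z ^ 2 - f z ^ 2 * N z = 1
  deriv_k : deriv k z = f z * w z
  deriv_f : deriv f z * N z + f z * deriv N z / 2 = k z * w z

variable {N w f k : ℂ → ℂ} {z : ℂ}

lemma DlogAt.congr {N' w' f' k' : ℂ → ℂ} (h : DlogAt N w f k z) (hN : N' =ᶠ[𝓝 z] N)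
    (hw : w' z = w z) (hf : f' =ᶠ[𝓝 z] f) (hk : k' =ᶠ[𝓝 z] k) : DlogAt N' w' f' k' z where
  df := h.df.congr_of_eventuallyEq hf
  dk := h.dk.congr_of_eventuallyEq hk
  norm_eq := by rw [hk.eq_of_nhds, hf.eq_of_nhds, hN.eq_of_nhds, h.norm_eq]
  deriv_k := by rw [hk.deriv_eq, hf.eq_of_nhds, hw, h.deriv_k]
  deriv_f := by
    rw [hf.deriv_eq, hf.eq_of_nhds, hk.eq_of_nhds, hN.eq_of_nhds, hN.deriv_eq, hw, h.deriv_f]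

/-- The product (f ν + k)(f' ν + k') expanded with ν² = N; logarithmic derivatives add. -/
lemma DlogAt.mul {w' f' k' : ℂ → ℂ} (h : DlogAt N w f k z) (h' : DlogAt N w' f' k' z)
    (hN : DifferentiableAt ℂ N z) :
    DlogAt N (fun z => w z + w' z) (fun z => f z * k' z + k z * f' z)
      (fun z => k z * k' z + f z * f' z * N z) z := by
  have hk := (h.dk.hasDerivAt.mul h'.dk.hasDerivAt).add
    ((h.df.hasDerivAt.mul h'.df.hasDerivAt).mul hN.hasDerivAt)
  have hf := (h.df.hasDerivAt.mul h'.dk.hasDerivAt).add (h.dk.hasDerivAt.mul h'.df.hasDerivAt)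
  refine ⟨hf.differentiableAt, hk.differentiableAt, ?_, ?_, ?_⟩
  · linear_combination (k' z ^ 2 - f' z ^ 2 * N z) * h.norm_eq + h'.norm_eq
  · refine hk.deriv.trans ?_
    simp only [Pi.mul_apply]
    linear_combination k' z * h.deriv_k + k z * h'.deriv_k + f' z * h.deriv_f + f z * h'.deriv_f
  · refine (congrArg (fun x => x * N z + _) hf.deriv).trans ?_
    linear_combination k' z * h.deriv_f + k z * h'.deriv_f + N z * f z * h'.deriv_k +
      N z * f' z * h.deriv_k

/-- The exponential of the odd function `ℓ ν`. -/
lemma dlogAt_exp {ℓ : ℂ → ℂ} (hN : DifferentiableAt ℂ N z) (hℓ : DifferentiableAt ℂ ℓ z)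
    (hw : N z * deriv ℓ z + deriv N z * ℓ z / 2 = w z) :
    DlogAt N w (fun z => ℓ z * sinhcSqrt (N z * ℓ z ^ 2)) (fun z => coshSqrt (N z * ℓ z ^ 2)) z := by
  have hX : HasDerivAt (fun z => N z * ℓ z ^ 2)
      (deriv N z * ℓ z ^ 2 + N z * (2 * ℓ z * deriv ℓ z)) z := by
    have := hN.hasDerivAt.mul (hℓ.hasDerivAt.pow 2)
    exact this.congr_deriv (by simp)
  have hk := (hasDerivAt_coshSqrt (N z * ℓ z ^ 2)).comp z hX
  have hf := hℓ.hasDerivAt.mul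
    ((differentiable_sinhcSqrt (N z * ℓ z ^ 2)).hasDerivAt.comp z hX)
  refine ⟨hf.differentiableAt, hk.differentiableAt, ?_, ?_, ?_⟩
  · linear_combination coshSqrt_sq_sub (N z * ℓ z ^ 2)
  · refine hk.deriv.trans ?_
    rw [← hw]
    ring
  · refine (congrArg (fun x => x * N z + _) hf.deriv).trans ?_
    simp only [Function.comp]
    rw [← hw, ← sinhcSqrt_add_deriv (N z * ℓ z ^ 2)]
    ring

/-- The same μ in terms of q ν instead of ν: f ν = (f / q)(q ν) and w / ν = w q / (q ν). This moves
μ from the curve at time 0 to the curve at time T. -/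
lemma DlogAt.rescale {q : ℂ → ℂ} (h : DlogAt N w f k z) (hN : DifferentiableAt ℂ N z)
    (hq : DifferentiableAt ℂ q z) (hq0 : q z ≠ 0) :
    DlogAt (fun z => q z ^ 2 * N z) (fun z => w z * q z) (fun z => f z / q z) k z := by
  have hf := h.df.hasDerivAt.div hq.hasDerivAt hq0
  have hN' := (hq.hasDerivAt.pow 2).mul hN.hasDerivAt
  refine ⟨hf.differentiableAt, h.dk, ?_, ?_, ?_⟩
  · rw [← h.norm_eq]
    field_simp
  · rw [h.deriv_k]
    field_simp
  · refine (congrArg₂ (fun x y => x * (q z ^ 2 * N z) + f z / q z * y / 2) hf.deriv hN'.deriv).trans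
      ?_
    simp only [Nat.cast_ofNat, Pi.pow_apply]
    field_simp
    linear_combination 2 * q z ^ 2 * h.deriv_f

lemma DlogAt.const_mul (h : DlogAt N w f k z) {s : ℂ} (hs : s ^ 2 = 1) :
    DlogAt N w (fun z => s * f z) (fun z => s * k z) z := by
  refine ⟨h.df.const_mul s, h.dk.const_mul s, ?_, ?_, ?_⟩
  · linear_combination (k z ^ 2 - f z ^ 2 * N z) * hs + h.norm_eq
  · rw [deriv_const_mul _ h.dk, h.deriv_k]; ring
  · rw [deriv_const_mul _ h.df]
    linear_combination s * h.deriv_f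

/-- For two solutions of the same equation, the even part and the square of the odd part of the
quotient have vanishing derivative. -/
lemma DlogAt.hasDerivAt_quotient {f' k' : ℂ → ℂ} (h : DlogAt N w f k z) (h' : DlogAt N w f' k' z)
    (hN : DifferentiableAt ℂ N z) :
    HasDerivAt (fun z => k z * k' z - f z * f' z * N z) 0 z ∧
      HasDerivAt (fun z => (f z * k' z - k z * f' z) ^ 2 * N z) 0 z := by
  have hf0 := h.df.hasDerivAt
  have hf0' := h'.df.hasDerivAt
  have hk0 := h.dk.hasDerivAt
  have hk0' := h'.dk.hasDerivAt
  constructor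
  · refine ((hk0.mul hk0').sub ((hf0.mul hf0').mul hN.hasDerivAt)).congr_deriv ?_
    simp only [Pi.mul_apply]
    linear_combination k' z * h.deriv_k + k z * h'.deriv_k - f' z * h.deriv_f - f z * h'.deriv_f
  · refine ((((hf0.mul hk0').sub (hk0.mul hf0')).pow 2).mul hN.hasDerivAt).congr_deriv ?_
    simp only [Nat.cast_ofNat, Pi.sub_apply, Pi.mul_apply, Pi.pow_apply]
    linear_combination (f z * k' z - k z * f' z) * (2 * k' z * h.deriv_f - 2 * k z * h'.deriv_f
      + 2 * f z * N z * h'.deriv_k - 2 * f' z * N z * h.deriv_k)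

end DlogPair

/-! ### Extension of μ across a simple branch point -/

section Local

open MeasureTheory Set Metric

/-- Differentiation under the integral sign for an integrand that is jointly continuous together
with its derivative. -/
lemma hasDerivAt_integral_param {a b : ℝ} (hab : a ≤ b) {D : Set ℂ} (hD : IsOpen D)
    {G G' : ℝ → ℂ → ℂ} (hG : ContinuousOn (Function.uncurry G) (Icc a b ×ˢ D))
    (hG' : ContinuousOn (Function.uncurry G') (Icc a b ×ˢ D))
    (hd : ∀ τ ∈ Icc a b, ∀ z ∈ D, HasDerivAt (G τ) (G' τ z) z) {z : ℂ} (hz : z ∈ D) :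
    HasDerivAt (fun z => ∫ τ in a..b, G τ z) (∫ τ in a..b, G' τ z) z := by
  obtain ⟨ε, hε, hεD⟩ := Metric.nhds_basis_closedBall.mem_iff.1 (hD.mem_nhds hz)
  have hK : IsCompact (Icc a b ×ˢ closedBall z ε) := isCompact_Icc.prod (isCompact_closedBall _ _)
  obtain ⟨M, hM⟩ := hK.exists_bound_of_continuousOn
    (hG'.mono (prod_mono_right hεD))
  have hsub : Set.uIoc a b ⊆ Icc a b := by
    rw [Set.uIoc_of_le hab]; exact Ioc_subset_Icc_self
  have hslice : ∀ {F : ℝ → ℂ → ℂ}, ContinuousOn (Function.uncurry F) (Icc a b ×ˢ D) →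
      ∀ x ∈ D, ContinuousOn (fun τ => F τ x) (Icc a b) := fun hF x hx =>
    hF.comp (continuousOn_id.prodMk continuousOn_const) fun τ hτ => ⟨hτ, hx⟩
  refine (intervalIntegral.hasDerivAt_integral_of_dominated_loc_of_deriv_le (bound := fun _ => M)
    (F := fun x τ => G τ x) (F' := fun x τ => G' τ x)
    (closedBall_mem_nhds z hε) ?_ ?_ ?_ ?_ (by simp) ?_).2
  · filter_upwards [hD.mem_nhds hz] with x hx
    exact ((hslice hG x hx).mono hsub).aestronglyMeasurable measurableSet_uIoc
  · exact ContinuousOn.intervalIntegrable (by rw [uIcc_of_le hab]; exact hslice hG z hz)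
  · exact ((hslice hG' z hz).mono hsub).aestronglyMeasurable measurableSet_uIoc
  · exact Filter.Eventually.of_forall fun τ hτ x hx => hM (τ, x) ⟨hsub hτ, hx⟩
  · exact Filter.Eventually.of_forall fun τ hτ x hx => hd τ (hsub hτ) x (hεD hx)

/-- The holomorphic solution of `(z - r) y' + y / 2 = g` on a ball containing `r`. -/
lemma exists_regular_solution {r₀ r : ℂ} {R : ℝ} {g : ℂ → ℂ} (hr : r ∈ ball r₀ R)
    (hg : DifferentiableOn ℂ g (ball r₀ R)) :
    ∃ y : ℂ → ℂ, DifferentiableOn ℂ y (ball r₀ R) ∧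
      ∀ z ∈ ball r₀ R, (z - r) * deriv y z + y z / 2 = g z := by
  have hmem : ∀ u ∈ Icc (0 : ℝ) 1, ∀ z ∈ ball r₀ R, r + (u : ℂ) ^ 2 * (z - r) ∈ ball r₀ R := by
    intro u hu z hz
    have := (convex_ball r₀ R).add_smul_sub_mem hr hz (t := u ^ 2)
      ⟨by positivity, pow_le_one₀ hu.1 hu.2⟩
    simpa using this
  have hana := hg.analyticOnNhd isOpen_ball
  set c : ℝ × ℂ → ℂ := fun p => r + (p.1 : ℂ) ^ 2 * (p.2 - r) with hc
  have hcc : Continuous c := by fun_prop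
  have hmaps : MapsTo c (Icc 0 1 ×ˢ ball r₀ R) (ball r₀ R) := fun p hp => hmem p.1 hp.1 p.2 hp.2
  have hinner : ∀ (u : ℝ) (z : ℂ), HasDerivAt (fun z => r + (u : ℂ) ^ 2 * (z - r)) ((u : ℂ) ^ 2) z :=
    fun u z => by
      simpa using (((hasDerivAt_id z).sub_const r).const_mul ((u : ℂ) ^ 2)).const_add r
  have hgd : ∀ u ∈ Icc (0 : ℝ) 1, ∀ z ∈ ball r₀ R,
      HasDerivAt g (deriv g (r + (u : ℂ) ^ 2 * (z - r))) (r + (u : ℂ) ^ 2 * (z - r)) :=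
    fun u hu z hz => (hana _ (hmem u hu z hz)).differentiableAt.hasDerivAt
  have hG : ContinuousOn (Function.uncurry fun (u : ℝ) (z : ℂ) => 2 * g (r + (u : ℂ) ^ 2 * (z - r)))
      (Icc 0 1 ×ˢ ball r₀ R) :=
    continuousOn_const.mul (hg.continuousOn.comp hcc.continuousOn hmaps)
  have hG' : ContinuousOn (Function.uncurry fun (u : ℝ) (z : ℂ) =>
      2 * (deriv g (r + (u : ℂ) ^ 2 * (z - r)) * (u : ℂ) ^ 2)) (Icc 0 1 ×ˢ ball r₀ R) := by
    refine continuousOn_const.mul (ContinuousOn.mul ?_ (by fun_prop))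
    exact hana.deriv.continuousOn.comp hcc.continuousOn hmaps
  -- The integral is (z - r)^(-1/2) ∫ g(ζ) (ζ - r)^(-1/2) dζ from r to z, with ζ = r + u² (z - r);
  -- the substitution removes both square roots.
  have hy : ∀ z ∈ ball r₀ R, HasDerivAt
      (fun z => ∫ u in (0 : ℝ)..1, 2 * g (r + (u : ℂ) ^ 2 * (z - r)))
      (∫ u in (0 : ℝ)..1, 2 * (deriv g (r + (u : ℂ) ^ 2 * (z - r)) * (u : ℂ) ^ 2)) z :=
    fun z hz => hasDerivAt_integral_param zero_le_one isOpen_ball hG hG'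
      (fun u hu z hz => (HasDerivAt.comp (h₂ := g) z (hgd u hu z hz) (hinner u z)).const_mul 2) hz
  refine ⟨_, fun z hz => (hy z hz).differentiableAt.differentiableWithinAt, fun z hz => ?_⟩
  -- The derivative of u g(r + u² (z - r)) is the integrand of (z - r) y' + y / 2, and its integral
  -- over [0, 1] is g(z).
  have hpath : ∀ u ∈ uIcc (0 : ℝ) 1, HasDerivAt (fun u : ℝ => (u : ℂ) * g (r + (u : ℂ) ^ 2 * (z - r)))
      (1 * g (r + (u : ℂ) ^ 2 * (z - r)) +
        (u : ℂ) * (deriv g (r + (u : ℂ) ^ 2 * (z - r)) * (2 * (u : ℂ) * (z - r)))) u := by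
    intro u hu
    rw [uIcc_of_le zero_le_one] at hu
    have h1 : HasDerivAt (fun u : ℝ => (u : ℂ)) 1 u := Complex.ofRealCLM.hasDerivAt
    have h2 : HasDerivAt (fun u : ℝ => r + (u : ℂ) ^ 2 * (z - r)) (2 * (u : ℂ) * (z - r)) u :=
      (((h1.pow 2).mul_const (z - r)).const_add r).congr_deriv (by simp)
    exact h1.mul (HasDerivAt.comp (h₂ := g) u (hgd u hu z hz) h2)
  have hsl : ∀ {F : ℝ → ℂ → ℂ}, ContinuousOn (Function.uncurry F) (Icc 0 1 ×ˢ ball r₀ R) →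
      IntervalIntegrable (fun τ => F τ z) volume 0 1 := fun hF =>
    ContinuousOn.intervalIntegrable (by
      rw [uIcc_of_le zero_le_one]
      exact hF.comp (continuousOn_id.prodMk continuousOn_const) fun τ hτ => ⟨hτ, hz⟩)
  have hi1 := hsl hG
  have hi2 := hsl hG'
  have hint : IntervalIntegrable (fun u : ℝ => 1 * g (r + (u : ℂ) ^ 2 * (z - r)) +
      (u : ℂ) * (deriv g (r + (u : ℂ) ^ 2 * (z - r)) * (2 * (u : ℂ) * (z - r)))) volume 0 1 := by
    refine ((hi1.const_mul (1 / 2)).add (hi2.const_mul (z - r))).congr ?_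
    exact fun u _ => by ring
  have hftc := intervalIntegral.integral_eq_sub_of_hasDerivAt hpath hint
  rw [(hy z hz).deriv, ← intervalIntegral.integral_const_mul, ← intervalIntegral.integral_div,
    ← intervalIntegral.integral_add (hi2.const_mul _) (hi1.div_const 2)]
  refine (intervalIntegral.integral_congr fun u _ => ?_).trans (hftc.trans ?_)
  · ring
  · simp

/-- A nonvanishing holomorphic function on a ball has a holomorphic square root. -/
lemma exists_sqrt_on_ball {r₀ : ℂ} {R : ℝ} {m : ℂ → ℂ} (hm : DifferentiableOn ℂ m (ball r₀ R))
    (hm0 : ∀ z ∈ ball r₀ R, m z ≠ 0) :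
    ∃ n : ℂ → ℂ, DifferentiableOn ℂ n (ball r₀ R) ∧ ∀ z ∈ ball r₀ R, n z ^ 2 = m z := by
  rcases le_or_gt R 0 with hR | hR
  · exact ⟨0, by simp [ball_eq_empty.2 hR], by simp [ball_eq_empty.2 hR]⟩
  have hana := hm.analyticOnNhd isOpen_ball
  have h1 : DifferentiableOn ℂ (fun z => deriv m z / (2 * m z)) (ball r₀ R) :=
    hana.deriv.differentiableOn.div (hm.const_mul 2) fun z hz => mul_ne_zero two_ne_zero (hm0 z hz)
  obtain ⟨M, hM⟩ := h1.isExactOn_ball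
  have hd : ∀ z ∈ ball r₀ R, HasDerivAt (fun z => Complex.exp (M z) ^ 2 / m z) 0 z := by
    intro z hz
    refine (((hM z hz).cexp.pow 2).div (hana z hz).differentiableAt.hasDerivAt
      (hm0 z hz)).congr_deriv ?_
    have := hm0 z hz
    simp only [Pi.pow_apply]
    field_simp
    norm_num
    right
    ring
  have hr : r₀ ∈ ball r₀ R := mem_ball_self hR
  have hc : ∀ z ∈ ball r₀ R, Complex.exp (M z) ^ 2 / m z = Complex.exp (M r₀) ^ 2 / m r₀ :=
    fun z hz => isOpen_ball.is_const_of_deriv_eq_zero (convex_ball r₀ R).isPreconnected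
      (fun z hz => (hd z hz).differentiableAt.differentiableWithinAt)
      (fun z hz => (hd z hz).deriv) hz hr
  obtain ⟨s, hs⟩ := exists_sq_eq' (m r₀)
  refine ⟨fun z => s * (Complex.exp (M z) / Complex.exp (M r₀)), fun z hz => ?_, fun z hz => ?_⟩
  · exact (((hM z hz).cexp.div_const _).const_mul s).differentiableAt.differentiableWithinAt
  · have h2 := hc z hz
    rw [div_eq_div_iff (hm0 z hz) (hm0 r₀ hr)] at h2
    rw [mul_pow, div_pow, hs, ← mul_div_assoc, div_eq_iff (pow_ne_zero 2 (Complex.exp_ne_zero _)),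
      mul_comm, h2, mul_comm]

/-- `z - r` has no continuous square root on a circle around `r`. -/
lemma no_continuous_sqrt_on_sphere {r : ℂ} {ρ : ℝ} (hρ : 0 < ρ) {s : ℂ → ℂ}
    (hs : ContinuousOn s (sphere r ρ)) (h : ∀ z ∈ sphere r ρ, s z ^ 2 = z - r) : False := by
  -- φ² is the positive constant ρ, but φ changes sign after a full turn. So Re φ has a zero, where
  -- φ² ≤ 0.
  set φ : ℝ → ℂ := fun θ => s (circleMap r ρ θ) * Complex.exp (-(θ / 2 * Complex.I)) with hφ
  have hφc : Continuous φ := by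
    refine Continuous.mul ?_ (by fun_prop)
    exact hs.comp_continuous (continuous_circleMap r ρ) (circleMap_mem_sphere r hρ.le)
  have hφ2 : ∀ θ, φ θ ^ 2 = ρ := by
    intro θ
    rw [hφ, mul_pow, h _ (circleMap_mem_sphere r hρ.le θ), ← Complex.exp_nat_mul, circleMap,
      add_sub_cancel_left, mul_assoc, ← Complex.exp_add]
    have : (θ : ℂ) * Complex.I + ((2 : ℕ) : ℂ) * -(θ / 2 * Complex.I) = 0 := by push_cast; ring
    rw [this, Complex.exp_zero, mul_one]
  have h2 : φ (2 * Real.pi) = -φ 0 := by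
    have e : Complex.exp (-(((2 * Real.pi : ℝ) : ℂ) / 2 * Complex.I)) = -1 := by
      rw [Complex.exp_neg]
      have : ((2 * Real.pi : ℝ) : ℂ) / 2 * Complex.I = Real.pi * Complex.I := by push_cast; ring
      rw [this, Complex.exp_pi_mul_I]
      norm_num
    have e2 : circleMap r ρ (2 * Real.pi) = circleMap r ρ 0 := by simp [circleMap]
    simp only [hφ, e, e2]
    simp
  have hre : Continuous fun θ => (φ θ).re := Complex.continuous_re.comp hφc
  have hzero : ∃ θ, (φ θ).re = 0 := by
    have hpre := isPreconnected_univ.image _ hre.continuousOn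
    have hoc := hpre.ordConnected
    have h0 : (φ 0).re ∈ (fun θ => (φ θ).re) '' univ := ⟨0, mem_univ _, rfl⟩
    have h1 : -(φ 0).re ∈ (fun θ => (φ θ).re) '' univ :=
      ⟨2 * Real.pi, mem_univ _, by simp only [h2, Complex.neg_re]⟩
    have h3 : (0 : ℝ) ∈ (fun θ => (φ θ).re) '' univ := by
      rcases le_total 0 (φ 0).re with hs | hs
      · exact hoc.out h1 h0 ⟨by linarith, hs⟩
      · exact hoc.out h0 h1 ⟨hs, by linarith⟩
    obtain ⟨θ, -, hθ⟩ := h3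
    exact ⟨θ, hθ⟩
  obtain ⟨θ, hθ⟩ := hzero
  have := congrArg Complex.re (hφ2 θ)
  rw [sq, Complex.mul_re, hθ, Complex.ofReal_re] at this
  nlinarith [mul_self_nonneg (φ θ).im]

/-- An open annulus is connected. -/
lemma isPreconnected_annulus (r₀ : ℂ) {δ R : ℝ} (hδ : 0 ≤ δ) :
    IsPreconnected {z : ℂ | δ < ‖z - r₀‖ ∧ ‖z - r₀‖ < R} := by
  have : {z : ℂ | δ < ‖z - r₀‖ ∧ ‖z - r₀‖ < R} =
      (fun p : ℝ × ℝ => circleMap r₀ p.1 p.2) '' (Ioo δ R ×ˢ univ) := by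
    ext z
    constructor
    · rintro ⟨h1, h2⟩
      refine ⟨(‖z - r₀‖, (z - r₀).arg), ⟨⟨h1, h2⟩, mem_univ _⟩, ?_⟩
      simp only [circleMap]
      rw [Complex.norm_mul_exp_arg_mul_I]
      ring
    · rintro ⟨p, ⟨hp, -⟩, rfl⟩
      have : ‖circleMap r₀ p.1 p.2 - r₀‖ = p.1 := by
        rw [circleMap_sub_center, norm_circleMap_zero, abs_of_pos (hδ.trans_lt hp.1)]
      simp only [mem_ofPred_eq, this]
      exact hp
  rw [this]
  refine (isPreconnected_Ioo.prod isPreconnected_univ).image _ (Continuous.continuousOn ?_)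
  unfold circleMap
  fun_prop

/-- A solution on an annulus around a simple zero `r` of `N` extends to the disc. -/
lemma exists_extension_to_ball {r₀ r : ℂ} {δ R : ℝ} (hr : ‖r - r₀‖ < δ) (hR : 3 * δ < R)
    {m w f k : ℂ → ℂ} (hm : DifferentiableOn ℂ m (ball r₀ R)) (hm0 : ∀ z ∈ ball r₀ R, m z ≠ 0)
    (hw : DifferentiableOn ℂ w (ball r₀ R))
    (h : ∀ z : ℂ, δ < ‖z - r₀‖ → ‖z - r₀‖ < R → DlogAt (fun z => (z - r) * m z) w f k z) :
    ∃ f' k' : ℂ → ℂ, (∀ z ∈ ball r₀ R, DlogAt (fun z => (z - r) * m z) w f' k' z) ∧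
      ∀ z : ℂ, δ < ‖z - r₀‖ → ‖z - r₀‖ < R → f' z = f z ∧ k' z = k z := by
  have hδ : 0 < δ := (norm_nonneg _).trans_lt hr
  set N : ℂ → ℂ := fun z => (z - r) * m z with hN
  have hmemA : ∀ z : ℂ, ‖z - r₀‖ < R → z ∈ ball r₀ R := fun z hz => mem_ball_iff_norm.2 hz
  have hrb : r ∈ ball r₀ R := hmemA r (by linarith)
  have hmd : ∀ z ∈ ball r₀ R, DifferentiableAt ℂ m z := fun z hz =>
    hm.differentiableAt (isOpen_ball.mem_nhds hz)
  have hNd : ∀ z ∈ ball r₀ R, HasDerivAt N (1 * m z + (z - r) * deriv m z) z := fun z hz =>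
    ((hasDerivAt_id z).sub_const r).mul (hmd z hz).hasDerivAt
  obtain ⟨n, hn, hnm⟩ := exists_sqrt_on_ball hm hm0
  have hn0 : ∀ z ∈ ball r₀ R, n z ≠ 0 := fun z hz h0 => hm0 z hz (by rw [← hnm z hz, h0]; simp)
  have hnd : ∀ z ∈ ball r₀ R, DifferentiableAt ℂ n z := fun z hz =>
    hn.differentiableAt (isOpen_ball.mem_nhds hz)
  have hdm : ∀ z ∈ ball r₀ R, deriv m z = 2 * n z * deriv n z := by
    intro z hz
    have h1 : HasDerivAt (fun z => n z ^ 2) (2 * n z * deriv n z) z :=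
      ((hnd z hz).hasDerivAt.pow 2).congr_deriv (by simp)
    have h2 : m =ᶠ[𝓝 z] fun z => n z ^ 2 := by
      filter_upwards [isOpen_ball.mem_nhds hz] with x hx using (hnm x hx).symm
    rw [h2.deriv_eq, h1.deriv]
  -- With N = (z - r) n² and ℓ = y / n, the equation (ℓ ν)' = w / ν becomes (z - r) y' + y / 2 = w /
  -- n. So exp(ℓ ν) is a solution on the whole disc.
  obtain ⟨y, hy, hyeq⟩ := exists_regular_solution (g := fun z => w z / n z) hrb (hw.div hn hn0)
  have hyd : ∀ z ∈ ball r₀ R, DifferentiableAt ℂ y z := fun z hz =>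
    hy.differentiableAt (isOpen_ball.mem_nhds hz)
  have hloc : ∀ z ∈ ball r₀ R, DlogAt N w
      (fun z => y z / n z * sinhcSqrt (N z * (y z / n z) ^ 2))
      (fun z => coshSqrt (N z * (y z / n z) ^ 2)) z := by
    intro z hz
    have hℓ : HasDerivAt (fun z => y z / n z) ((deriv y z * n z - y z * deriv n z) / n z ^ 2) z :=
      (hyd z hz).hasDerivAt.div (hnd z hz).hasDerivAt (hn0 z hz)
    refine dlogAt_exp (hNd z hz).differentiableAt hℓ.differentiableAt ?_
    have h1 := hyeq z hz
    rw [hℓ.deriv, (hNd z hz).deriv, hdm z hz, hN]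
    simp only
    rw [← hnm z hz]
    have h3 := hn0 z hz
    rw [eq_div_iff h3] at h1
    rw [← h1]
    field_simp
    ring
  set fl : ℂ → ℂ := fun z => y z / n z * sinhcSqrt (N z * (y z / n z) ^ 2) with hfl
  set kl : ℂ → ℂ := fun z => coshSqrt (N z * (y z / n z) ^ 2) with hkl
  set A : Set ℂ := {z : ℂ | δ < ‖z - r₀‖ ∧ ‖z - r₀‖ < R} with hA
  have hnc : Continuous fun z : ℂ => ‖z - r₀‖ := by fun_prop
  have hAo : IsOpen A := (isOpen_lt continuous_const hnc).inter (isOpen_lt hnc continuous_const)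
  have hAc : IsPreconnected A := isPreconnected_annulus r₀ hδ.le
  have hq : ∀ z ∈ A, HasDerivAt (fun z => k z * kl z - f z * fl z * N z) 0 z ∧
      HasDerivAt (fun z => (f z * kl z - k z * fl z) ^ 2 * N z) 0 z := fun z hz =>
    (h z hz.1 hz.2).hasDerivAt_quotient (hloc z (hmemA z hz.2))
      (hNd z (hmemA z hz.2)).differentiableAt
  -- A circle around r itself rather than around r₀; it lies in the annulus because |r - r₀| < δ and
  -- 3 δ < R.
  have hsphere : sphere r (2 * δ) ⊆ A := by
    intro z hz
    rw [mem_sphere_iff_norm] at hz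
    have h1 : z - r₀ = (z - r) + (r - r₀) := by ring
    constructor
    · have := norm_sub_le_norm_add (z - r) (r - r₀)
      rw [← h1] at this
      linarith
    · have := norm_add_le (z - r) (r - r₀)
      rw [← h1] at this
      linarith
  obtain ⟨z₁, hz₁⟩ : (sphere r (2 * δ)).Nonempty := (NormedSpace.sphere_nonempty).2 (by positivity)
  have hP : ∀ z ∈ A, k z * kl z - f z * fl z * N z = k z₁ * kl z₁ - f z₁ * fl z₁ * N z₁ :=
    fun z hz => hAo.is_const_of_deriv_eq_zero hAc
      (fun z hz => (hq z hz).1.differentiableAt.differentiableWithinAt)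
      (fun z hz => (hq z hz).1.deriv) hz (hsphere hz₁)
  have hQ : ∀ z ∈ A, (f z * kl z - k z * fl z) ^ 2 * N z =
      (f z₁ * kl z₁ - k z₁ * fl z₁) ^ 2 * N z₁ :=
    fun z hz => hAo.is_const_of_deriv_eq_zero hAc
      (fun z hz => (hq z hz).2.differentiableAt.differentiableWithinAt)
      (fun z hz => (hq z hz).2.deriv) hz (hsphere hz₁)
  set P := k z₁ * kl z₁ - f z₁ * fl z₁ * N z₁ with hPdef
  set Q := (f z₁ * kl z₁ - k z₁ * fl z₁) ^ 2 * N z₁ with hQdef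
  -- The quotient of the two solutions has constant even part P, and its odd part R ν satisfies R² N
  -- = Q. If Q ≠ 0, then R has no zero and √Q / (R n) would be a square root of z - r on the circle.
  have hQ0 : Q = 0 := by
    by_contra hne
    obtain ⟨s, hs⟩ := exists_sq_eq' Q
    have hR0 : ∀ z ∈ A, f z * kl z - k z * fl z ≠ 0 := fun z hz h0 => hne (by
      rw [← hQ z hz, h0]; simp)
    have hnb : ∀ z ∈ A, n z ≠ 0 := fun z hz => hn0 z (hmemA z hz.2)
    refine no_continuous_sqrt_on_sphere (r := r) (ρ := 2 * δ) (by positivity)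
      (s := fun z => s / ((f z * kl z - k z * fl z) * n z)) ?_ fun z hz => ?_
    · intro z hz
      have hzA := hsphere hz
      have d1 := h z hzA.1 hzA.2
      have d2 := hloc z (hmemA z hzA.2)
      have hc : ContinuousAt (fun z => (f z * kl z - k z * fl z) * n z) z :=
        ((d1.df.continuousAt.mul d2.dk.continuousAt).sub
          (d1.dk.continuousAt.mul d2.df.continuousAt)).mul (hnd z (hmemA z hzA.2)).continuousAt
      exact (continuousAt_const.div hc (mul_ne_zero (hR0 z hzA) (hnb z hzA))).continuousWithinAt
    · have hzA := hsphere hz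
      rw [div_pow, hs, ← hQ z hzA, mul_pow, hnm z (hmemA z hzA.2)]
      have h1 := hR0 z hzA
      have h2 := hm0 z (hmemA z hzA.2)
      simp only [hN]
      field_simp
  have hNA : ∀ z ∈ A, N z ≠ 0 := by
    intro z hz h0
    rcases mul_eq_zero.1 h0 with h1 | h1
    · rw [sub_eq_zero.1 h1] at hz
      exact absurd hz.1 (not_lt.2 hr.le)
    · exact hm0 z (hmemA z hz.2) h1
  have hRz : ∀ z ∈ A, f z * kl z - k z * fl z = 0 := by
    intro z hz
    have h1 := hQ z hz
    rw [hQ0] at h1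
    rcases mul_eq_zero.1 h1 with h2 | h2
    · exact pow_eq_zero_iff two_ne_zero |>.1 h2
    · exact absurd h2 (hNA z hz)
  -- With vanishing odd part the quotient is the constant P, and the norm equation forces P = ±1.
  have hP2 : P ^ 2 = 1 := by
    have hz := hsphere hz₁
    have d1 := (h z₁ hz.1 hz.2).norm_eq
    have d2 := (hloc z₁ (hmemA z₁ hz.2)).norm_eq
    have d3 := hRz z₁ hz
    rw [hPdef]
    linear_combination (f z₁ * kl z₁ - k z₁ * fl z₁) * N z₁ * d3 +
      (kl z₁ ^ 2 - fl z₁ ^ 2 * N z₁) * d1 + d2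
  refine ⟨fun z => P * fl z, fun z => P * kl z, fun z hz => (hloc z hz).const_mul hP2,
    fun z h1 h2 => ?_⟩
  have hz : z ∈ A := ⟨h1, h2⟩
  have d2 := (hloc z (hmemA z hz.2)).norm_eq
  have d3 := hRz z hz
  constructor
  · simp only
    rw [← hP z hz]
    linear_combination f z * d2 - kl z * d3
  · simp only
    rw [← hP z hz]
    linear_combination k z * d2 - fl z * N z * d3

end Local

/-! ### Transport of μ away from the branch points -/

section Transport

open Set MeasureTheory

variable {Ω : Set ℂ} {T : ℝ} {a b c a' c' : ℝ → ℂ → ℂ}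

/-- The principal square root of `a τ / a 0`. -/
def sqrtRatio (a : ℝ → ℂ → ℂ) (τ : ℝ) (z : ℂ) : ℂ := (a τ z / a 0 z) ^ ((2 : ℕ) : ℂ)⁻¹

lemma sqrtRatio_sq (τ : ℝ) (z : ℂ) : sqrtRatio a τ z ^ 2 = a τ z / a 0 z :=
  Complex.cpow_nat_inv_pow _ two_ne_zero

lemma sqrtRatio_ne_zero {τ : ℝ} {z : ℂ} (h : a τ z / a 0 z ∈ Complex.slitPlane) :
    sqrtRatio a τ z ≠ 0 := fun h0 =>
  Complex.slitPlane_ne_zero h (by rw [← sqrtRatio_sq, h0]; simp)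

/-- The derivative of a differentiable square root. -/
lemma hasDerivAt_cpow_half {𝕜 : Type*} [NontriviallyNormedField 𝕜] [NormedAlgebra 𝕜 ℂ]
    {u : 𝕜 → ℂ} {u' : ℂ} {x : 𝕜} (hu : HasDerivAt u u' x) (h : u x ∈ Complex.slitPlane) :
    HasDerivAt (fun x => u x ^ ((2 : ℕ) : ℂ)⁻¹) (u' / (2 * u x ^ ((2 : ℕ) : ℂ)⁻¹)) x := by
  have h1 := (hasDerivAt_id (u x)).cpow_const (c := ((2 : ℕ) : ℂ)⁻¹) h
  refine ((h1.hasFDerivAt.restrictScalars 𝕜).comp_hasDerivAt x hu).congr_deriv ?_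
  have h0 := Complex.slitPlane_ne_zero h
  have h2 : u x ^ ((2 : ℕ) : ℂ)⁻¹ ≠ 0 := fun h3 => h0 (by
    rw [← Complex.cpow_nat_inv_pow (u x) two_ne_zero, h3]; simp)
  have h4 : u x ^ (((2 : ℕ) : ℂ)⁻¹ - 1) * (u x ^ ((2 : ℕ) : ℂ)⁻¹) = 1 := by
    rw [← Complex.cpow_add _ _ h0]
    have : ((2 : ℕ) : ℂ)⁻¹ - 1 + ((2 : ℕ) : ℂ)⁻¹ = 0 := by norm_num
    rw [this, Complex.cpow_zero]
  rw [eq_div_iff (mul_ne_zero two_ne_zero h2)]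
  simp
  linear_combination u' * h4

/-- Transport of the eigenvalue `μ` along the Whitham flow on a region that avoids the branch
points, by `∂ₜ ln μ = c / (ν z)`. -/
theorem exists_transported_dlog (hT : 0 < T) (hΩ : IsOpen Ω) (h0 : ∀ z ∈ Ω, z ≠ 0)
    (ha : ContinuousOn (Function.uncurry a) (Icc 0 T ×ˢ Ω))
    (hb : ContinuousOn (Function.uncurry b) (Icc 0 T ×ˢ Ω))
    (hc : ContinuousOn (Function.uncurry c) (Icc 0 T ×ˢ Ω))
    (ha' : ContinuousOn (Function.uncurry a') (Icc 0 T ×ˢ Ω))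
    (hc' : ContinuousOn (Function.uncurry c') (Icc 0 T ×ˢ Ω))
    (had : ∀ τ ∈ Icc 0 T, ∀ z ∈ Ω, HasDerivAt (a τ) (a' τ z) z)
    (hcd : ∀ τ ∈ Icc 0 T, ∀ z ∈ Ω, HasDerivAt (c τ) (c' τ z) z)
    (hW : ∀ τ ∈ Ioo 0 T, ∀ z ∈ Ω, ∃ a₁ b₁ : ℂ, HasDerivAt (fun s => a s z) a₁ τ ∧
      HasDerivAt (fun s => b s z) b₁ τ ∧
      -2 * b₁ * a τ z + b τ z * a₁ =
        -2 * z * a τ z * c' τ z + a τ z * c τ z + z * a' τ z * c τ z)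
    (hr : ∀ τ ∈ Icc 0 T, ∀ z ∈ Ω, a τ z / a 0 z ∈ Complex.slitPlane)
    {f₀ k₀ : ℂ → ℂ}
    (hμ : ∀ z ∈ Ω, DlogAt (fun z => z⁻¹ * a 0 z) (fun z => b 0 z / z ^ 2) f₀ k₀ z) :
    ∃ f k : ℂ → ℂ,
      (∀ z ∈ Ω, DlogAt (fun z => z⁻¹ * a T z) (fun z => b T z / z ^ 2) f k z) ∧
      ∀ z ∈ Ω, ∀ θ : ℂ, θ ≠ 0 →
        (∀ τ ∈ Icc 0 T, conj (z⁻¹ * a τ z) = (θ ^ 2)⁻¹ * (z⁻¹ * a τ z)) →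
        (∀ τ ∈ Icc 0 T, conj (z⁻¹ * c τ z) = θ⁻¹ * (z⁻¹ * c τ z)) →
        conj (k₀ z) = k₀ z → conj (f₀ z) = θ * f₀ z →
        conj (k z) = k z ∧ conj (f z) = θ * f z := by
  have h0I : (0 : ℝ) ∈ Icc 0 T := ⟨le_rfl, hT.le⟩
  have hTI : T ∈ Icc 0 T := ⟨hT.le, le_rfl⟩
  have hane : ∀ τ ∈ Icc 0 T, ∀ z ∈ Ω, a τ z ≠ 0 := fun τ hτ z hz h =>
    Complex.slitPlane_ne_zero (hr τ hτ z hz) (by rw [h, zero_div])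
  have hqne : ∀ τ ∈ Icc 0 T, ∀ z ∈ Ω, sqrtRatio a τ z ≠ 0 := fun τ hτ z hz =>
    sqrtRatio_ne_zero (hr τ hτ z hz)
  have hswap : MapsTo (fun p : ℝ × ℂ => ((0 : ℝ), p.2)) (Icc 0 T ×ˢ Ω) (Icc 0 T ×ˢ Ω) :=
    fun p hp => ⟨h0I, hp.2⟩
  have hswapc : ContinuousOn (fun p : ℝ × ℂ => ((0 : ℝ), p.2)) (Icc 0 T ×ˢ Ω) := by fun_prop
  have ha0 : ContinuousOn (fun p : ℝ × ℂ => a 0 p.2) (Icc 0 T ×ˢ Ω) := ha.comp hswapc hswap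
  have ha0' : ContinuousOn (fun p : ℝ × ℂ => a' 0 p.2) (Icc 0 T ×ˢ Ω) := ha'.comp hswapc hswap
  have hrc : ContinuousOn (fun p : ℝ × ℂ => a p.1 p.2 / a 0 p.2) (Icc 0 T ×ˢ Ω) :=
    ha.div ha0 fun p hp => hane 0 h0I p.2 hp.2
  have hqc : ContinuousOn (fun p : ℝ × ℂ => sqrtRatio a p.1 p.2) (Icc 0 T ×ˢ Ω) :=
    fun p hp => ContinuousWithinAt.cpow (hrc p hp) continuousWithinAt_const
      (hr p.1 hp.1 p.2 hp.2)
  have hzc : ContinuousOn (fun p : ℝ × ℂ => p.2) (Icc 0 T ×ˢ Ω) := by fun_prop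
  set q' : ℝ → ℂ → ℂ := fun τ z =>
    ((a' τ z * a 0 z - a τ z * a' 0 z) / a 0 z ^ 2) / (2 * sqrtRatio a τ z) with hq'
  have hqd : ∀ τ ∈ Icc 0 T, ∀ z ∈ Ω, HasDerivAt (sqrtRatio a τ) (q' τ z) z := fun τ hτ z hz =>
    hasDerivAt_cpow_half ((had τ hτ z hz).div (had 0 h0I z hz) (hane 0 h0I z hz)) (hr τ hτ z hz)
  have hqc' : ContinuousOn (fun p : ℝ × ℂ => q' p.1 p.2) (Icc 0 T ×ˢ Ω) := by
    refine ContinuousOn.div (((ha'.mul ha0).sub (ha.mul ha0')).div (ha0.pow 2) fun p hp => ?_)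
      (continuousOn_const.mul hqc) fun p hp => ?_
    · exact pow_ne_zero 2 (hane 0 h0I p.2 hp.2)
    · exact mul_ne_zero two_ne_zero (hqne p.1 hp.1 p.2 hp.2)
  -- With ν_τ = ν₀ · `sqrtRatio a τ`, the velocity c / (ν_τ z) of ln μ is G / ν₀. Thus ln μ_T - ln
  -- μ₀ = h / ν₀ = (h / N₀) ν₀ is odd, with h the time integral of G.
  set G : ℝ → ℂ → ℂ := fun τ z => c τ z / (sqrtRatio a τ z * z) with hG
  set G' : ℝ → ℂ → ℂ := fun τ z => (c' τ z * (sqrtRatio a τ z * z) -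
    c τ z * (q' τ z * z + sqrtRatio a τ z * 1)) / (sqrtRatio a τ z * z) ^ 2 with hG'
  have hqz : ∀ τ ∈ Icc 0 T, ∀ z ∈ Ω, sqrtRatio a τ z * z ≠ 0 := fun τ hτ z hz =>
    mul_ne_zero (hqne τ hτ z hz) (h0 z hz)
  have hGc : ContinuousOn (Function.uncurry G) (Icc 0 T ×ˢ Ω) :=
    hc.div (hqc.mul hzc) fun p hp => hqz p.1 hp.1 p.2 hp.2
  have hGc' : ContinuousOn (Function.uncurry G') (Icc 0 T ×ˢ Ω) := by
    refine ((hc'.mul (hqc.mul hzc)).sub (hc.mul ((hqc'.mul hzc).add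
      (hqc.mul continuousOn_const)))).div ((hqc.mul hzc).pow 2) fun p hp => ?_
    exact pow_ne_zero 2 (hqz p.1 hp.1 p.2 hp.2)
  have hGd : ∀ τ ∈ Icc 0 T, ∀ z ∈ Ω, HasDerivAt (G τ) (G' τ z) z := fun τ hτ z hz =>
    (hcd τ hτ z hz).div ((hqd τ hτ z hz).mul (hasDerivAt_id z)) (hqz τ hτ z hz)
  set h : ℂ → ℂ := fun z => ∫ τ in (0 : ℝ)..T, G τ z with hh
  have hhd : ∀ z ∈ Ω, HasDerivAt h (∫ τ in (0 : ℝ)..T, G' τ z) z := fun z hz =>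
    hasDerivAt_integral_param hT.le hΩ hGc hGc' hGd hz
  have hsl : ∀ {F : ℝ → ℂ → ℂ}, ContinuousOn (Function.uncurry F) (Icc 0 T ×ˢ Ω) →
      ∀ z ∈ Ω, ContinuousOn (fun τ => F τ z) (Icc 0 T) := fun hF z hz =>
    hF.comp (continuousOn_id.prodMk continuousOn_const) fun τ hτ => ⟨hτ, hz⟩
  have hsli : ∀ {F : ℝ → ℂ → ℂ}, ContinuousOn (Function.uncurry F) (Icc 0 T ×ˢ Ω) →
      ∀ z ∈ Ω, IntervalIntegrable (fun τ => F τ z) volume 0 T := fun hF z hz =>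
    ContinuousOn.intervalIntegrable (by rw [uIcc_of_le hT.le]; exact hsl hF z hz)
  have hq0 : ∀ z ∈ Ω, sqrtRatio a 0 z = 1 := fun z hz => by
    rw [sqrtRatio, div_self (hane 0 h0I z hz), Complex.one_cpow]
  set N₀ : ℂ → ℂ := fun z => z⁻¹ * a 0 z with hN₀
  have hN₀ne : ∀ z ∈ Ω, N₀ z ≠ 0 := fun z hz =>
    mul_ne_zero (inv_ne_zero (h0 z hz)) (hane 0 h0I z hz)
  have hN₀d : ∀ z ∈ Ω, HasDerivAt N₀ (-(z ^ 2)⁻¹ * a 0 z + z⁻¹ * a' 0 z) z := fun z hz =>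
    (hasDerivAt_inv (h0 z hz)).mul (had 0 h0I z hz)
  -- The Whitham equation says ∂_z (c / (ν z)) = ∂_τ (b / (ν z²)). This is its time integral,
  -- multiplied by ν₀.
  have hkey : ∀ z ∈ Ω, (∫ τ in (0 : ℝ)..T, G' τ z) -
      h z * ((-(z ^ 2)⁻¹ * a 0 z + z⁻¹ * a' 0 z) / (2 * N₀ z)) =
      b T z / (sqrtRatio a T z * z ^ 2) - b 0 z / z ^ 2 := by
    intro z hz
    have hz0 := h0 z hz
    have hcont : ContinuousOn (fun τ => b τ z / (sqrtRatio a τ z * z ^ 2)) (Icc 0 T) :=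
      (hsl hb z hz).div ((hsl (F := sqrtRatio a) hqc z hz).mul continuousOn_const) fun τ hτ =>
        mul_ne_zero (hqne τ hτ z hz) (pow_ne_zero 2 hz0)
    have hint := (hsli hGc' z hz).sub
      ((hsli hGc z hz).mul_const ((-(z ^ 2)⁻¹ * a 0 z + z⁻¹ * a' 0 z) / (2 * N₀ z)))
    -- The flow need not be differentiable at the endpoints; continuity on the closed interval is
    -- enough.
    have hftc := intervalIntegral.integral_eq_sub_of_hasDerivAt_of_le hT.le hcont
      (f' := fun τ => G' τ z - G τ z * ((-(z ^ 2)⁻¹ * a 0 z + z⁻¹ * a' 0 z) / (2 * N₀ z)))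
      (fun τ hτ => ?_) hint
    · rw [hq0 z hz, one_mul] at hftc
      rw [← hftc, intervalIntegral.integral_sub (hsli hGc' z hz) ((hsli hGc z hz).mul_const _),
        intervalIntegral.integral_mul_const]
    · have hτ' := Ioo_subset_Icc_self hτ
      obtain ⟨a₁, b₁, ha₁, hb₁, hWe⟩ := hW τ hτ z hz
      have hqτ : HasDerivAt (fun s => sqrtRatio a s z) (a₁ / a 0 z / (2 * sqrtRatio a τ z)) τ :=
        hasDerivAt_cpow_half (ha₁.div_const (a 0 z)) (hr τ hτ' z hz)
      have hq1 := hqne τ hτ' z hz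
      have hq2 := sqrtRatio_sq (a := a) τ z
      have ha1 := hane 0 h0I z hz
      have ha2 := hane τ hτ' z hz
      refine (hb₁.div (hqτ.mul_const (z ^ 2)) (mul_ne_zero hq1 (pow_ne_zero 2 hz0))).congr_deriv ?_
      simp only [hG, hG', hq', hN₀]
      rw [eq_div_iff ha1] at hq2
      have e1 : a 0 z = a τ z / sqrtRatio a τ z ^ 2 := by
        rw [← hq2]; field_simp
      rw [e1]
      field_simp
      linear_combination -hWe
  have hℓ : ∀ z ∈ Ω, DlogAt N₀ (fun z => b T z / (sqrtRatio a T z * z ^ 2) - b 0 z / z ^ 2)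
      (fun z => h z / N₀ z * sinhcSqrt (N₀ z * (h z / N₀ z) ^ 2))
      (fun z => coshSqrt (N₀ z * (h z / N₀ z) ^ 2)) z := by
    intro z hz
    have hd : HasDerivAt (fun z => h z / N₀ z) _ z := (hhd z hz).div (hN₀d z hz) (hN₀ne z hz)
    refine dlogAt_exp (hN₀d z hz).differentiableAt hd.differentiableAt ?_
    rw [hd.deriv, (hN₀d z hz).deriv]
    rw [← hkey z hz]
    have := hN₀ne z hz
    field_simp
    ring
  have hprod : ∀ z ∈ Ω, DlogAt N₀ _ _ _ z := fun z hz =>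
    (hμ z hz).mul (hℓ z hz) (hN₀d z hz).differentiableAt
  -- μ_T is μ₀ times exp((h / N₀) ν₀), rewritten in terms of ν_T.
  refine ⟨_, _, fun z hz => ((hprod z hz).rescale (hN₀d z hz).differentiableAt
    (hqd T hTI z hz).differentiableAt (hqne T hTI z hz)).congr ?_ ?_
      Filter.EventuallyEq.rfl Filter.EventuallyEq.rfl, ?_⟩
  · filter_upwards [hΩ.mem_nhds hz] with x hx
    rw [sqrtRatio_sq, hN₀]
    have := hane 0 h0I x hx
    field_simp
  · have := hqne T hTI z hz
    have := h0 z hz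
    field_simp
    ring
  · intro z hz θ hθ hca hcc hk hf
    -- At such a point the ratio a_τ / a₀ is real and lies in the slit plane, so its principal root
    -- is real. Hence h and h / N₀ transform under conjugation by powers of θ only.
    have hratio : ∀ τ ∈ Icc 0 T, conj (sqrtRatio a τ z) = sqrtRatio a τ z := by
      intro τ hτ
      have e : a τ z / a 0 z = (z⁻¹ * a τ z) / (z⁻¹ * a 0 z) := by
        rw [mul_div_mul_left _ _ (inv_ne_zero (h0 z hz))]
      have h1 : conj (a τ z / a 0 z) = a τ z / a 0 z := by
        rw [e, map_div₀, hca τ hτ, hca 0 h0I,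
          mul_div_mul_left _ _ (inv_ne_zero (pow_ne_zero 2 hθ))]
      have h2 := Complex.cpow_conj (a τ z / a 0 z) ((2 : ℕ) : ℂ)⁻¹
        (Complex.slitPlane_arg_ne_pi (hr τ hτ z hz))
      rw [h1, map_inv₀, Complex.conj_natCast] at h2
      exact h2.symm
    have hhc : conj (h z) = θ⁻¹ * h z := by
      rw [hh]
      simp only
      rw [← intervalIntegral.integral_const_mul, ← intervalIntegral.intervalIntegral_conj]
      refine intervalIntegral.integral_congr fun τ hτ => ?_
      rw [uIcc_of_le hT.le] at hτ
      have e : G τ z = (z⁻¹ * c τ z) / sqrtRatio a τ z := by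
        have := hqne τ hτ z hz
        have := h0 z hz
        simp only [hG]
        field_simp
      change conj (G τ z) = θ⁻¹ * G τ z
      rw [e, map_div₀, hratio τ hτ, hcc τ hτ, mul_div_assoc]
    have hNc : conj (N₀ z) = (θ ^ 2)⁻¹ * N₀ z := hca 0 h0I
    have hℓc : conj (h z / N₀ z) = θ * (h z / N₀ z) := by
      rw [map_div₀, hhc, hNc]
      have := hN₀ne z hz
      field_simp
    have hXc : conj (N₀ z * (h z / N₀ z) ^ 2) = N₀ z * (h z / N₀ z) ^ 2 := by
      rw [map_mul, map_pow, hℓc, hNc]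
      field_simp
    have hCc := coshSqrt_conj (N₀ z * (h z / N₀ z) ^ 2)
    have hSc := sinhcSqrt_conj (N₀ z * (h z / N₀ z) ^ 2)
    rw [hXc] at hCc hSc
    constructor
    · simp only [map_add, map_mul, hk, hf, ← hCc, ← hSc, hℓc, hNc]
      field_simp
    · simp only [map_add, map_mul, map_div₀, hk, hf, ← hCc, ← hSc, hratio T hTI]
      rw [← map_div₀, hℓc]
      field_simp

end Transport

/-! ### Translation between monodromy eigenvalues and pairs (f, k) -/

section Eigenvalue

open Set

lemma eval_poly {n : ℕ} (v : Fin n → ℂ) (z : ℂ) : (poly v).eval z = ∑ i, v i * z ^ (i : ℕ) := by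
  simp [poly, eval_finsetSum]

lemma eval_derivative_poly {n : ℕ} (v : Fin n → ℂ) (z : ℂ) :
    (derivative (poly v)).eval z = ∑ i, v i * (((i : ℕ) : ℂ) * z ^ ((i : ℕ) - 1)) := by
  simp only [poly, derivative_sum, eval_finsetSum, derivative_C_mul_X_pow, eval_mul, eval_C,
    eval_pow, eval_X]
  exact Finset.sum_congr rfl fun i _ => by ring

lemma hasDerivAt_eval_poly {n : ℕ} {v : ℝ → Fin n → ℂ} {v' : Fin n → ℂ} {t : ℝ}
    (h : HasDerivAt v v' t) (z : ℂ) :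
    HasDerivAt (fun s => (poly (v s)).eval z) ((poly v').eval z) t := by
  simp only [eval_poly]
  exact HasDerivAt.fun_sum fun i _ => (hasDerivAt_pi.1 h i).mul_const _

lemma hasDerivAt_eval_aPoly {g : ℕ} {γ : ℝ → PolyPair g} {v : PolyPair g} {t : ℝ}
    (h : HasDerivAt γ v t) (z : ℂ) :
    HasDerivAt (fun s => (aPoly (γ s)).eval z) ((aPoly v).eval z) t :=
  hasDerivAt_eval_poly
    ((ContinuousLinearMap.fst ℝ (Fin (2 * g + 1) → ℂ) (Fin (g + 2) → ℂ)).hasFDerivAt.comp_hasDerivAt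
      t h) z

lemma hasDerivAt_eval_bPoly {g : ℕ} {γ : ℝ → PolyPair g} {v : PolyPair g} {t : ℝ}
    (h : HasDerivAt γ v t) (z : ℂ) :
    HasDerivAt (fun s => (bPoly (γ s)).eval z) ((bPoly v).eval z) t :=
  hasDerivAt_eval_poly
    ((ContinuousLinearMap.snd ℝ (Fin (2 * g + 1) → ℂ) (Fin (g + 2) → ℂ)).hasFDerivAt.comp_hasDerivAt
      t h) z

lemma continuousOn_eval_poly {n : ℕ} {v : ℝ → Fin n → ℂ} {s : Set ℝ} {t : Set ℂ}
    (h : ContinuousOn v s) :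
    ContinuousOn (fun p : ℝ × ℂ => (poly (v p.1)).eval p.2) (s ×ˢ t) := by
  simp only [eval_poly]
  refine continuousOn_finsetSum _ fun i _ => ContinuousOn.mul ?_ (by fun_prop)
  exact (continuousOn_pi.1 h i).comp continuousOn_fst fun p hp => hp.1

lemma continuousOn_eval_derivative_poly {n : ℕ} {v : ℝ → Fin n → ℂ} {s : Set ℝ} {t : Set ℂ}
    (h : ContinuousOn v s) :
    ContinuousOn (fun p : ℝ × ℂ => (derivative (poly (v p.1))).eval p.2) (s ×ˢ t) := by
  simp only [eval_derivative_poly]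
  refine continuousOn_finsetSum _ fun i _ => ContinuousOn.mul ?_ (by fun_prop)
  exact (continuousOn_pi.1 h i).comp continuousOn_fst fun p hp => hp.1

lemma conj_zpow_of_norm_eq_one (g : ℕ) {z : ℂ} (hz : ‖z‖ = 1) :
    (conj z) ^ (1 - (g : ℤ)) = z ^ g * z⁻¹ := by
  have h0 : z ≠ 0 := fun h => by simp [h] at hz
  rw [← Complex.inv_eq_conj hz, inv_zpow', neg_sub, zpow_sub₀ h0]
  simp [div_eq_mul_inv]

variable {g : ℕ} {a b : ℂ[X]}

/-- The even and odd parts of a monodromy eigenvalue satisfy the differential equations of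
`d ln μ = b dλ / (ν λ²)`. -/
lemma IsMonodromyEigenvalue.exists_dlogAt {μ : ℂ × ℂ → ℂ} (h : IsMonodromyEigenvalue g a b μ)
    (ha : ∀ z : ℂ, z ≠ 0 → z ^ (2 * g) * conj (a.eval (conj z)⁻¹) = a.eval z) :
    ∃ f k : ℂ → ℂ,
      (∀ z : ℂ, z ≠ 0 → a.eval z ≠ 0 →
        DlogAt (fun z => z⁻¹ * a.eval z) (fun z => b.eval z / z ^ 2) f k z) ∧
      ∀ z : ℂ, ‖z‖ = 1 → a.eval z ≠ 0 →
        conj (k z) = k z ∧ conj (f z) = (z ^ g * z⁻¹) * f z := by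
  obtain ⟨f, k, hf, hk, hμ⟩ := h.holomorphic
  refine ⟨f, k, fun z hz haz => ?_, fun z hz haz => ?_⟩
  · have hfz : DifferentiableAt ℂ f z := hf.differentiableAt (isOpen_ne.mem_nhds hz)
    have hkz : DifferentiableAt ℂ k z := hk.differentiableAt (isOpen_ne.mem_nhds hz)
    set N : ℂ → ℂ := fun z => z⁻¹ * a.eval z with hN
    have hNa : AnalyticAt ℂ N z := (analyticAt_inv hz).mul
      (AnalyticOnNhd.eval_polynomial a z (mem_univ z))
    have hNz : N z ≠ 0 := mul_ne_zero (inv_ne_zero hz) haz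
    obtain ⟨n, hn⟩ := exists_sq_eq' (N z)
    obtain ⟨ν, hν, hνz, hν2⟩ := exists_analyticAt_sqrt hNa hNz hn
    have hn0 : n ≠ 0 := fun h0 => hNz (by rw [← hn, h0]; simp)
    have hcurve : ∀ᶠ w in 𝓝 z, (w, ν w) ∈ spectralCurve a := by
      filter_upwards [hν2, isOpen_ne.mem_nhds hz] with w hw hw0 using ⟨hw0, hw⟩
    have hcurve' : ∀ᶠ w in 𝓝 z, (w, -ν w) ∈ spectralCurve a := by
      filter_upwards [hν2, isOpen_ne.mem_nhds hz] with w hw hw0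
      exact ⟨hw0, by rw [neg_sq]; exact hw⟩
    have hmem := hcurve.self_of_nhds
    have h1 := (h.dlog z ν hν (by rwa [hνz]) hcurve)
    -- The second branch is needed to separate the even from the odd part: half the sum and half the
    -- difference of the two identities give the equations for k and f.
    have h2 := (h.dlog z (fun w => -ν w) hν.neg (by rw [hνz]; exact neg_ne_zero.2 hn0) hcurve')
    have h3 : HasDerivAt (fun w => f w * ν w + k w) _ z :=
      (hfz.hasDerivAt.mul hν.differentiableAt.hasDerivAt).add hkz.hasDerivAt
    have h4 : HasDerivAt (fun w => f w * -ν w + k w) _ z :=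
      (hfz.hasDerivAt.mul hν.differentiableAt.hasDerivAt.neg).add hkz.hasDerivAt
    have h5 := h3.unique (h1.congr_of_eventuallyEq (hcurve.mono fun w hw => (hμ _ hw).symm))
    have h6 := h4.unique (h2.congr_of_eventuallyEq (hcurve'.mono fun w hw => (hμ _ hw).symm))
    have hdN : deriv N z = 2 * n * deriv ν z := by
      have h7 : HasDerivAt (fun w => ν w ^ 2) (2 * ν z * deriv ν z) z :=
        (hν.differentiableAt.hasDerivAt.pow 2).congr_deriv (by simp)
      rw [hνz] at h7
      exact (h7.congr_of_eventuallyEq (hν2.mono fun w hw => hw.symm)).deriv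
    have hsig := h.sigma _ hmem
    have hsig := (congrArg (· * μ (z, ν z)) hsig).trans (inv_mul_cancel₀ (h.ne_zero _ hmem))
    rw [sigmaInv, hμ _ hcurve'.self_of_nhds,
      hμ _ hmem] at hsig
    rw [hμ _ hmem] at h5
    rw [hμ _ hcurve'.self_of_nhds] at h6
    simp only [Pi.neg_apply, hνz] at h5 h6 hsig
    have e1 : b.eval z / (n * z ^ 2) = b.eval z / z ^ 2 / n := by field_simp
    have e2 : b.eval z / (-n * z ^ 2) = -(b.eval z / z ^ 2 / n) := by field_simp
    have e3 : n * (b.eval z / z ^ 2 / n) = b.eval z / z ^ 2 := mul_div_cancel₀ _ hn0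
    rw [e1] at h5
    rw [e2] at h6
    refine ⟨hfz, hkz, ?_, ?_, ?_⟩
    · rw [← hn]
      linear_combination hsig
    · linear_combination (h5 + h6) / 2 + f z * e3
    · rw [hdN, ← hn]
      linear_combination n * (h5 - h6) / 2 + k z * e3
  · have hz0 : z ≠ 0 := fun h => by simp [h] at hz
    have hcz : (conj z)⁻¹ = z := by rw [← Complex.inv_eq_conj hz, inv_inv]
    obtain ⟨n, hn⟩ := exists_sq_eq' (z⁻¹ * a.eval z)
    have hn0 : n ≠ 0 := fun h0 => mul_ne_zero (inv_ne_zero hz0) haz (by rw [← hn, h0]; simp)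
    have haz' := ha z hz0
    rw [hcz] at haz'
    -- On the unit circle η fixes λ, so the relation for both roots ±m separates into one for k and
    -- one for f.
    have hη : ∀ m : ℂ, m ^ 2 = z⁻¹ * a.eval z →
        f z * (z ^ g * z⁻¹ * conj m) + k z = conj (f z * m + k z) := by
      intro m hm
      have hmem : (z, m) ∈ spectralCurve a := ⟨hz0, hm⟩
      have h1 := h.eta _ hmem
      have h2 : etaInv g (z, m) = (z, z ^ g * z⁻¹ * conj m) := by
        rw [etaInv, conj_zpow_of_norm_eq_one g hz, hcz]
      have hmem' : (z, z ^ g * z⁻¹ * conj m) ∈ spectralCurve a := by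
        refine ⟨hz0, ?_⟩
        simp only
        rw [mul_pow, ← map_pow, hm, map_mul, map_inv₀, hcz]
        have e : (z ^ g * z⁻¹) ^ 2 * (z * conj (a.eval z)) =
            z⁻¹ * (z ^ (2 * g) * conj (a.eval z)) := by
          field_simp
          ring
        rw [e, haz']
      rw [h2, hμ _ hmem', hμ _ hmem] at h1
      exact h1
    have h1 := hη n hn
    have h2 := hη (-n) (by rw [neg_sq, hn])
    simp only [map_add, map_mul, map_neg] at h1 h2
    have hn0' : conj n ≠ 0 := by simpa using hn0
    constructor
    · linear_combination -(h1 + h2) / 2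
    · refine mul_right_cancel₀ hn0' ?_
      linear_combination (h2 - h1) / 2

/-- A pair of holomorphic functions solving the differential equations on `ℂ*` defines a monodromy
eigenvalue. -/
lemma isMonodromyEigenvalue_of_dlogAt {f k : ℂ → ℂ}
    (h : ∀ z : ℂ, z ≠ 0 → DlogAt (fun z => z⁻¹ * a.eval z) (fun z => b.eval z / z ^ 2) f k z)
    (hk : ∀ z : ℂ, z ≠ 0 → k (conj z)⁻¹ = conj (k z))
    (hf : ∀ z : ℂ, z ≠ 0 → f (conj z)⁻¹ * (conj z) ^ (1 - (g : ℤ)) = conj (f z)) :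
    IsMonodromyEigenvalue g a b (fun q => f q.1 * q.2 + k q.1) := by
  have hinv : ∀ q ∈ spectralCurve a, (k q.1 + f q.1 * q.2) * (k q.1 - f q.1 * q.2) = 1 := by
    rintro ⟨z, n⟩ ⟨hz, hn⟩
    have := (h z hz).norm_eq
    simp only at hn ⊢
    rw [← hn] at this
    linear_combination this
  have hne : ∀ q ∈ spectralCurve a, f q.1 * q.2 + k q.1 ≠ 0 := fun q hq h0 => by
    have := hinv q hq
    rw [add_comm, h0, zero_mul] at this
    exact zero_ne_one this
  have hsig : ∀ q ∈ spectralCurve a, f q.1 * -q.2 + k q.1 = (f q.1 * q.2 + k q.1)⁻¹ :=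
    fun q hq => by
      refine eq_inv_of_mul_eq_one_left ?_
      linear_combination hinv q hq
  refine ⟨⟨f, k, fun z hz => (h z hz).df.differentiableWithinAt,
    fun z hz => (h z hz).dk.differentiableWithinAt, fun q _ => rfl⟩, hne, hsig, ?_, ?_, ?_, ?_⟩
  · rintro ⟨z, n⟩ hq
    have h1 := hsig _ hq
    have h2 := hf z hq.1
    have h3 := hk z hq.1
    simp only [rhoInv] at h1 ⊢
    rw [h3, ← map_inv₀ (starRingEnd ℂ) (f z * n + k z), ← h1, map_add, map_mul, map_neg, ← h2]
    ring
  · rintro ⟨z, n⟩ hq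
    have h2 := hf z hq.1
    have h3 := hk z hq.1
    simp only [etaInv]
    rw [h3, map_add, map_mul, ← h2]
    ring
  · intro z hz haz
    have := (h z hz).norm_eq
    simp only [haz, mul_zero, sub_zero, zero_add] at this ⊢
    exact mul_self_eq_one_iff.1 (by rw [← sq, this])
  · intro z ν hν hν0 hc
    have hz := hc.self_of_nhds.1
    have hd := h z hz
    have hνd := hν.differentiableAt.hasDerivAt
    refine ((hd.df.hasDerivAt.mul hνd).add hd.dk.hasDerivAt).congr_deriv ?_
    have h7 : HasDerivAt (fun w => ν w ^ 2) (2 * ν z * deriv ν z) z :=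
      (hνd.pow 2).congr_deriv (by simp)
    have h8 : deriv (fun z => z⁻¹ * a.eval z) z = 2 * ν z * deriv ν z :=
      (h7.congr_of_eventuallyEq (hc.mono fun w hw => hw.2.symm)).deriv
    have h9 : ν z ^ 2 = z⁻¹ * a.eval z := hc.self_of_nhds.2
    have h10 := hd.deriv_f
    rw [h8, ← h9] at h10
    rw [hd.deriv_k]
    have h11 : deriv f z * ν z + f z * deriv ν z = k z * (b.eval z / z ^ 2) / ν z := by
      rw [eq_div_iff hν0, ← h10]; ring
    rw [h11]
    simp only
    field_simp
    ring

end Eigenvalue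

/-! ### Persistence of the monodromy eigenvalue along the flow -/

section Persistence

open Set Metric

/-- Functions on a region and on pairwise disjoint balls that agree on the overlaps glue. -/
lemma exists_glued_dlog {I : Type*} {ρ₀ : I → ℂ} {δ R : ℝ} {N w : ℂ → ℂ} {Ω : Set ℂ} (hΩ : IsOpen Ω)
    (hdisj : ∀ i j, i ≠ j → Disjoint (ball (ρ₀ i) R) (ball (ρ₀ j) R))
    {f k : ℂ → ℂ} {f' k' : I → ℂ → ℂ} (hδ : ∀ z ∈ Ω, ∀ i, δ < ‖z - ρ₀ i‖)
    (h : ∀ z ∈ Ω, DlogAt N w f k z) (h' : ∀ i, ∀ z ∈ ball (ρ₀ i) R, DlogAt N w (f' i) (k' i) z)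
    (hagree : ∀ i (z : ℂ), δ < ‖z - ρ₀ i‖ → ‖z - ρ₀ i‖ < R → f' i z = f z ∧ k' i z = k z) :
    ∃ F K : ℂ → ℂ, (∀ z ∈ Ω, F z = f z ∧ K z = k z) ∧
      (∀ z, z ∈ Ω ∨ (∃ i, z ∈ ball (ρ₀ i) R) → DlogAt N w F K z) := by
  classical
  set F : ℂ → ℂ := fun z => if h : ∃ i, z ∈ ball (ρ₀ i) R then f' h.choose z else f z with hF
  set K : ℂ → ℂ := fun z => if h : ∃ i, z ∈ ball (ρ₀ i) R then k' h.choose z else k z with hK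
  have huniq : ∀ i z, z ∈ ball (ρ₀ i) R → ∀ h : ∃ j, z ∈ ball (ρ₀ j) R, h.choose = i := by
    intro i z hz h
    by_contra hne
    exact Set.disjoint_left.1 (hdisj _ _ hne) h.choose_spec hz
  have hball : ∀ i, ∀ z ∈ ball (ρ₀ i) R, F z = f' i z ∧ K z = k' i z := by
    intro i z hz
    have hex : ∃ j, z ∈ ball (ρ₀ j) R := ⟨i, hz⟩
    simp only [hF, hK, dif_pos hex, huniq i z hz hex, and_self]
  have hΩe : ∀ z ∈ Ω, F z = f z ∧ K z = k z := by
    intro z hz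
    by_cases hex : ∃ i, z ∈ ball (ρ₀ i) R
    · obtain ⟨i, hi⟩ := hex
      rw [(hball i z hi).1, (hball i z hi).2]
      exact hagree i z (hδ z hz i) (mem_ball_iff_norm.1 hi)
    · simp only [hF, hK, dif_neg hex, and_self]
  refine ⟨F, K, hΩe, fun z hz => ?_⟩
  rcases hz with hz | ⟨i, hi⟩
  · refine (h z hz).congr Filter.EventuallyEq.rfl rfl ?_ ?_
    · filter_upwards [hΩ.mem_nhds hz] with x hx using (hΩe x hx).1
    · filter_upwards [hΩ.mem_nhds hz] with x hx using (hΩe x hx).2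
  · refine (h' i z hi).congr Filter.EventuallyEq.rfl rfl ?_ ?_
    · filter_upwards [isOpen_ball.mem_nhds hi] with x hx using (hball i x hx).1
    · filter_upwards [isOpen_ball.mem_nhds hi] with x hx using (hball i x hx).2

/-- Two holomorphic functions on `ℂ*` that agree on the unit circle are equal. -/
lemma eq_of_eq_on_unit_circle {f h : ℂ → ℂ} (hf : DifferentiableOn ℂ f {z | z ≠ 0})
    (hh : DifferentiableOn ℂ h {z | z ≠ 0}) (heq : ∀ z : ℂ, ‖z‖ = 1 → f z = h z) :
    ∀ z : ℂ, z ≠ 0 → f z = h z := by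
  have hpre : IsPreconnected {z : ℂ | z ≠ 0} := by
    have := (isConnected_compl_singleton_of_one_lt_rank (E := ℂ) (by simp) 0).isPreconnected
    exact this
  have hacc : ∃ᶠ z in 𝓝[≠] (1 : ℂ), f z = h z := by
    -- Points of the circle accumulate at 1, so the identity theorem applies on the connected set
    -- ℂ*.
    have h1 : Filter.Tendsto (fun θ : ℝ => Complex.exp (θ * Complex.I)) (𝓝[>] 0) (𝓝[≠] 1) := by
      refine tendsto_nhdsWithin_iff.2 ⟨?_, ?_⟩
      · have : Continuous fun θ : ℝ => Complex.exp (θ * Complex.I) := by fun_prop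
        simpa using (this.tendsto 0).mono_left nhdsWithin_le_nhds
      · filter_upwards [Ioo_mem_nhdsGT Real.pi_pos] with θ hθ h2
        have h3 : Complex.exp (θ * Complex.I) = 1 := h2
        have h4 := congrArg Complex.im h3
        rw [Complex.exp_ofReal_mul_I_im, Complex.one_im] at h4
        exact (Real.sin_pos_of_pos_of_lt_pi hθ.1 hθ.2).ne' h4
    exact h1.frequently (Filter.Eventually.of_forall fun θ =>
      heq _ (Complex.norm_exp_ofReal_mul_I θ)).frequently
  exact fun z hz => (hf.analyticOnNhd isOpen_ne).eqOn_of_preconnected_of_frequently_eq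
    (hh.analyticOnNhd isOpen_ne) hpre (by simp) hacc hz

/-- Along the Whitham flow the existence of a monodromy eigenvalue persists, as long as the roots of
`a` stay in fixed small disjoint discs. -/
theorem exists_isMonodromyEigenvalue_of_whitham {g : ℕ} {γ : ℝ → PolyPair g}
    {c : ℝ → Fin (g + 2) → ℂ} {T : ℝ} (hT : 0 < T) (hγ : ContinuousOn γ (Icc 0 T))
    (hc : ContinuousOn c (Icc 0 T))
    (hd : ∀ τ ∈ Ioo 0 T, ∃ v, HasDerivAt γ v τ ∧ WhithamEq (c τ) (γ τ) v)
    (ha : ∀ τ ∈ Icc 0 T, ∀ z : ℂ, z ≠ 0 →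
      z ^ (2 * g) * conj ((aPoly (γ τ)).eval (conj z)⁻¹) = (aPoly (γ τ)).eval z)
    (hcr : ∀ τ ∈ Icc 0 T, IsRealC g (c τ))
    (hμ : ∃ μ, IsMonodromyEigenvalue g (aPoly (γ 0)) (bPoly (γ 0)) μ)
    {I : Type*} [Fintype I] {ρ₀ ρ : I → ℂ} {δ : ℝ} (hδ : 0 < δ)
    (hsep : ∀ i j, i ≠ j → 8 * δ ≤ ‖ρ₀ i - ρ₀ j‖) (hρ₀ : ∀ i, 4 * δ ≤ ‖ρ₀ i‖)
    (hcirc : ∀ i (z : ℂ), ‖z‖ = 1 → δ < ‖z - ρ₀ i‖) (hρ : ∀ i, ‖ρ i - ρ₀ i‖ < δ)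
    {L : ℂ} (hL : L ≠ 0) (haT : ∀ z, (aPoly (γ T)).eval z = L * ∏ i, (z - ρ i))
    (hratio : ∀ τ ∈ Icc 0 T, ∀ z : ℂ, (∀ i, δ < ‖z - ρ₀ i‖) →
      (aPoly (γ τ)).eval z / (aPoly (γ 0)).eval z ∈ Complex.slitPlane) :
    ∃ μ, IsMonodromyEigenvalue g (aPoly (γ T)) (bPoly (γ T)) μ := by
  classical
  obtain ⟨μ, hμ⟩ := hμ
  have h0I : (0 : ℝ) ∈ Icc 0 T := ⟨le_rfl, hT.le⟩
  have hTI : T ∈ Icc 0 T := ⟨hT.le, le_rfl⟩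
  obtain ⟨f₀, k₀, hfk, hfkr⟩ := hμ.exists_dlogAt (ha 0 h0I)
  -- Ω need not be simply connected. Since the transport integrates in time and uses the single
  -- valued root of a_τ / a₀, no path in z is involved.
  set Ω : Set ℂ := {z | z ≠ 0} ∩ ⋂ i, {z | δ < ‖z - ρ₀ i‖} with hΩdef
  have hΩ : IsOpen Ω := isOpen_ne.inter (isOpen_iInter_of_finite fun i =>
    isOpen_lt continuous_const (by fun_prop))
  have hΩi : ∀ z ∈ Ω, ∀ i, δ < ‖z - ρ₀ i‖ := fun z hz i => mem_iInter.1 hz.2 i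
  have hΩm : ∀ z : ℂ, z ≠ 0 → (∀ i, δ < ‖z - ρ₀ i‖) → z ∈ Ω := fun z hz h =>
    ⟨hz, mem_iInter.2 h⟩
  have ha0 : ∀ z ∈ Ω, (aPoly (γ 0)).eval z ≠ 0 := fun z hz h =>
    Complex.slitPlane_ne_zero (hratio 0 h0I z (hΩi z hz)) (by rw [h, div_zero])
  have hγ1 : ContinuousOn (fun τ => (γ τ).1) (Icc 0 T) := continuous_fst.comp_continuousOn hγ
  have hγ2 : ContinuousOn (fun τ => (γ τ).2) (Icc 0 T) := continuous_snd.comp_continuousOn hγ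
  have hW : ∀ τ ∈ Ioo 0 T, ∀ z ∈ Ω, ∃ a₁ b₁ : ℂ,
      HasDerivAt (fun s => (aPoly (γ s)).eval z) a₁ τ ∧
      HasDerivAt (fun s => (bPoly (γ s)).eval z) b₁ τ ∧
      -2 * b₁ * (aPoly (γ τ)).eval z + (bPoly (γ τ)).eval z * a₁ =
        -2 * z * (aPoly (γ τ)).eval z * (derivative (poly (c τ))).eval z +
          (aPoly (γ τ)).eval z * (poly (c τ)).eval z +
          z * (derivative (aPoly (γ τ))).eval z * (poly (c τ)).eval z := by
    intro τ hτ z _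
    obtain ⟨v, hv, hW⟩ := hd τ hτ
    refine ⟨_, _, hasDerivAt_eval_aPoly hv z, hasDerivAt_eval_bPoly hv z, ?_⟩
    simpa using congrArg (Polynomial.eval z) hW
  have hca : ContinuousOn (Function.uncurry fun τ z => (aPoly (γ τ)).eval z) (Icc 0 T ×ˢ Ω) :=
    continuousOn_eval_poly (v := fun τ => (γ τ).1) hγ1
  have hcb : ContinuousOn (Function.uncurry fun τ z => (bPoly (γ τ)).eval z) (Icc 0 T ×ˢ Ω) :=
    continuousOn_eval_poly (v := fun τ => (γ τ).2) hγ2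
  have hca' : ContinuousOn (Function.uncurry fun τ z => (derivative (aPoly (γ τ))).eval z)
      (Icc 0 T ×ˢ Ω) := continuousOn_eval_derivative_poly (v := fun τ => (γ τ).1) hγ1
  obtain ⟨f, k, hfkΩ, hreal⟩ := exists_transported_dlog (Ω := Ω) hT hΩ (fun z hz => hz.1)
    hca hcb (c := fun τ z => (poly (c τ)).eval z) (continuousOn_eval_poly hc) hca'
    (c' := fun τ z => (derivative (poly (c τ))).eval z) (continuousOn_eval_derivative_poly hc)
    (fun τ _ z _ => Polynomial.hasDerivAt _ z) (fun τ _ z _ => Polynomial.hasDerivAt _ z)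
    hW (fun τ hτ z hz => hratio τ hτ z (hΩi z hz)) (fun z hz => hfk z hz.1 (ha0 z hz))
  have hdisj : ∀ i j, i ≠ j → Disjoint (ball (ρ₀ i) (4 * δ)) (ball (ρ₀ j) (4 * δ)) := by
    intro i j hij
    refine ball_disjoint_ball ?_
    rw [dist_eq_norm]
    linarith [hsep i j hij]
  have hloc : ∀ i, ∃ f' k' : ℂ → ℂ,
      (∀ z ∈ ball (ρ₀ i) (4 * δ), DlogAt (fun z => z⁻¹ * (aPoly (γ T)).eval z)
        (fun z => (bPoly (γ T)).eval z / z ^ 2) f' k' z) ∧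
      ∀ z : ℂ, δ < ‖z - ρ₀ i‖ → ‖z - ρ₀ i‖ < 4 * δ → f' z = f z ∧ k' z = k z := by
    intro i
    have hz0 : ∀ z ∈ ball (ρ₀ i) (4 * δ), z ≠ 0 := by
      intro z hz h
      rw [h, mem_ball_iff_norm, zero_sub, norm_neg] at hz
      linarith [hρ₀ i]
    have hN : (fun z => z⁻¹ * (aPoly (γ T)).eval z) = fun z =>
        (z - ρ i) * (z⁻¹ * (L * ∏ j ∈ Finset.univ.erase i, (z - ρ j))) := by
      funext z
      rw [haT, ← Finset.mul_prod_erase Finset.univ _ (Finset.mem_univ i)]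
      ring
    rw [hN]
    -- The overlap with Ω is the annulus from δ to 4 δ. The separation 8 δ keeps all other roots out
    -- of this disc, so the cofactor of z - ρ i does not vanish there.
    refine exists_extension_to_ball (hρ i) (by linarith) ?_ ?_ ?_ fun z h1 h2 => ?_
    · refine DifferentiableOn.mul (differentiableOn_inv.mono hz0) ?_
      exact (Differentiable.const_mul (Differentiable.fun_finsetProd fun j _ => by fun_prop)
        L).differentiableOn
    · intro z hz
      refine mul_ne_zero (inv_ne_zero (hz0 z hz)) (mul_ne_zero hL (Finset.prod_ne_zero_iff.2 ?_))
      intro j hj h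
      rw [sub_eq_zero] at h
      rw [h, mem_ball_iff_norm] at hz
      have h1 := hsep j i (Finset.ne_of_mem_erase hj)
      have h2 : ρ₀ j - ρ₀ i = (ρ j - ρ₀ i) - (ρ j - ρ₀ j) := by ring
      rw [h2] at h1
      linarith [norm_sub_le (ρ j - ρ₀ i) (ρ j - ρ₀ j), hρ j]
    · refine DifferentiableOn.div (Polynomial.differentiable _).differentiableOn
        (by fun_prop) fun z hz => pow_ne_zero 2 (hz0 z hz)
    · rw [← hN]
      have hzb : z ∈ ball (ρ₀ i) (4 * δ) := mem_ball_iff_norm.2 h2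
      refine hfkΩ z (hΩm z (hz0 z hzb) fun j => ?_)
      by_cases hj : j = i
      · rwa [hj]
      · have h3 := hsep j i hj
        have h4 : ρ₀ j - ρ₀ i = (z - ρ₀ i) - (z - ρ₀ j) := by ring
        rw [h4] at h3
        linarith [norm_sub_le (z - ρ₀ i) (z - ρ₀ j)]
  choose f' k' hfk' hagree using hloc
  obtain ⟨F, K, hFK, hall⟩ := exists_glued_dlog hΩ hdisj hΩi hfkΩ hfk' hagree
  have hall' : ∀ z : ℂ, z ≠ 0 → DlogAt (fun z => z⁻¹ * (aPoly (γ T)).eval z)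
      (fun z => (bPoly (γ T)).eval z / z ^ 2) F K z := by
    intro z hz
    refine hall z ?_
    by_cases hex : ∃ i, z ∈ ball (ρ₀ i) (4 * δ)
    · exact Or.inr hex
    · left
      push Not at hex
      refine hΩm z hz fun i => ?_
      have := hex i
      rw [mem_ball_iff_norm, not_lt] at this
      linarith
  -- The circle lies in Ω, and there θ = z^g / z is the factor by which η acts on ν.
  have hcircle : ∀ z : ℂ, ‖z‖ = 1 → conj (K z) = K z ∧ conj (F z) = (z ^ g * z⁻¹) * F z := by
    intro z hz
    have hz0 : z ≠ 0 := fun h => by simp [h] at hz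
    have hcz : (conj z)⁻¹ = z := by rw [← Complex.inv_eq_conj hz, inv_inv]
    have hzΩ : z ∈ Ω := hΩm z hz0 fun i => hcirc i z hz
    rw [(hFK z hzΩ).1, (hFK z hzΩ).2]
    obtain ⟨h1, h2⟩ := hfkr z hz (ha0 z hzΩ)
    refine hreal z hzΩ _ (mul_ne_zero (pow_ne_zero g hz0) (inv_ne_zero hz0)) (fun τ hτ => ?_)
      (fun τ hτ => ?_) h1 h2
    · have h3 := ha τ hτ z hz0
      rw [hcz] at h3
      rw [map_mul, map_inv₀, hcz]
      have e : ((z ^ g * z⁻¹) ^ 2)⁻¹ * (z⁻¹ * (z ^ (2 * g) * conj ((aPoly (γ τ)).eval z))) =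
          z * conj ((aPoly (γ τ)).eval z) := by
        field_simp
        ring
      rw [← e, h3]
    · have h3 := hcr τ hτ z hz0
      rw [hcz] at h3
      rw [map_mul, map_inv₀, hcz]
      have e : (z ^ g * z⁻¹)⁻¹ * (z⁻¹ * (z ^ (g + 1) * conj ((poly (c τ)).eval z))) =
          z * conj ((poly (c τ)).eval z) := by
        field_simp
        ring
      rw [← e, h3]
  -- The reflected functions are holomorphic on ℂ*, so the symmetries on the circle extend to ℂ*.
  have hrefl : ∀ G : ℂ → ℂ, (∀ z : ℂ, z ≠ 0 → DifferentiableAt ℂ G z) →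
      ∀ z : ℂ, z ≠ 0 → DifferentiableAt ℂ (fun z => conj (G (conj z)⁻¹)) z := by
    intro G hG z hz
    have hz' : conj z ≠ 0 := by simpa using hz
    have h1 : DifferentiableAt ℂ (fun w => G w⁻¹) (conj z) :=
      DifferentiableAt.comp (conj z) (hG _ (inv_ne_zero hz')) (differentiableAt_inv hz')
    have h2 := h1.conj_conj
    rwa [Complex.conj_conj] at h2
  refine ⟨_, isMonodromyEigenvalue_of_dlogAt hall' (fun z hz => ?_) fun z hz => ?_⟩
  · have := eq_of_eq_on_unit_circle (f := fun z => conj (K (conj z)⁻¹)) (h := K)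
      (fun z hz => (hrefl K (fun z hz => (hall' z hz).dk) z hz).differentiableWithinAt)
      (fun z hz => (hall' z hz).dk.differentiableWithinAt)
      (fun z hz => by
        have hcz : (conj z)⁻¹ = z := by rw [← Complex.inv_eq_conj hz, inv_inv]
        rw [hcz, (hcircle z hz).1]) z hz
    rw [← this, Complex.conj_conj]
  · have := eq_of_eq_on_unit_circle
      (f := fun z => conj (F (conj z)⁻¹) * z ^ (1 - (g : ℤ))) (h := F)
      (fun z hz => ((hrefl F (fun z hz => (hall' z hz).df) z hz).mul
        (differentiableAt_zpow.2 (Or.inl hz))).differentiableWithinAt)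
      (fun z hz => (hall' z hz).df.differentiableWithinAt)
      (fun z hz => by
        have hz0 : z ≠ 0 := fun h => by simp [h] at hz
        have hcz : (conj z)⁻¹ = z := by rw [← Complex.inv_eq_conj hz, inv_inv]
        rw [hcz, (hcircle z hz).2, zpow_sub₀ hz0]
        simp only [zpow_one, zpow_natCast]
        field_simp) z hz
    rw [← this, map_mul, Complex.conj_conj, map_zpow₀]

end Persistence

/-! ### Divided differences as power series in the nilpotent shift -/

section Shift

variable {N : ℕ}

lemma coeff_poly (v : Fin N → ℂ) (k : ℕ) :
    (poly v).coeff k = if h : k < N then v ⟨k, h⟩ else 0 := by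
  simp only [poly, finsetSum_coeff, coeff_C_mul, coeff_X_pow]
  split_ifs with h
  · rw [Finset.sum_eq_single ⟨k, h⟩]
    · simp
    · intro i _ hi
      rw [if_neg fun hk => hi (Fin.ext hk.symm), mul_zero]
    · simp
  · refine Finset.sum_eq_zero fun i _ => ?_
    rw [if_neg (by have := i.2; omega), mul_zero]

lemma poly_add (v w : Fin N → ℂ) : poly (v + w) = poly v + poly w := by
  simp [poly, add_mul, Finset.sum_add_distrib]

lemma poly_smul (a : ℂ) (v : Fin N → ℂ) : poly (a • v) = C a * poly v := by
  simp [poly, Finset.mul_sum, mul_assoc]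

lemma poly_zero : poly (0 : Fin N → ℂ) = 0 := by simp [poly]

lemma poly_neg (v : Fin N → ℂ) : poly (-v) = -poly v := by simp [poly]

lemma poly_sub (v w : Fin N → ℂ) : poly (v - w) = poly v - poly w := by
  rw [sub_eq_add_neg, poly_add, poly_neg, sub_eq_add_neg]

lemma poly_sum {ι : Type*} (s : Finset ι) (v : ι → Fin N → ℂ) :
    poly (∑ i ∈ s, v i) = ∑ i ∈ s, poly (v i) := by
  classical
  induction s using Finset.induction_on with
  | empty => simp [poly_zero]
  | insert i s hi ih => rw [Finset.sum_insert hi, Finset.sum_insert hi, poly_add, ih]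

lemma poly_injective : Function.Injective (poly : (Fin N → ℂ) → ℂ[X]) := by
  intro v w h
  funext i
  have := congrArg (fun p => p.coeff i) h
  simpa [coeff_poly] using this

lemma degree_poly_lt (v : Fin N → ℂ) : (poly v).degree < N := by
  rw [degree_lt_iff_coeff_zero]
  intro k hk
  rw [coeff_poly, dif_neg (by omega)]

lemma poly_coeff_eq {p : ℂ[X]} (hp : p.degree < N) : poly (fun i : Fin N => p.coeff i) = p := by
  ext k
  rw [coeff_poly]
  split_ifs with h
  · rfl
  · exact ((degree_lt_iff_coeff_zero _ _).1 hp k (by omega)).symm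

/-- The backward shift of the coefficients of a polynomial. -/
def shift : Module.End ℂ (Fin N → ℂ) where
  toFun v i := if h : (i : ℕ) + 1 < N then v ⟨i + 1, h⟩ else 0
  map_add' v w := by
    funext i
    simp only [Pi.add_apply]
    split_ifs <;> simp
  map_smul' a v := by
    funext i
    simp only [Pi.smul_apply, RingHom.id_apply]
    split_ifs <;> simp

lemma shift_apply (v : Fin N → ℂ) (i : Fin N) :
    shift v i = if h : (i : ℕ) + 1 < N then v ⟨i + 1, h⟩ else 0 := rfl

lemma shift_pow_apply (k : ℕ) (v : Fin N → ℂ) (i : Fin N) :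
    (shift ^ k) v i = if h : (i : ℕ) + k < N then v ⟨i + k, h⟩ else 0 := by
  induction k generalizing i with
  | zero => simp
  | succ k ih =>
    rw [pow_succ', Module.End.mul_apply, shift_apply]
    by_cases h : (i : ℕ) + 1 < N
    · rw [dif_pos h, ih]
      by_cases h' : (i : ℕ) + (k + 1) < N
      · rw [dif_pos h', dif_pos (by simp only; omega)]
        congr 2
        simp only
        omega
      · rw [dif_neg h', dif_neg (by simp only; omega)]
    · rw [dif_neg h, dif_neg (by omega)]

lemma shift_pow_eq_zero : (shift : Module.End ℂ (Fin N → ℂ)) ^ N = 0 := by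
  refine LinearMap.ext fun v => funext fun i => ?_
  rw [shift_pow_apply, dif_neg (by omega)]
  rfl

/-- The shift is nilpotent of order `N`, so identities between the operators below are congruences
of polynomials modulo X^N. -/
lemma aeval_shift_eq {p q : ℂ[X]} (h : X ^ N ∣ p - q) :
    aeval (shift : Module.End ℂ (Fin N → ℂ)) p = aeval shift q := by
  obtain ⟨u, hu⟩ := h
  rw [← sub_eq_zero, ← map_sub, hu, map_mul, map_pow, aeval_X, shift_pow_eq_zero, zero_mul]

lemma X_mul_poly_shift (v : Fin N → ℂ) : X * poly (shift v) = poly v - C ((poly v).coeff 0) := by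
  ext k
  cases k with
  | zero => simp
  | succ k =>
    rw [coeff_X_mul, coeff_sub, coeff_C_succ, sub_zero, coeff_poly, coeff_poly]
    by_cases h : k + 1 < N
    · rw [dif_pos h, dif_pos (by omega), shift_apply, dif_pos h]
    · rw [dif_neg h]
      split_ifs with h'
      · rw [shift_apply, dif_neg h]
      · rfl

variable (N) in
/-- The symbol of the divided difference operator at `r`. -/
def divSymbol (r : ℂ) : ℂ[X] := ∑ k ∈ Finset.range N, C (r ^ k) * X ^ (k + 1)

variable (N) in
-- A truncated geometric series: the symbol is X / (1 - r X) up to order `N`.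
lemma divSymbol_eq (r : ℂ) :
    divSymbol N r - X - C r * X * divSymbol N r = -(C (r ^ N) * X ^ (N + 1)) := by
  have h : ∀ M : ℕ, divSymbol M r - X - C r * X * divSymbol M r = -(C (r ^ M) * X ^ (M + 1)) := by
    intro M
    induction M with
    | zero => simp [divSymbol]
    | succ M ih =>
      have : divSymbol (M + 1) r = divSymbol M r + C (r ^ M) * X ^ (M + 1) := by
        rw [divSymbol, Finset.sum_range_succ, divSymbol]
      rw [this]
      have h2 : (C (r ^ (M + 1)) : ℂ[X]) = C r * C (r ^ M) := by rw [← C_mul]; congr 1; ring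
      rw [h2]
      linear_combination ih
  exact h N

lemma X_dvd_divSymbol (r : ℂ) : X ∣ divSymbol N r :=
  Finset.dvd_sum fun k _ => Dvd.intro_left (C (r ^ k) * X ^ k) (by ring)

/-- The resolvent identity: X / (1 - r₀ X) = X / (1 - r X) · (1 - (r - r₀) X / (1 - r₀ X)). In
operators, D_r is D_{r₀} (1 - (r - r₀) D_{r₀})⁻¹. -/
lemma X_pow_dvd_divSymbol_sub (r r₀ : ℂ) :
    X ^ N ∣ divSymbol N r₀ - divSymbol N r * (1 - C (r - r₀) * divSymbol N r₀) := by
  have h1 := divSymbol_eq N r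
  have h2 := divSymbol_eq N r₀
  refine ⟨C (r ^ N) * X * (1 + C r₀ * divSymbol N r₀) - C (r₀ ^ N) * X * (1 + C r * divSymbol N r),
    ?_⟩
  rw [C_sub]
  linear_combination (1 + C r * divSymbol N r) * h2 - (1 + C r₀ * divSymbol N r₀) * h1

/-- The divided difference operator `f ↦ (f - f r) / (X - r)` on coefficient vectors. -/
def divDiff (r : ℂ) : Module.End ℂ (Fin N → ℂ) := aeval shift (divSymbol N r)

lemma divDiff_eq (r : ℂ) (v : Fin N → ℂ) : divDiff r v = shift (v + r • divDiff r v) := by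
  have h : aeval (shift : Module.End ℂ (Fin N → ℂ)) (divSymbol N r) =
      aeval shift (X * (1 + C r * divSymbol N r)) := by
    refine aeval_shift_eq ⟨-(C (r ^ N) * X), ?_⟩
    linear_combination divSymbol_eq N r
  conv_lhs => rw [divDiff, h]
  rw [map_mul, map_add, map_one, map_mul, aeval_X, aeval_C, divDiff]
  simp [Module.algebraMap_end_apply]

lemma X_sub_C_mul_poly_divDiff (r : ℂ) (v : Fin N → ℂ) :
    (X - C r) * poly (divDiff r v) = poly v - C ((poly v).eval r) := by
  have h := X_mul_poly_shift (v + r • divDiff r v)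
  rw [← divDiff_eq, poly_add, poly_smul] at h
  have h2 : (X - C r) * poly (divDiff r v) =
      poly v - C ((poly v + C r * poly (divDiff r v)).coeff 0) := by linear_combination h
  have h3 := congrArg (Polynomial.eval r) h2
  simp only [eval_mul, eval_sub, eval_X, eval_C, sub_self, zero_mul] at h3
  rw [h2, ← sub_eq_zero.1 h3.symm]

lemma poly_divDiff_of_eq {r : ℂ} {v : Fin N → ℂ} {H : ℂ[X]} (h : poly v = (X - C r) * H) :
    poly (divDiff r v) = H := by
  have h1 := X_sub_C_mul_poly_divDiff r v
  rw [h] at h1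
  simp only [eval_mul, eval_sub, eval_X, eval_C, sub_self, zero_mul, C_0, sub_zero] at h1
  exact mul_left_cancel₀ (X_sub_C_ne_zero r) h1

lemma poly_divDiff_pow_of_eq {r : ℂ} {v : Fin N → ℂ} {H : ℂ[X]} {d : ℕ}
    (h : poly v = (X - C r) ^ d * H) {k : ℕ} (hk : k ≤ d) :
    poly ((divDiff r ^ k) v) = (X - C r) ^ (d - k) * H := by
  induction k with
  | zero => simpa using h
  | succ k ih =>
    rw [pow_succ', Module.End.mul_apply]
    refine poly_divDiff_of_eq ?_
    rw [ih (by omega), ← mul_assoc, ← pow_succ']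
    congr 2
    omega

/-- Taylor coefficients of `(1 - Y) ^ (1 / 2)`. -/
def sqrtCoeff : ℕ → ℂ
  | 0 => 1
  | k + 1 => sqrtCoeff k * (k - 1 / 2) / (k + 1)

lemma succ_mul_sqrtCoeff_succ (k : ℕ) :
    (k + 1) * sqrtCoeff (k + 1) = sqrtCoeff k * (k - 1 / 2) := by
  rw [sqrtCoeff]
  have : (k + 1 : ℂ) ≠ 0 := Nat.cast_add_one_ne_zero k
  field_simp

lemma sqrtCoeff_ne_zero (k : ℕ) : sqrtCoeff k ≠ 0 := by
  induction k with
  | zero => simp [sqrtCoeff]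
  | succ k ih =>
    rw [sqrtCoeff]
    refine div_ne_zero (mul_ne_zero ih ?_) (Nat.cast_add_one_ne_zero k)
    intro h
    have h2 : ((2 * k : ℕ) : ℂ) = ((1 : ℕ) : ℂ) := by
      push_cast
      linear_combination 2 * h
    have := Nat.cast_injective h2
    omega

lemma conj_sqrtCoeff (k : ℕ) : conj (sqrtCoeff k) = sqrtCoeff k := by
  induction k with
  | zero => simp [sqrtCoeff]
  | succ k ih => simp [sqrtCoeff, ih, Complex.conj_ofNat]

/-- The partial sums are the Taylor coefficients of (1 - Y)^(1/2) / (1 - Y) = (1 - Y)^(-1/2), which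
is -2 times the derivative of (1 - Y)^(1/2). -/
lemma sum_sqrtCoeff (d : ℕ) :
    ∑ k ∈ Finset.range (d + 1), sqrtCoeff k = -2 * ((d + 1) * sqrtCoeff (d + 1)) := by
  induction d with
  | zero => simp [sqrtCoeff]
  | succ d ih =>
    rw [Finset.sum_range_succ, ih]
    have := succ_mul_sqrtCoeff_succ (d + 1)
    push_cast at this ⊢
    linear_combination 2 * this

lemma sum_sqrtCoeff_ne_zero (d : ℕ) : ∑ k ∈ Finset.range (d + 1), sqrtCoeff k ≠ 0 := by
  rw [sum_sqrtCoeff]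
  exact mul_ne_zero (by norm_num) (mul_ne_zero (Nat.cast_add_one_ne_zero d) (sqrtCoeff_ne_zero _))

/-- Taylor polynomial of degree `d` of `(1 - Y) ^ (1 / 2)`. -/
def sqrtPoly (d : ℕ) : ℂ[X] := ∑ k ∈ Finset.range (d + 1), C (sqrtCoeff k) * X ^ k

lemma sqrtPoly_succ (d : ℕ) :
    sqrtPoly (d + 1) = sqrtPoly d + C (sqrtCoeff (d + 1)) * X ^ (d + 1) := by
  rw [sqrtPoly, Finset.sum_range_succ, sqrtPoly]

lemma X_pow_dvd_sqrtPoly_sub {d m : ℕ} (h : d ≤ m) : X ^ (d + 1) ∣ sqrtPoly m - sqrtPoly d := by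
  induction m, h using Nat.le_induction with
  | base => simp
  | succ m hm ih =>
    have : sqrtPoly (m + 1) - sqrtPoly d =
        (sqrtPoly m - sqrtPoly d) + C (sqrtCoeff (m + 1)) * X ^ (m + 1) := by
      rw [sqrtPoly_succ]; ring
    rw [this]
    exact dvd_add ih ((pow_dvd_pow X (by omega)).mul_left _)

lemma map_conj_sqrtPoly (d : ℕ) : (sqrtPoly d).map (starRingEnd ℂ) = sqrtPoly d := by
  simp [sqrtPoly, Polynomial.map_sum, conj_sqrtCoeff]

/-- The equation (1 - Y) p' + p / 2 = 0 of the square root holds for its Taylor polynomial except in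
the top degree, which is invisible to nilpotent operators of that order. -/
lemma derivative_sqrtPoly (d : ℕ) :
    (1 - X) * derivative (sqrtPoly d) + C (1 / 2) * sqrtPoly d =
      C (-(d - 1 / 2) * sqrtCoeff d) * X ^ d := by
  induction d with
  | zero => simp [sqrtPoly, sqrtCoeff]
  | succ d ih =>
    rw [sqrtPoly_succ, derivative_add, derivative_C_mul_X_pow]
    have h := succ_mul_sqrtCoeff_succ d
    have h1 : (C (sqrtCoeff (d + 1) * ((d + 1 : ℕ) : ℂ)) : ℂ[X]) =
        C ((d - 1 / 2) * sqrtCoeff d) := by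
      congr 1; push_cast; linear_combination h
    have h2 : (C (-(((d + 1 : ℕ) : ℂ) - 1 / 2) * sqrtCoeff (d + 1)) : ℂ[X]) =
        -C ((d - 1 / 2) * sqrtCoeff d) + C (1 / 2) * C (sqrtCoeff (d + 1)) := by
      rw [← C_mul, ← C_neg, ← C_add]
      congr 1; push_cast; linear_combination -h
    rw [h1, h2, Nat.add_sub_cancel, neg_mul, C_neg] at *
    linear_combination ih

lemma exists_inverse_sqrtPoly (N d : ℕ) : ∃ R : ℂ[X], X ^ N ∣ sqrtPoly d * R - 1 := by
  have h1 : IsCoprime (sqrtPoly d) X := by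
    obtain ⟨u, hu⟩ := X_pow_dvd_sqrtPoly_sub (Nat.zero_le d)
    refine ⟨1, -u, ?_⟩
    have h0 : sqrtPoly 0 = 1 := by simp [sqrtPoly, sqrtCoeff]
    rw [h0] at hu
    linear_combination hu
  obtain ⟨a, b, hab⟩ := h1.pow_right (n := N)
  exact ⟨a, -b, by linear_combination hab⟩

end Shift

/-! ### The desingularising operator ∏ (1 - x_i D_i)^(1/2) -/

section Twist

lemma aeval_smul_apply {V : Type*} [AddCommGroup V] [Module ℂ V] (M : Module.End ℂ V) (p : ℂ[X])
    (x : ℂ) (w : V) :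
    aeval (x • M) p w =
      ∑ k ∈ Finset.range (p.natDegree + 1), (p.coeff k * x ^ k) • (M ^ k) w := by
  rw [aeval_eq_sum_range, LinearMap.sum_apply]
  refine Finset.sum_congr rfl fun k _ => ?_
  rw [_root_.smul_pow, LinearMap.smul_apply, LinearMap.smul_apply, smul_smul]

variable {V : Type*} [NormedAddCommGroup V] [NormedSpace ℂ V] [FiniteDimensional ℂ V]

lemma exists_norm_apply_le (M : Module.End ℂ V) : ∃ C, 0 ≤ C ∧ ∀ w, ‖M w‖ ≤ C * ‖w‖ :=
  ⟨_, norm_nonneg _, (LinearMap.toContinuousLinearMap M).le_opNorm⟩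

lemma exists_norm_aeval_smul_apply_le (M : Module.End ℂ V) {p : ℂ[X]} {m : ℕ} (h : X ^ m ∣ p) :
    ∃ C, 0 ≤ C ∧ ∀ x : ℂ, ‖x‖ ≤ 1 → ∀ w, ‖aeval (x • M) p w‖ ≤ C * ‖x‖ ^ m * ‖w‖ := by
  choose B hB0 hB using fun k => exists_norm_apply_le (M ^ k)
  refine ⟨∑ k ∈ Finset.range (p.natDegree + 1), ‖p.coeff k‖ * B k,
    Finset.sum_nonneg fun k _ => mul_nonneg (norm_nonneg _) (hB0 k), fun x hx w => ?_⟩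
  rw [aeval_smul_apply, Finset.sum_mul, Finset.sum_mul]
  refine norm_sum_le_of_le _ fun k _ => ?_
  rw [norm_smul, norm_mul, norm_pow]
  by_cases hk : k < m
  · rw [X_pow_dvd_iff.1 h k hk]
    simp
  · calc ‖p.coeff k‖ * ‖x‖ ^ k * ‖(M ^ k) w‖ ≤ ‖p.coeff k‖ * ‖x‖ ^ m * (B k * ‖w‖) := by
          refine mul_le_mul (mul_le_mul_of_nonneg_left ?_ (norm_nonneg _)) (hB k w)
            (norm_nonneg _) (by positivity)
          exact pow_le_pow_of_le_one (norm_nonneg _) hx (by omega)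
      _ = _ := by ring

lemma contDiffOn_aeval_smul_apply {E : Type*} [NormedAddCommGroup E] [NormedSpace ℝ E] {O : Set E}
    (M : Module.End ℂ V) (p : ℂ[X]) {x : E → ℂ} {w : E → V} (hx : ContDiffOn ℝ ∞ x O)
    (hw : ContDiffOn ℝ ∞ w O) : ContDiffOn ℝ ∞ (fun z => aeval (x z • M) p (w z)) O := by
  simp only [aeval_smul_apply]
  refine ContDiffOn.sum fun k _ => ContDiffOn.smul (contDiffOn_const.mul (hx.pow k)) ?_
  exact ((LinearMap.toContinuousLinearMap (M ^ k)).restrictScalars ℝ).contDiff.comp_contDiffOn hw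

lemma hasDerivAt_aeval_smul_apply (M : Module.End ℂ V) (p : ℂ[X]) {x : ℝ → ℂ} {x' : ℂ}
    {w : ℝ → V} {w' : V} {t : ℝ} (hx : HasDerivAt x x' t) (hw : HasDerivAt w w' t) :
    HasDerivAt (fun s => aeval (x s • M) p (w s))
      (x' • (M * aeval (x t • M) (derivative p)) (w t) + aeval (x t • M) p w') t := by
  induction p using Polynomial.induction_on' with
  | add p q hp hq =>
    refine ((hp.add hq).congr_deriv ?_).congr_of_eventuallyEq (Filter.Eventually.of_forall ?_)
    · simp only [map_add, mul_add, LinearMap.add_apply, smul_add]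
      abel
    · intro s
      simp
  | monomial k a =>
    have h1 : HasDerivAt (fun s => (M ^ k) (w s)) ((M ^ k) w') t :=
      ((LinearMap.toContinuousLinearMap (M ^ k)).restrictScalars ℝ).hasFDerivAt.comp_hasDerivAt t hw
    have h2 := ((hx.pow k).const_mul a).smul h1
    refine (h2.congr_deriv ?_).congr_of_eventuallyEq (Filter.Eventually.of_forall ?_)
    · simp only [derivative_monomial, aeval_monomial, Module.algebraMap_end_eq_smul_id]
      cases k with
      | zero => simp
      | succ k =>
        simp only [_root_.smul_pow, Module.End.mul_apply, LinearMap.smul_apply, LinearMap.id_apply,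
          map_smul, Nat.add_sub_cancel, smul_smul, pow_succ' M k, Pi.pow_apply]
        rw [add_comm]
        congr 1
        all_goals
          congr 1
          ring
    · intro s
      simp [aeval_monomial, _root_.smul_pow, Module.algebraMap_end_eq_smul_id, smul_smul, mul_comm a]

variable {N : ℕ} {R : Type*}

/-- The product over `i ∈ s` of the operators `p i (x i • divDiff (r i))`. -/
def rootTwist (p : R → ℂ[X]) (r : R → ℂ) (s : Finset R) (x : R → ℂ) :
    Module.End ℂ (Fin N → ℂ) :=
  aeval shift (∏ i ∈ s, (p i).comp (C (x i) * divSymbol N (r i)))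

lemma aeval_shift_comp (p : ℂ[X]) (x r : ℂ) :
    aeval shift (p.comp (C x * divSymbol N r)) =
      aeval (x • (divDiff r : Module.End ℂ (Fin N → ℂ))) p := by
  rw [aeval_comp, map_mul, aeval_C, divDiff, Algebra.smul_def]

variable {p : R → ℂ[X]} {r x : R → ℂ} {s : Finset R}

lemma rootTwist_empty : (rootTwist p r ∅ x : Module.End ℂ (Fin N → ℂ)) = 1 := by
  simp [rootTwist]

lemma aeval_shift_comm (p q : ℂ[X]) (v : Fin N → ℂ) :
    aeval shift p (aeval shift q v) = aeval shift q (aeval shift p v) := by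
  rw [← Module.End.mul_apply, ← map_mul, mul_comm, map_mul, Module.End.mul_apply]

lemma rootTwist_zero (hp : ∀ i ∈ s, (p i).coeff 0 = 1) (hx : ∀ i ∈ s, x i = 0) :
    (rootTwist p r s x : Module.End ℂ (Fin N → ℂ)) = 1 := by
  rw [rootTwist, Finset.prod_eq_one, map_one]
  intro i hi
  rw [hx i hi, C_0, zero_mul, comp_zero, ← coeff_zero_eq_eval_zero, hp i hi, C_1]

lemma aeval_shift_conj (p : ℂ[X]) (v : Fin N → ℂ) :
    aeval shift p (fun i => conj (v i)) =
      fun i => conj (aeval shift (p.map (starRingEnd ℂ)) v i) := by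
  induction p using Polynomial.induction_on' with
  | add p q hp hq =>
    funext i
    simp [hp, hq]
  | monomial k a =>
    funext i
    simp only [aeval_monomial, Polynomial.map_monomial, Module.algebraMap_end_eq_smul_id,
      Module.End.mul_apply, LinearMap.smul_apply, LinearMap.id_apply, Pi.smul_apply,
      shift_pow_apply, smul_eq_mul, map_mul, Complex.conj_conj]
    split_ifs <;> simp

lemma map_conj_divSymbol (r : ℂ) :
    (divSymbol N r).map (starRingEnd ℂ) = divSymbol N (conj r) := by
  simp [divSymbol, Polynomial.map_sum]

/-- Conjugation merely permutes the factors. Hence the twist maps real vectors to real vectors. -/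
lemma rootTwist_conj [Fintype R] (σ : Equiv.Perm R) {P : ℂ[X]} (hP : P.map (starRingEnd ℂ) = P)
    (hr : ∀ i, r (σ i) = conj (r i)) (hx : ∀ i, x (σ i) = conj (x i)) (v : Fin N → ℂ) :
    rootTwist (fun _ => P) r Finset.univ x (fun i => conj (v i)) =
      fun i => conj (rootTwist (fun _ => P) r Finset.univ x v i) := by
  rw [rootTwist, aeval_shift_conj]
  have : (∏ i, P.comp (C (x i) * divSymbol N (r i))).map (starRingEnd ℂ) =
      ∏ i, P.comp (C (x i) * divSymbol N (r i)) := by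
    rw [Polynomial.map_prod, ← Equiv.prod_comp σ]
    refine Finset.prod_congr rfl fun i _ => ?_
    rw [Polynomial.map_comp, hP, Polynomial.map_mul, map_C, map_conj_divSymbol, hr, hx,
      Complex.conj_conj, Complex.conj_conj]
  rw [this]

variable [DecidableEq R]

lemma rootTwist_insert {i : R} (hi : i ∉ s) :
    (rootTwist p r (insert i s) x : Module.End ℂ (Fin N → ℂ)) =
      aeval (x i • divDiff (r i)) (p i) * rootTwist p r s x := by
  rw [rootTwist, Finset.prod_insert hi, map_mul, aeval_shift_comp, rootTwist]

lemma contDiffOn_rootTwist {E : Type*} [NormedAddCommGroup E] [NormedSpace ℝ E] {O : Set E}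
    {x : E → R → ℂ} {w : E → Fin N → ℂ} (hx : ∀ i ∈ s, ContDiffOn ℝ ∞ (fun z => x z i) O)
    (hw : ContDiffOn ℝ ∞ w O) : ContDiffOn ℝ ∞ (fun z => rootTwist p r s (x z) (w z)) O := by
  induction s using Finset.induction_on with
  | empty => simpa [rootTwist_empty] using hw
  | insert i s hi ih =>
    simp only [rootTwist_insert hi, Module.End.mul_apply]
    exact contDiffOn_aeval_smul_apply _ _ (hx i (Finset.mem_insert_self i s))
      (ih fun j hj => hx j (Finset.mem_insert_of_mem hj))

/-- Every symbol substituted is divisible by X, so inverses modulo X^N stay inverse after the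
substitution. -/
lemma rootTwist_mul_eq_one {q : R → ℂ[X]} (h : ∀ i ∈ s, X ^ N ∣ p i * q i - 1) :
    (rootTwist p r s x * rootTwist q r s x : Module.End ℂ (Fin N → ℂ)) = 1 := by
  have h1 : ∀ i ∈ s, aeval (shift : Module.End ℂ (Fin N → ℂ))
      ((p i).comp (C (x i) * divSymbol N (r i)) * (q i).comp (C (x i) * divSymbol N (r i))) = 1 := by
    intro i hi
    rw [← map_one (aeval (R := ℂ) shift)]
    refine aeval_shift_eq ?_
    obtain ⟨u, hu⟩ := h i hi
    have h2 := congrArg (fun f => f.comp (C (x i) * divSymbol N (r i))) hu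
    simp only [sub_comp, mul_comp, one_comp, pow_comp, X_comp] at h2
    rw [h2]
    exact (pow_dvd_pow_of_dvd ((X_dvd_divSymbol (r i)).mul_left _) N).mul_right _
  rw [rootTwist, rootTwist, ← map_mul, ← Finset.prod_mul_distrib]
  clear h
  induction s using Finset.induction_on with
  | empty => simp
  | insert i s hi ih =>
    rw [Finset.prod_insert hi, map_mul, h1 i (Finset.mem_insert_self i s),
      ih fun j hj => h1 j (Finset.mem_insert_of_mem hj), mul_one]

lemma exists_norm_rootTwist_le (p : R → ℂ[X]) (r : R → ℂ) (s : Finset R) :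
    ∃ C, 0 ≤ C ∧ ∀ x : R → ℂ, (∀ i, ‖x i‖ ≤ 1) → ∀ w : Fin N → ℂ,
      ‖rootTwist p r s x w‖ ≤ C * ‖w‖ := by
  induction s using Finset.induction_on with
  | empty => exact ⟨1, zero_le_one, fun x _ w => by simp [rootTwist_empty]⟩
  | insert i s hi ih =>
    obtain ⟨B, hB0, hB⟩ := ih
    obtain ⟨B', hB0', hB'⟩ := exists_norm_aeval_smul_apply_le
      (divDiff (r i) : Module.End ℂ (Fin N → ℂ)) (p := p i) (m := 0) (by simp)
    refine ⟨B' * B, mul_nonneg hB0' hB0, fun x hx w => ?_⟩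
    rw [rootTwist_insert hi, Module.End.mul_apply]
    refine (hB' _ (hx i) _).trans ?_
    rw [pow_zero, mul_one, mul_assoc]
    exact mul_le_mul_of_nonneg_left (hB x hx w) hB0'

/-- The factors are exchanged one at a time, each at the cost of ‖x i‖^(d i + 1). It serves to
replace the full square root by its truncation of degree d i. -/
lemma exists_norm_rootTwist_sub_le {p q : R → ℂ[X]} {d : R → ℕ} (r : R → ℂ) (s : Finset R)
    (h : ∀ i ∈ s, X ^ (d i + 1) ∣ p i - q i) :
    ∃ C, 0 ≤ C ∧ ∀ x : R → ℂ, (∀ i, ‖x i‖ ≤ 1) → ∀ w : Fin N → ℂ,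
      ‖rootTwist p r s x w - rootTwist q r s x w‖ ≤ C * (∑ i ∈ s, ‖x i‖ ^ (d i + 1)) * ‖w‖ := by
  induction s using Finset.induction_on with
  | empty => exact ⟨1, zero_le_one, fun x _ w => by simp [rootTwist_empty]⟩
  | insert i s hi ih =>
    obtain ⟨B, hB0, hB⟩ := ih fun j hj => h j (Finset.mem_insert_of_mem hj)
    obtain ⟨B₁, hB₁0, hB₁⟩ := exists_norm_aeval_smul_apply_le
      (divDiff (r i) : Module.End ℂ (Fin N → ℂ)) (p := p i) (m := 0) (by simp)
    obtain ⟨B₂, hB₂0, hB₂⟩ := exists_norm_aeval_smul_apply_le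
      (divDiff (r i) : Module.End ℂ (Fin N → ℂ)) (h i (Finset.mem_insert_self i s))
    obtain ⟨B₃, hB₃0, hB₃⟩ := exists_norm_rootTwist_le (N := N) q r s
    refine ⟨B₁ * B + B₂ * B₃, by positivity, fun x hx w => ?_⟩
    rw [rootTwist_insert hi, rootTwist_insert hi, Module.End.mul_apply, Module.End.mul_apply,
      Finset.sum_insert hi]
    set M : Module.End ℂ (Fin N → ℂ) := x i • divDiff (r i)
    have e : aeval M (p i) (rootTwist p r s x w) - aeval M (q i) (rootTwist q r s x w) =
        aeval M (p i) (rootTwist p r s x w - rootTwist q r s x w) +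
          aeval M (p i - q i) (rootTwist q r s x w) := by
      rw [map_sub, map_sub, LinearMap.sub_apply]
      abel
    rw [e]
    have h1 := hB₁ _ (hx i) (rootTwist p r s x w - rootTwist q r s x w)
    have h2 := hB₂ _ (hx i) (rootTwist q r s x w)
    rw [pow_zero, mul_one] at h1
    have h3 := mul_le_mul_of_nonneg_left (hB x hx w) hB₁0
    have h4 := mul_le_mul_of_nonneg_left (hB₃ x hx w)
      (mul_nonneg hB₂0 (pow_nonneg (norm_nonneg (x i)) (d i + 1)))
    have hs : 0 ≤ ∑ j ∈ s, ‖x j‖ ^ (d j + 1) := Finset.sum_nonneg fun j _ => by positivity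
    refine (norm_add_le _ _).trans ((add_le_add (h1.trans h3) (h2.trans h4)).trans ?_)
    have h5 : 0 ≤ B₁ * B * ‖x i‖ ^ (d i + 1) * ‖w‖ := by positivity
    have h6 : 0 ≤ B₂ * B₃ * (∑ j ∈ s, ‖x j‖ ^ (d j + 1)) * ‖w‖ := by positivity
    nlinarith

/-- The result of applying the truncated twist to `(X - r) ^ d`. -/
def truncFactor (d : ℕ) (r x : ℂ) : ℂ[X] :=
  ∑ k ∈ Finset.range (d + 1), C (sqrtCoeff k * x ^ k) * (X - C r) ^ (d - k)

/-- Up to k = d no value at the root is subtracted: D_r^k just lowers the exponent of (X - r)^d by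
k. This is why the series is cut off at the multiplicity. -/
lemma poly_rootTwist_sqrtPoly {d : R → ℕ} {v : Fin N → ℂ} {H : ℂ[X]}
    (h : poly v = (∏ i ∈ s, (X - C (r i)) ^ d i) * H) :
    poly (rootTwist (fun i => sqrtPoly (d i)) r s x v) =
      (∏ i ∈ s, truncFactor (d i) (r i) (x i)) * H := by
  induction s using Finset.induction_on generalizing H with
  | empty => simpa [rootTwist_empty] using h
  | insert i s hi ih =>
    have h1 := ih (H := (X - C (r i)) ^ d i * H) (by rw [h, Finset.prod_insert hi]; ring)
    rw [rootTwist_insert hi, Module.End.mul_apply, Finset.prod_insert hi, sqrtPoly, map_sum,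
      LinearMap.sum_apply, poly_sum, truncFactor, mul_assoc, Finset.sum_mul]
    refine Finset.sum_congr rfl fun k hk => ?_
    rw [Finset.mem_range] at hk
    have h2 := poly_divDiff_pow_of_eq (H := (∏ j ∈ s, truncFactor (d j) (r j) (x j)) * H)
      (h1.trans (by ring)) (k := k) (by omega)
    rw [map_mul, aeval_C, map_pow, aeval_X, _root_.smul_pow, Module.algebraMap_end_eq_smul_id,
      Module.End.mul_apply, LinearMap.smul_apply, LinearMap.smul_apply, LinearMap.id_apply,
      smul_smul, poly_smul, h2]
    ring

/-- At r + x each term x^k (X - r)^(d - k) equals x^d, so only a partial sum of the Taylor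
coefficients is left. Its nonvanishing yields the leading coefficient κ. -/
lemma eval_truncFactor_self (d : ℕ) (r x : ℂ) :
    (truncFactor d r x).eval (r + x) =
      x ^ d * ∑ k ∈ Finset.range (d + 1), sqrtCoeff k := by
  rw [truncFactor, eval_finsetSum, Finset.mul_sum]
  refine Finset.sum_congr rfl fun k hk => ?_
  rw [Finset.mem_range] at hk
  simp only [eval_mul, eval_C, eval_pow, eval_sub, eval_X, add_sub_cancel_left]
  rw [mul_assoc, ← pow_add, Nat.add_sub_cancel' (by omega), mul_comm]

lemma truncFactor_zero (d : ℕ) (r : ℂ) : truncFactor d r 0 = (X - C r) ^ d := by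
  rw [truncFactor, Finset.sum_range_succ', Finset.sum_eq_zero]
  · simp [sqrtCoeff]
  · simp

lemma continuous_eval_truncFactor (d : ℕ) (r : ℂ) :
    Continuous fun p : ℂ × ℂ => (truncFactor d r p.1).eval p.2 := by
  simp only [truncFactor, eval_finsetSum, eval_mul, eval_C, eval_pow, eval_sub, eval_X]
  fun_prop

/-- With u = x D_r, the derivative of (1 - u)^(1/2) is -(1/2)(1 - u)⁻¹ (1 - u)^(1/2), and D_r (1 -
u)⁻¹ = D_{r + x} by the resolvent identity. -/
lemma divDiff_mul_aeval_derivative_sqrtPoly (r x : ℂ) :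
    divDiff r * aeval (x • (divDiff r : Module.End ℂ (Fin N → ℂ))) (derivative (sqrtPoly N)) =
      (-1 / 2 : ℂ) • (divDiff (r + x) * aeval (x • divDiff r) (sqrtPoly N)) := by
  rw [← aeval_shift_comp, ← aeval_shift_comp, divDiff, divDiff, ← map_mul, ← map_mul, ← map_smul]
  refine aeval_shift_eq ?_
  set u : ℂ[X] := C x * divSymbol N r with hu
  have h1 := X_pow_dvd_divSymbol_sub (N := N) (r + x) r
  rw [add_sub_cancel_left, ← hu] at h1
  have h2 := congrArg (fun p => p.comp u) (derivative_sqrtPoly N)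
  simp only [add_comp, mul_comp, sub_comp, one_comp, X_comp, C_comp, pow_comp] at h2
  have h3 : X ^ N ∣ u ^ N := pow_dvd_pow_of_dvd ((X_dvd_divSymbol r).mul_left _) N
  have e : divSymbol N r * (derivative (sqrtPoly N)).comp u -
      (-1 / 2 : ℂ) • (divSymbol N (r + x) * (sqrtPoly N).comp u) =
      (divSymbol N r - divSymbol N (r + x) * (1 - u)) * (derivative (sqrtPoly N)).comp u +
        divSymbol N (r + x) * (C (-(N - 1 / 2) * sqrtCoeff N) * u ^ N) := by
    rw [← h2, smul_eq_C_mul, show (-1 / 2 : ℂ) = -(1 / 2) by ring, C_neg]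
    ring
  rw [e]
  exact dvd_add (h1.mul_right _) ((h3.mul_left _).mul_left _)

/-- The purpose of the twist: moving the roots contributes exactly the singular term -(1/2) Σ x_i'
D_{r_i + x_i} F of the Whitham field, with the divided difference at the moved root. All factors
commute, being polynomials in the shift. -/
lemma hasDerivAt_rootTwist {x : ℝ → R → ℂ} {x' : R → ℂ} {w : ℝ → Fin N → ℂ} {w' : Fin N → ℂ}
    {t : ℝ} (hx : ∀ i ∈ s, HasDerivAt (fun τ => x τ i) (x' i) t) (hw : HasDerivAt w w' t) :
    HasDerivAt (fun τ => rootTwist (fun _ => sqrtPoly N) r s (x τ) (w τ))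
      (rootTwist (fun _ => sqrtPoly N) r s (x t) w' - (1 / 2 : ℂ) • ∑ i ∈ s, x' i •
        divDiff (r i + x t i) (rootTwist (fun _ => sqrtPoly N) r s (x t) (w t))) t := by
  induction s using Finset.induction_on with
  | empty => simpa [rootTwist_empty] using hw
  | insert i s hi ih =>
    have ih := ih fun j hj => hx j (Finset.mem_insert_of_mem hj)
    simp only [rootTwist_insert hi, Module.End.mul_apply]
    refine (hasDerivAt_aeval_smul_apply _ _ (hx i (Finset.mem_insert_self i s)) ih).congr_deriv ?_
    rw [divDiff_mul_aeval_derivative_sqrtPoly, map_sub, map_smul, map_sum, Finset.sum_insert hi]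
    have h : ∀ j, aeval (x t i • (divDiff (r i) : Module.End ℂ (Fin N → ℂ))) (sqrtPoly N)
        (x' j • divDiff (r j + x t j) (rootTwist (fun _ => sqrtPoly N) r s (x t) (w t))) =
        x' j • divDiff (r j + x t j) (aeval (x t i • (divDiff (r i) : Module.End ℂ (Fin N → ℂ)))
          (sqrtPoly N) (rootTwist (fun _ => sqrtPoly N) r s (x t) (w t))) := by
      intro j
      rw [map_smul, ← aeval_shift_comp, divDiff, aeval_shift_comm]
    simp only [h, LinearMap.smul_apply, Module.End.mul_apply]
    module

end Twist

/-! ### Real coordinates for spectral data -/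

section Moebius

open Complex

/-- The Möbius transformation from the unit circle to the real line. -/
def moebius (z : ℂ) : ℂ := I * (z - 1) / (z + 1)

/-- The inverse of `moebius`. -/
def moebiusInv (r : ℂ) : ℂ := (I + r) / (I - r)

lemma moebiusInv_add_one {r : ℂ} (hr : I - r ≠ 0) : moebiusInv r + 1 = 2 * I / (I - r) := by
  rw [moebiusInv]; field_simp; ring

lemma moebiusInv_add_one_ne_zero {r : ℂ} (hr : I - r ≠ 0) : moebiusInv r + 1 ≠ 0 := by
  rw [moebiusInv_add_one hr]
  exact div_ne_zero (mul_ne_zero two_ne_zero I_ne_zero) hr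

lemma moebius_moebiusInv {r : ℂ} (hr : I - r ≠ 0) : moebius (moebiusInv r) = r := by
  rw [moebius, div_eq_iff (moebiusInv_add_one_ne_zero hr), moebiusInv]
  field_simp
  ring

lemma I_sub_moebius {z : ℂ} (hz : z + 1 ≠ 0) : I - moebius z = 2 * I / (z + 1) := by
  rw [moebius]; field_simp; ring

lemma I_sub_moebius_ne_zero {z : ℂ} (hz : z + 1 ≠ 0) : I - moebius z ≠ 0 := by
  rw [I_sub_moebius hz]
  exact div_ne_zero (mul_ne_zero two_ne_zero I_ne_zero) hz

lemma moebiusInv_moebius {z : ℂ} (hz : z + 1 ≠ 0) : moebiusInv (moebius z) = z := by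
  rw [moebiusInv, div_eq_iff (I_sub_moebius_ne_zero hz), moebius]
  field_simp
  ring

/-- The linear polynomial `(λ + 1) (moebius λ - r)`. -/
def ell (r : ℂ) : ℂ[X] := C (I - r) * X - C (I + r)

lemma eval_ell (r z : ℂ) : (ell r).eval z = (I - r) * z - (I + r) := by simp [ell]

lemma eval_ell_eq_moebius (r : ℂ) {z : ℂ} (hz : z + 1 ≠ 0) :
    (ell r).eval z = (z + 1) * (moebius z - r) := by
  rw [eval_ell, moebius]; field_simp; ring

lemma eval_ell_eq_moebiusInv {r : ℂ} (hr : I - r ≠ 0) (z : ℂ) :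
    (ell r).eval z = (I - r) * (z - moebiusInv r) := by
  rw [eval_ell, moebiusInv]; field_simp

lemma mul_conj_eval_ell (r : ℂ) {z : ℂ} (hz : z ≠ 0) :
    z * conj ((ell r).eval (conj z)⁻¹) = (ell (conj r)).eval z := by
  simp only [eval_ell, map_sub, map_mul, map_add, conj_I, map_inv₀, conj_conj]
  field_simp
  ring

variable {g : ℕ}

/-- The family of all roots `r j` and their conjugates. -/
def pairRoot (r : Fin g → ℂ) (i : Fin g × Bool) : ℂ := if i.2 then conj (r i.1) else r i.1

/-- Complex conjugation on the index set of `pairRoot`. -/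
def pairSwap (g : ℕ) : Equiv.Perm (Fin g × Bool) := Equiv.prodCongr (Equiv.refl _) Equiv.boolNot

lemma pairRoot_swap (r : Fin g → ℂ) (i : Fin g × Bool) :
    pairRoot r (pairSwap g i) = conj (pairRoot r i) := by
  obtain ⟨j, b⟩ := i
  cases b <;> simp [pairRoot, pairSwap]

lemma prod_pairRoot {M : Type*} [CommMonoid M] (f : ℂ → M) (r : Fin g → ℂ) :
    ∏ i, f (pairRoot r i) = ∏ j, f (r j) * f (conj (r j)) := by
  rw [Fintype.prod_prod_type]
  refine Finset.prod_congr rfl fun j _ => ?_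
  rw [Fintype.prod_bool, mul_comm]
  simp [pairRoot]

/-- The normalising factor of the polynomial `a`. -/
def rootScale (r : Fin g → ℂ) : ℝ := (√(16 * ∏ j, ‖1 + r j ^ 2‖))⁻¹

/-- The polynomial `a` whose roots have the images `r j`, `conj (r j)` under `moebius`. -/
def aOfRoots (r : Fin g → ℂ) : ℂ[X] := C (-(rootScale r : ℂ) ^ 2) * ∏ i, ell (pairRoot r i)

/-- The homogenisation of a polynomial in `moebius λ`, as a polynomial in `λ`. -/
def homog (v : Fin (g + 2) → ℂ) : ℂ[X] :=
  ∑ k, C (v k) * ((C I * (X - 1)) ^ (k : ℕ) * (X + 1) ^ (g + 1 - (k : ℕ)))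

lemma eval_homog (v : Fin (g + 2) → ℂ) (z : ℂ) :
    (homog v).eval z = ∑ k, v k * ((I * (z - 1)) ^ (k : ℕ) * (z + 1) ^ (g + 1 - (k : ℕ))) := by
  simp [homog, eval_finsetSum]

lemma eval_homog_eq_moebius (v : Fin (g + 2) → ℂ) {z : ℂ} (hz : z + 1 ≠ 0) :
    (homog v).eval z = (z + 1) ^ (g + 1) * (poly v).eval (moebius z) := by
  rw [eval_homog, eval_poly, Finset.mul_sum]
  refine Finset.sum_congr rfl fun k _ => ?_
  have hk : (k : ℕ) + (g + 1 - k) = g + 1 := by omega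
  rw [moebius, div_pow, ← hk, pow_add, Nat.add_sub_cancel_left]
  field_simp

lemma degree_homog_lt (v : Fin (g + 2) → ℂ) : (homog v).degree < ((g + 2 : ℕ) : WithBot ℕ) := by
  rw [homog, Polynomial.degree_lt_iff_coeff_zero]
  intro m hm
  rw [finsetSum_coeff]
  refine Finset.sum_eq_zero fun k _ => ?_
  rw [coeff_C_mul, coeff_eq_zero_of_natDegree_lt, mul_zero]
  have h1 : ((C I * (X - 1) : ℂ[X]) ^ (k : ℕ)).natDegree ≤ k := by
    refine natDegree_pow_le_of_le k ?_ |>.trans (by rw [mul_one])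
    refine (natDegree_C_mul_le _ _).trans ?_
    rw [← C_1, natDegree_X_sub_C]
  have h2 : ((X + 1 : ℂ[X]) ^ (g + 1 - (k : ℕ))).natDegree ≤ g + 1 - k := by
    refine natDegree_pow_le_of_le _ ?_ |>.trans (by rw [mul_one])
    rw [← C_1, natDegree_X_add_C]
  have := natDegree_mul_le_of_le h1 h2
  omega

lemma eq_of_eval_eq_of_ne {p q : ℂ[X]} (s : Finset ℂ) (h : ∀ z ∉ s, p.eval z = q.eval z) :
    p = q := by
  refine Polynomial.eq_of_infinite_eval_eq p q ?_
  exact (Set.Infinite.sdiff Set.infinite_univ s.finite_toSet).mono fun z hz => h z fun hs => hz.2 hs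

lemma homog_injective : Function.Injective (homog : (Fin (g + 2) → ℂ) → ℂ[X]) := by
  intro v w h
  refine poly_injective (eq_of_eval_eq_of_ne {I} fun r hr => ?_)
  have hr : I - r ≠ 0 := fun h => hr (by simp [sub_eq_zero.1 h])
  have h1 := moebiusInv_add_one_ne_zero hr
  have h2 := congrArg (Polynomial.eval (moebiusInv r)) h
  rw [eval_homog_eq_moebius _ h1, eval_homog_eq_moebius _ h1, moebius_moebiusInv hr] at h2
  exact mul_left_cancel₀ (pow_ne_zero _ h1) h2

variable (g) in
/-- The change of coordinates induced by `moebius` on coefficient vectors. -/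
def homogEquiv : (Fin (g + 2) → ℂ) ≃ₗ[ℂ] (Fin (g + 2) → ℂ) :=
  LinearEquiv.ofInjectiveEndo
    { toFun := fun v i => (homog v).coeff i
      map_add' := fun v w => by
        funext i
        simp [homog, add_mul, Finset.sum_add_distrib]
      map_smul' := fun a v => by
        funext i
        simp [homog, Finset.mul_sum, mul_assoc] }
    (fun v w h => homog_injective (by
      rw [← poly_coeff_eq (degree_homog_lt v), ← poly_coeff_eq (degree_homog_lt w)]
      exact congrArg poly h))

lemma poly_homogEquiv (v : Fin (g + 2) → ℂ) : poly (homogEquiv g v) = homog v :=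
  poly_coeff_eq (degree_homog_lt v)

/-- The reflection z ↦ 1 / conj z is complex conjugation in the Möbius coordinate, so the reality
condition means real coefficients. -/
lemma pow_mul_conj_eval_homog (v : Fin (g + 2) → ℂ) {z : ℂ} (hz : z ≠ 0) :
    z ^ (g + 1) * conj ((homog v).eval (conj z)⁻¹) = (homog fun i => conj (v i)).eval z := by
  rw [eval_homog, eval_homog, map_sum, Finset.mul_sum]
  refine Finset.sum_congr rfl fun k _ => ?_
  have hk : (k : ℕ) + (g + 1 - k) = g + 1 := by omega
  simp only [map_mul, map_pow, map_sub, map_add, map_one, conj_I, map_inv₀, conj_conj]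
  rw [← hk, pow_add, Nat.add_sub_cancel_left]
  have h1 : I * (z - 1) = z * (-I * (z⁻¹ - 1)) := by field_simp; ring
  have h2 : z + 1 = z * (z⁻¹ + 1) := by field_simp; ring
  rw [h1, h2, mul_pow z, mul_pow z]
  ring

/-- The real part of a vector of coefficients. -/
def realPart {N : ℕ} (v : Fin N → ℂ) : Fin N → ℂ := fun i => ((v i).re : ℂ)

lemma realPart_of_conj {N : ℕ} {v : Fin N → ℂ} (h : (fun i => conj (v i)) = v) :
    realPart v = v := by
  funext i
  exact Complex.conj_eq_iff_re.1 (congrFun h i)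

lemma conj_realPart {N : ℕ} (v : Fin N → ℂ) : (fun i => conj (realPart v i)) = realPart v := by
  funext i
  simp [realPart]

lemma isRealC_homogEquiv {v : Fin (g + 2) → ℂ} (h : (fun i => conj (v i)) = v) :
    IsRealC g (homogEquiv g v) := by
  intro z hz
  rw [poly_homogEquiv, pow_mul_conj_eval_homog v hz, h]

lemma IsRealC.conj_homogEquiv_symm {c : Fin (g + 2) → ℂ} (hc : IsRealC g c) :
    (fun i => conj ((homogEquiv g).symm c i)) = (homogEquiv g).symm c := by
  refine homog_injective (eq_of_eval_eq_of_ne {0} fun z hz => ?_)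
  have hz : z ≠ 0 := by simpa using hz
  rw [← pow_mul_conj_eval_homog _ hz, ← poly_homogEquiv, LinearEquiv.apply_symm_apply, hc z hz]

lemma eval_aOfRoots (r : Fin g → ℂ) (z : ℂ) :
    (aOfRoots r).eval z = -(rootScale r : ℂ) ^ 2 * ∏ i, (ell (pairRoot r i)).eval z := by
  rw [aOfRoots, eval_mul, eval_C, eval_prod]

lemma eval_aOfRoots_eq_moebius (r : Fin g → ℂ) {z : ℂ} (hz : z + 1 ≠ 0) :
    (aOfRoots r).eval z =
      -(rootScale r : ℂ) ^ 2 * ((z + 1) ^ (2 * g) * ∏ i, (moebius z - pairRoot r i)) := by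
  rw [eval_aOfRoots]
  simp only [eval_ell_eq_moebius _ hz, Finset.prod_mul_distrib, Finset.prod_const,
    Finset.card_univ, Fintype.card_prod, Fintype.card_bool, Fintype.card_fin, mul_comm g 2]

/-- The roots avoid the preimages of `0` and `∞`. -/
def Admissible (r : Fin g → ℂ) : Prop := ∀ j, 1 + r j ^ 2 ≠ 0

lemma Admissible.I_sub_pairRoot {r : Fin g → ℂ} (h : Admissible r) (i : Fin g × Bool) :
    I - pairRoot r i ≠ 0 := by
  have h1 : ∀ r : ℂ, 1 + r ^ 2 = -((I - r) * (I + r)) := fun r => by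
    ring_nf; rw [I_sq]; ring
  have h2 := h i.1
  rw [h1, neg_ne_zero, mul_ne_zero_iff] at h2
  rw [pairRoot]
  split_ifs
  · intro h3
    refine h2.2 ?_
    have := congrArg (starRingEnd ℂ) h3
    simp only [map_sub, conj_I, conj_conj, map_zero] at this
    linear_combination -this
  · exact h2.1

lemma Admissible.rootScale_pos {r : Fin g → ℂ} (h : Admissible r) : 0 < rootScale r := by
  rw [rootScale]
  have : 0 < ∏ j, ‖1 + r j ^ 2‖ := Finset.prod_pos fun j _ => norm_pos_iff.2 (h j)
  positivity

lemma Admissible.rootScale_sq {r : Fin g → ℂ} (h : Admissible r) :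
    rootScale r ^ 2 * ∏ j, ‖1 + r j ^ 2‖ = 1 / 16 := by
  have : 0 < ∏ j, ‖1 + r j ^ 2‖ := Finset.prod_pos fun j _ => norm_pos_iff.2 (h j)
  rw [rootScale, inv_pow, Real.sq_sqrt (by positivity)]
  field_simp

lemma Admissible.eval_aOfRoots_eq {r : Fin g → ℂ} (h : Admissible r) (z : ℂ) :
    (aOfRoots r).eval z = (-(rootScale r : ℂ) ^ 2 * ∏ i, (I - pairRoot r i)) *
      ∏ i, (z - moebiusInv (pairRoot r i)) := by
  rw [eval_aOfRoots, mul_assoc, ← Finset.prod_mul_distrib]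
  congr 1
  exact Finset.prod_congr rfl fun i _ => eval_ell_eq_moebiusInv (h.I_sub_pairRoot i) z

lemma Admissible.leadingCoeff_ne_zero {r : Fin g → ℂ} (h : Admissible r) :
    -(rootScale r : ℂ) ^ 2 * ∏ i, (I - pairRoot r i) ≠ 0 :=
  mul_ne_zero (neg_ne_zero.2 (pow_ne_zero 2 (by exact_mod_cast h.rootScale_pos.ne')))
    (Finset.prod_ne_zero_iff.2 fun i _ => h.I_sub_pairRoot i)

lemma Admissible.aOfRoots_eq {r : Fin g → ℂ} (h : Admissible r) :
    aOfRoots r = C (-(rootScale r : ℂ) ^ 2 * ∏ i, (I - pairRoot r i)) *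
      ∏ i, (X - C (moebiusInv (pairRoot r i))) := by
  refine eq_of_eval_eq_of_ne ∅ fun z _ => ?_
  rw [h.eval_aOfRoots_eq, eval_mul, eval_C, eval_prod]
  simp

lemma Admissible.natDegree_aOfRoots {r : Fin g → ℂ} (h : Admissible r) :
    (aOfRoots r).natDegree = 2 * g := by
  rw [h.aOfRoots_eq, natDegree_C_mul h.leadingCoeff_ne_zero, natDegree_finsetProd_X_sub_C_eq_card]
  simp [mul_comm]

lemma degree_aOfRoots_lt (r : Fin g → ℂ) :
    (aOfRoots r).degree < ((2 * g + 1 : ℕ) : WithBot ℕ) := by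
  have h : (aOfRoots r).natDegree ≤ 2 * g := by
    rw [aOfRoots]
    refine (natDegree_C_mul_le _ _).trans ((natDegree_prod_le _ _).trans ?_)
    refine (Finset.sum_le_card_nsmul _ _ 1 fun i _ => ?_).trans ?_
    · refine (natDegree_sub_le _ _).trans ?_
      simp only [natDegree_C, zero_le, sup_of_le_left]
      exact (natDegree_C_mul_le _ _).trans natDegree_X_le
    · simp [mul_comm]
  refine (degree_le_of_natDegree_le h).trans_lt ?_
  exact_mod_cast Nat.lt_succ_self _

/-- The pair `(a, b)` with roots `r` and homogeneous coordinates `F` of `b`. -/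
def pairOf (r : Fin g → ℂ) (F : Fin (g + 2) → ℂ) : PolyPair g :=
  (fun i => (aOfRoots r).coeff i, ((rootScale r : ℂ) * I) • homogEquiv g F)

lemma aPoly_pairOf (r : Fin g → ℂ) (F : Fin (g + 2) → ℂ) : aPoly (pairOf r F) = aOfRoots r :=
  poly_coeff_eq (degree_aOfRoots_lt r)

lemma bPoly_pairOf (r : Fin g → ℂ) (F : Fin (g + 2) → ℂ) :
    bPoly (pairOf r F) = C ((rootScale r : ℂ) * I) * homog F := by
  rw [bPoly, pairOf, poly_smul, poly_homogEquiv]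

lemma pow_mul_conj_eval_aOfRoots (r : Fin g → ℂ) {z : ℂ} (hz : z ≠ 0) :
    z ^ (2 * g) * conj ((aOfRoots r).eval (conj z)⁻¹) = (aOfRoots r).eval z := by
  have h1 : z ^ (2 * g) = ∏ _i : Fin g × Bool, z := by simp [mul_comm]
  rw [eval_aOfRoots, map_mul, map_prod, h1, mul_left_comm, ← Finset.prod_mul_distrib, eval_aOfRoots]
  congr 1
  · simp
  · rw [← Equiv.prod_comp (pairSwap g)]
    refine Finset.prod_congr rfl fun i _ => ?_
    rw [mul_conj_eval_ell _ hz, pairRoot_swap, conj_conj]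

/-- On the circle the factors of a root and of its conjugate combine to z times a squared modulus.
So the sign condition on `a` is automatic in the normal form. -/
lemma inv_pow_mul_eval_aOfRoots (r : Fin g → ℂ) {z : ℂ} (hz : ‖z‖ = 1) :
    (z ^ g)⁻¹ * (aOfRoots r).eval z =
      ((-(rootScale r ^ 2 * ∏ j, Complex.normSq ((ell (r j)).eval z)) : ℝ) : ℂ) := by
  have hz0 : z ≠ 0 := fun h => by simp [h] at hz
  have hcz : (conj z)⁻¹ = z := by rw [← Complex.inv_eq_conj hz, inv_inv]
  rw [eval_aOfRoots, prod_pairRoot fun ρ => (ell ρ).eval z]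
  have h1 : ∀ j, (ell (r j)).eval z * (ell (conj (r j))).eval z =
      z * (Complex.normSq ((ell (r j)).eval z) : ℂ) := by
    intro j
    rw [← mul_conj_eval_ell _ hz0, hcz, ← Complex.mul_conj]
    ring
  simp only [h1, Finset.prod_mul_distrib, Finset.prod_const, Finset.card_univ, Fintype.card_fin]
  push_cast
  field_simp

lemma Admissible.norm_eval_zero {r : Fin g → ℂ} (h : Admissible r) :
    ‖(aOfRoots r).eval 0‖ = 1 / 16 := by
  rw [eval_aOfRoots, prod_pairRoot fun ρ => (ell ρ).eval 0, ← h.rootScale_sq, norm_mul, norm_prod,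
    norm_neg, norm_pow, Complex.norm_real, Real.norm_of_nonneg h.rootScale_pos.le]
  congr 1
  refine Finset.prod_congr rfl fun j _ => ?_
  have h1 : ‖(ell (conj (r j))).eval 0‖ = ‖I - r j‖ := by
    rw [← norm_conj, eval_ell]
    congr 1
    simp
    ring
  rw [norm_mul, h1, ← norm_mul, eval_ell]
  congr 1
  linear_combination -I_sq

/-- Pairs in normal form are spectral data, up to the existence of a monodromy eigenvalue. -/
lemma isSpectralData_pairOf {r : Fin g → ℂ} {F : Fin (g + 2) → ℂ} (h : Admissible r)
    (hinj : Function.Injective (pairRoot r)) (hF : (fun i => conj (F i)) = F)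
    (hb : (homogEquiv g F) (Fin.last (g + 1)) ≠ 0)
    (hμ : ∃ μ, IsMonodromyEigenvalue g (aPoly (pairOf r F)) (bPoly (pairOf r F)) μ) :
    IsSpectralData g (pairOf r F) := by
  have hs : ((rootScale r : ℂ) * I) ≠ 0 :=
    mul_ne_zero (by exact_mod_cast h.rootScale_pos.ne') I_ne_zero
  refine ⟨?_, ?_, ?_, ?_, ?_, ?_, ?_, hμ⟩
  · rw [aPoly_pairOf, h.natDegree_aOfRoots]
  · rw [bPoly_pairOf, natDegree_C_mul hs, ← poly_homogEquiv]
    refine natDegree_eq_of_le_of_coeff_ne_zero ?_ ?_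
    · exact natDegree_le_iff_coeff_eq_zero.2 fun m hm => by
        rw [coeff_poly, dif_neg (by omega)]
    · rw [coeff_poly, dif_pos (by omega)]
      exact hb
  · rw [aPoly_pairOf, h.norm_eval_zero]
  · intro z hz
    rw [aPoly_pairOf, pow_mul_conj_eval_aOfRoots r hz]
  · intro z hz
    rw [aPoly_pairOf, inv_pow_mul_eval_aOfRoots r hz]
    refine ⟨ofReal_im _, ?_⟩
    rw [ofReal_re]
    exact neg_nonpos.2 (mul_nonneg (sq_nonneg _) (Finset.prod_nonneg fun j _ => normSq_nonneg _))
  · intro z hz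
    rw [aPoly_pairOf, h.aOfRoots_eq] at hz ⊢
    -- Distinct entries of `pairRoot` stay distinct under the injective inverse Möbius map.
    have hsep : (∏ i, (X - C (moebiusInv (pairRoot r i)))).Separable := by
      refine separable_prod_X_sub_C_iff.2 fun i j hij => hinj ?_
      rw [← moebius_moebiusInv (h.I_sub_pairRoot i), ← moebius_moebiusInv (h.I_sub_pairRoot j), hij]
    rw [eval_mul, eval_C, mul_eq_zero, or_iff_right h.leadingCoeff_ne_zero] at hz
    rw [derivative_C_mul, eval_mul, eval_C]
    have h1 := Separable.aeval_derivative_ne_zero hsep (x := z) (by rw [coe_aeval_eq_eval, hz])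
    rw [coe_aeval_eq_eval] at h1
    exact mul_ne_zero h.leadingCoeff_ne_zero h1
  · intro z hz
    rw [bPoly_pairOf, eval_mul, eval_mul, map_mul, mul_left_comm, pow_mul_conj_eval_homog _ hz, hF]
    simp

end Moebius

/-! ### Every spectral datum has the normal form -/

section NormalForm

open Complex

lemma norm_moebiusInv (r : ℂ) : ‖moebiusInv r‖ = ‖I + r‖ / ‖I - r‖ := by
  rw [moebiusInv, norm_div]

lemma im_neg_of_norm_moebiusInv_lt_one {r : ℂ} (hr : I - r ≠ 0) (h : ‖moebiusInv r‖ < 1) :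
    r.im < 0 := by
  rw [norm_moebiusInv, div_lt_one (norm_pos_iff.2 hr), ← sq_lt_sq₀ (norm_nonneg _) (norm_nonneg _),
    ← normSq_eq_norm_sq, ← normSq_eq_norm_sq, normSq_apply, normSq_apply] at h
  simp at h
  nlinarith

lemma moebiusInv_conj (r : ℂ) : moebiusInv (conj r) = (conj (moebiusInv r))⁻¹ := by
  rw [moebiusInv, moebiusInv, map_div₀, inv_div, map_sub, map_add, conj_I, ← neg_div_neg_eq]
  congr 1 <;> ring

variable {g : ℕ} {p : PolyPair g}

/-- On the circle λ^(-g) a is real and nonpositive, so a zero is a maximum along the circle. Its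
derivative vanishes there, contradicting simplicity of the root. -/
lemma IsSpectralData.norm_ne_one (hp : IsSpectralData g p) {z : ℂ} (hz : (aPoly p).eval z = 0) :
    ‖z‖ ≠ 1 := by
  intro h1
  have hz0 : z ≠ 0 := fun h => by simp [h] at h1
  obtain ⟨θ, hθ⟩ : ∃ θ : ℝ, exp (θ * I) = z := ⟨z.arg, by
    have := norm_mul_exp_arg_mul_I z
    rwa [h1, ofReal_one, one_mul] at this⟩
  have he : HasDerivAt (fun t : ℝ => exp (t * I)) (z * I) θ := by
    have : HasDerivAt (fun w : ℂ => exp (w * I)) (exp (θ * I) * (1 * I)) θ :=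
      ((hasDerivAt_id (θ : ℂ)).mul_const I).cexp
    rw [one_mul, hθ] at this
    exact this.comp_ofReal
  have hu : DifferentiableAt ℝ (fun t : ℝ => ((exp (t * I)) ^ g)⁻¹) θ :=
    (he.differentiableAt.pow g).inv (pow_ne_zero g (exp_ne_zero _))
  have hw : HasDerivAt (fun t : ℝ => (aPoly p).eval (exp (t * I)))
      ((derivative (aPoly p)).eval z * (z * I)) θ := by
    have := (aPoly p).hasDerivAt (exp (θ * I))
    rw [hθ] at this
    exact HasDerivAt.comp (h₂ := fun w => (aPoly p).eval w) θ (by rw [hθ]; exact this) he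
  have hH := hu.hasDerivAt.mul hw
  simp only [hθ, hz, mul_zero, zero_add] at hH
  have hexp : ∀ t : ℝ, ‖exp (t * I)‖ = 1 := norm_exp_ofReal_mul_I
  set D := (z ^ g)⁻¹ * ((derivative (aPoly p)).eval z * (z * I)) with hD
  have hre : HasDerivAt (fun t : ℝ => (((exp (t * I)) ^ g)⁻¹ * (aPoly p).eval (exp (t * I))).re)
      D.re θ := reCLM.hasFDerivAt.comp_hasDerivAt θ hH
  have him : HasDerivAt (fun t : ℝ => (((exp (t * I)) ^ g)⁻¹ * (aPoly p).eval (exp (t * I))).im)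
      D.im θ := imCLM.hasFDerivAt.comp_hasDerivAt θ hH
  have him0 : D.im = 0 := by
    refine him.unique ?_
    have : (fun t : ℝ => (((exp (t * I)) ^ g)⁻¹ * (aPoly p).eval (exp (t * I))).im) =
        fun _ => 0 := funext fun t => (hp.nonpos_a _ (hexp t)).1
    rw [this]
    exact hasDerivAt_const _ _
  have hre0 : D.re = 0 := by
    refine IsLocalMax.hasDerivAt_eq_zero (Filter.Eventually.of_forall fun t => ?_) hre
    simp only [hθ, hz, mul_zero, zero_re]
    exact (hp.nonpos_a _ (hexp t)).2
  have hD0 : D = 0 := Complex.ext hre0 him0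
  exact mul_ne_zero (inv_ne_zero (pow_ne_zero g hz0))
    (mul_ne_zero (hp.simple_a z hz) (mul_ne_zero hz0 I_ne_zero)) hD0

lemma IsSpectralData.aPoly_ne_zero (hp : IsSpectralData g p) : aPoly p ≠ 0 := by
  intro h
  have := hp.norm_a
  rw [h] at this
  norm_num at this

lemma IsSpectralData.ne_zero_of_root (hp : IsSpectralData g p) {z : ℂ}
    (hz : (aPoly p).eval z = 0) : z ≠ 0 := by
  intro h
  have := hp.norm_a
  rw [← h, hz] at this
  norm_num at this

lemma IsSpectralData.reflect_root (hp : IsSpectralData g p) {z : ℂ} (hz : (aPoly p).eval z = 0) :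
    (aPoly p).eval (conj z)⁻¹ = 0 := by
  have hz0 := hp.ne_zero_of_root hz
  have := hp.real_a z hz0
  rw [hz, mul_eq_zero, or_iff_right (pow_ne_zero _ hz0)] at this
  simpa using this

/-- The roots of `a` in the unit disc. -/
lemma IsSpectralData.exists_roots (hp : IsSpectralData g p) :
    ∃ ρ : Fin g → ℂ, Function.Injective ρ ∧ (∀ j, ‖ρ j‖ < 1) ∧
      (∀ j, (aPoly p).eval (ρ j) = 0) ∧
      ∃ κ : ℂ, aPoly p = C κ * ∏ z ∈ (aPoly p).roots.toFinset, (X - C z) ∧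
        (aPoly p).roots.toFinset.card = 2 * g := by
  classical
  have ha0 := hp.aPoly_ne_zero
  set Z := (aPoly p).roots.toFinset with hZ
  have hmem : ∀ z, z ∈ Z ↔ (aPoly p).eval z = 0 := by
    intro z
    rw [hZ, Multiset.mem_toFinset, mem_roots ha0, IsRoot.def]
  have hnodup : (aPoly p).roots.Nodup := by
    refine nodup_roots ?_
    rw [separable_def]
    refine isCoprime_of_irreducible_dvd (fun h => ha0 h.1) fun q hq h1 h2 => ?_
    obtain ⟨z, hz⟩ := IsAlgClosed.exists_root q (degree_pos_of_irreducible hq).ne'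
    exact hp.simple_a z (hz.dvd h1) (hz.dvd h2)
  have hsplit : (aPoly p).Splits := IsAlgClosed.splits _
  have hcard : Z.card = 2 * g := by
    rw [hZ, Multiset.toFinset_card_of_nodup hnodup, ← hp.degree_a, hsplit.natDegree_eq_card_roots]
  have hprod : aPoly p = C (aPoly p).leadingCoeff * ∏ z ∈ Z, (X - C z) := by
    conv_lhs => rw [hsplit.eq_prod_roots]
    congr 1
    rw [hZ, Finset.prod, Multiset.toFinset_val, hnodup.dedup]
  have hD : (Z.filter fun z => ‖z‖ < 1).card = g := by
    have h1 := Finset.card_filter_add_card_filter_not (s := Z) (fun z => ‖z‖ < 1)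
    -- Reflection in the circle exchanges inner and outer roots, and none lies on the circle, so
    -- exactly g of the 2g roots lie inside.
    have h2 : (Z.filter fun z => ‖z‖ < 1).card = (Z.filter fun z => ¬ ‖z‖ < 1).card := by
      refine Finset.card_nbij' (fun z => (conj z)⁻¹) (fun z => (conj z)⁻¹) ?_ ?_ ?_ ?_
      · intro z hz
        simp only [Finset.coe_filter, Set.mem_ofPred_eq, hmem] at hz ⊢
        refine ⟨hp.reflect_root hz.1, ?_⟩
        rw [norm_inv, norm_conj, not_lt]
        exact (one_le_inv₀ (norm_pos_iff.2 (hp.ne_zero_of_root hz.1))).2 hz.2.le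
      · intro z hz
        simp only [Finset.coe_filter, Set.mem_ofPred_eq, hmem] at hz ⊢
        refine ⟨hp.reflect_root hz.1, ?_⟩
        rw [norm_inv, norm_conj]
        exact inv_lt_one_of_one_lt₀ (lt_of_le_of_ne (not_lt.1 hz.2) (hp.norm_ne_one hz.1).symm)
      · intro z _
        simp
      · intro z _
        simp
    omega
  let e := (Finset.equivFinOfCardEq hD).symm
  have he : ∀ j, (e j : ℂ) ∈ Z.filter fun z => ‖z‖ < 1 := fun j => (e j).2
  simp only [Finset.mem_filter, hmem] at he
  exact ⟨fun j => e j, fun i j hij => e.injective (Subtype.ext hij), fun j => (he j).2,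
    fun j => (he j).1, _, hprod, hcard⟩

/-- Spectral data have a normal form. -/
theorem IsSpectralData.exists_pairOf (hp : IsSpectralData g p) :
    ∃ (r : Fin g → ℂ) (F : Fin (g + 2) → ℂ), Admissible r ∧ Function.Injective (pairRoot r) ∧
      (fun i => conj (F i)) = F ∧ p = pairOf r F := by
  classical
  obtain ⟨ρ, hρi, hρ1, hρa, κ₀, hκ₀, hcard⟩ := hp.exists_roots
  have hρ1' : ∀ j, ρ j + 1 ≠ 0 := fun j h => by
    have := hρ1 j
    rw [eq_neg_of_add_eq_zero_left h] at this
    simp at this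
  set r : Fin g → ℂ := fun j => moebius (ρ j) with hr
  have hIr : ∀ j, I - r j ≠ 0 := fun j => I_sub_moebius_ne_zero (hρ1' j)
  have hinv : ∀ j, moebiusInv (r j) = ρ j := fun j => moebiusInv_moebius (hρ1' j)
  have hadm : Admissible r := by
    intro j h
    have h1 : I + r j ≠ 0 := by
      intro h2
      refine hp.ne_zero_of_root (hρa j) ?_
      rw [← hinv j, moebiusInv, h2, zero_div]
    refine mul_ne_zero (hIr j) h1 ?_
    linear_combination -h + I_sq
  -- Roots inside the disc go to the lower half plane, so no r_i is the conjugate of some r_j.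
  have him : ∀ j, (r j).im < 0 := fun j =>
    im_neg_of_norm_moebiusInv_lt_one (hIr j) (by rw [hinv]; exact hρ1 j)
  have hrinj : Function.Injective r := by
    intro i j hij
    refine hρi ?_
    rw [← hinv, ← hinv, hij]
  have hinj : Function.Injective (pairRoot r) := by
    rintro ⟨i, b⟩ ⟨j, b'⟩ hij
    have h1 := him i
    have h2 := him j
    cases b <;> cases b' <;> simp only [pairRoot, if_true, Bool.false_eq_true, if_false] at hij
    · rw [hrinj hij]
    · have := congrArg Complex.im hij
      rw [conj_im] at this
      linarith
    · have := congrArg Complex.im hij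
      rw [conj_im] at this
      linarith
    · rw [hrinj ((starRingEnd ℂ).injective hij)]
  have hroot : ∀ i, (aPoly p).eval (moebiusInv (pairRoot r i)) = 0 := by
    rintro ⟨j, b⟩
    cases b
    · simpa [pairRoot, hinv] using hρa j
    · simpa [pairRoot, moebiusInv_conj, hinv] using hp.reflect_root (hρa j)
  have hinj' : Function.Injective fun i => moebiusInv (pairRoot r i) := by
    intro i j hij
    refine hinj ?_
    rw [← moebius_moebiusInv (hadm.I_sub_pairRoot i), ← moebius_moebiusInv (hadm.I_sub_pairRoot j)]
    exact congrArg moebius hij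
  have himage : Finset.univ.image (fun i => moebiusInv (pairRoot r i)) =
      (aPoly p).roots.toFinset := by
    refine Finset.eq_of_subset_of_card_le ?_ ?_
    · intro z hz
      obtain ⟨i, _, rfl⟩ := Finset.mem_image.1 hz
      rw [Multiset.mem_toFinset, mem_roots hp.aPoly_ne_zero, IsRoot.def]
      exact hroot i
    · rw [hcard, Finset.card_image_of_injective _ hinj']
      simp [mul_comm]
  obtain ⟨κ, hκ⟩ : ∃ κ : ℂ, aPoly p = C κ * aOfRoots r := by
    refine ⟨κ₀ / (-(rootScale r : ℂ) ^ 2 * ∏ i, (I - pairRoot r i)), ?_⟩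
    rw [hadm.aOfRoots_eq, ← mul_assoc, ← C_mul, div_mul_cancel₀ _ hadm.leadingCoeff_ne_zero]
    conv_lhs => rw [hκ₀, ← himage, Finset.prod_image fun i _ j _ h => hinj' h]
  -- The value at 0 fixes |κ| = 1; at the point 1 both polynomials are negative, so κ is real and
  -- nonnegative.
  have hκ1 : κ = 1 := by
    have h1 := hp.norm_a
    rw [hκ, eval_mul, eval_C, norm_mul, hadm.norm_eval_zero] at h1
    have h2 : ‖κ‖ = 1 := by linarith
    have h3 := hp.nonpos_a 1 norm_one
    have h4 := inv_pow_mul_eval_aOfRoots r (z := 1) norm_one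
    have h5 : (aPoly p).eval 1 ≠ 0 := fun h => hp.norm_ne_one h norm_one
    rw [hκ, eval_mul, eval_C, mul_left_comm, h4] at h3
    rw [hκ, eval_mul, eval_C] at h5
    rw [one_pow, inv_one, one_mul] at h4
    rw [h4] at h5
    set m : ℝ := rootScale r ^ 2 * ∏ j, normSq ((ell (r j)).eval 1) with hm
    have hm0 : 0 ≤ m := mul_nonneg (sq_nonneg _) (Finset.prod_nonneg fun j _ => normSq_nonneg _)
    have hm1 : m ≠ 0 := fun h => h5 (by rw [h]; simp)
    have hmp : 0 < m := lt_of_le_of_ne hm0 hm1.symm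
    rw [im_mul_ofReal, re_mul_ofReal] at h3
    have h6 : κ.im = 0 := by
      rcases mul_eq_zero.1 h3.1 with h | h
      · exact h
      · exact absurd (neg_eq_zero.1 h) hm1
    have h7 : 0 ≤ κ.re := by
      by_contra h
      push Not at h
      nlinarith [h3.2]
    have h8 : κ = (κ.re : ℂ) := Complex.ext (by simp) (by simp [h6])
    rw [h8, norm_real, Real.norm_of_nonneg h7] at h2
    rw [h8, h2, ofReal_one]
  rw [hκ1, C_1, one_mul] at hκ
  have hs : ((rootScale r : ℂ) * I) ≠ 0 :=
    mul_ne_zero (by exact_mod_cast hadm.rootScale_pos.ne') I_ne_zero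
  set F := (homogEquiv g).symm (((rootScale r : ℂ) * I)⁻¹ • p.2) with hF
  have hFe : homogEquiv g F = ((rootScale r : ℂ) * I)⁻¹ • p.2 := LinearEquiv.apply_symm_apply _ _
  have hhom : homog F = C ((rootScale r : ℂ) * I)⁻¹ * bPoly p := by
    rw [← poly_homogEquiv, hFe, poly_smul, bPoly]
  refine ⟨r, F, hadm, hinj, ?_, ?_⟩
  · refine homog_injective (eq_of_eval_eq_of_ne {0} fun z hz => ?_)
    have hz : z ≠ 0 := by simpa using hz
    rw [← pow_mul_conj_eval_homog _ hz, hhom, eval_mul, eval_mul, eval_C, eval_C, map_mul,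
      mul_left_comm, hp.real_b z hz, map_inv₀, map_mul, conj_I, conj_ofReal]
    field_simp
  · refine Prod.ext (poly_injective ?_) ?_
    · exact hκ.trans (aPoly_pairOf r F).symm
    · rw [pairOf, hFe, smul_smul, mul_inv_cancel₀ hs, one_smul]

end NormalForm

/-! ### The regular part of the Whitham field in the Möbius coordinate -/

section Field

open Complex

variable {g : ℕ}

/-- The vector field of the Whitham flow on polynomials in the coordinate `moebius λ`. -/
def fieldPoly (r : Fin g → ℂ) (K : Fin (g + 2) → ℂ) : ℂ[X] :=
  C (-1 / 4) * ∑ i, ((1 + X ^ 2) * poly (divDiff (pairRoot r i) K) +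
      C ((poly K).eval (pairRoot r i)) * (X + C (pairRoot r i))) -
    C (1 / 2) * (X * poly K) + C (1 / 2) * ((1 + X ^ 2) * derivative (poly K))

lemma coeff_one_add_X_sq_mul (p : ℂ[X]) (m : ℕ) :
    ((1 + X ^ 2) * p).coeff (m + 2) = p.coeff (m + 2) + p.coeff m := by
  rw [add_mul, one_mul, coeff_add, mul_comm (X ^ 2), coeff_mul_X_pow]

lemma coeff_divDiff (r : ℂ) {N : ℕ} (v : Fin N → ℂ) (m : ℕ) :
    (poly (divDiff r v)).coeff m =
      (poly v).coeff (m + 1) + r * (poly (divDiff r v)).coeff (m + 1) := by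
  have h := congrArg (fun p => p.coeff (m + 1)) (X_sub_C_mul_poly_divDiff r v)
  simp only [sub_mul, coeff_sub, coeff_X_mul, coeff_C_mul, coeff_C_succ, sub_zero] at h
  linear_combination h

/-- Only the coefficient of X^(g + 2) is in question. There the 2g divided differences contribute
-g/2, the middle term -1/2 and the derivative (g + 1)/2 times the top coefficient of K, with sum
zero. -/
lemma degree_fieldPoly_lt (r : Fin g → ℂ) (K : Fin (g + 2) → ℂ) :
    (fieldPoly r K).degree < ((g + 2 : ℕ) : WithBot ℕ) := by
  rw [degree_lt_iff_coeff_zero]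
  intro m hm
  obtain ⟨m, rfl⟩ := Nat.exists_eq_add_of_le' (le_trans (Nat.le_add_left 2 g) hm)
  have hK : ∀ k, g + 2 ≤ k → (poly K).coeff k = 0 := fun k hk => by
    rw [coeff_poly, dif_neg (by omega)]
  have hq : ∀ i k, g + 1 ≤ k → (poly (divDiff (pairRoot r i) K)).coeff k = 0 := fun i k hk => by
    rw [coeff_divDiff, hK _ (by omega), coeff_poly, dif_neg (by omega)]
    simp
  have hq' : ∀ i, (poly (divDiff (pairRoot r i) K)).coeff m = (poly K).coeff (m + 1) := fun i => by
    rw [coeff_divDiff, hq i (m + 1) (by omega), mul_zero, add_zero]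
  have hlin : ∀ ρ : ℂ, (X + C ρ).coeff (m + 2) = 0 := fun ρ => by
    rw [coeff_add, coeff_X, coeff_C]; simp
  rw [fieldPoly, coeff_add, coeff_sub, coeff_C_mul, coeff_C_mul, coeff_C_mul, finsetSum_coeff,
    coeff_one_add_X_sq_mul, coeff_X_mul (poly K) (m + 1), coeff_derivative, coeff_derivative,
    hK (m + 2 + 1) (by omega)]
  simp only [coeff_add, coeff_one_add_X_sq_mul, coeff_C_mul, hlin, hq _ (m + 2) (by omega), hq',
    mul_zero, add_zero, zero_add, Finset.sum_const, Finset.card_univ, Fintype.card_prod, Fintype.card_bool, Fintype.card_fin]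
  rcases Nat.eq_or_lt_of_le hm with h | h
  · have hm' : m = g := by omega
    subst hm'
    push_cast [nsmul_eq_mul]
    ring
  · rw [hK (m + 1) (by omega)]
    simp

/-- The coefficients of `fieldPoly`. -/
def fieldVec (r : Fin g → ℂ) (K : Fin (g + 2) → ℂ) : Fin (g + 2) → ℂ :=
  fun i => (fieldPoly r K).coeff i

lemma poly_fieldVec (r : Fin g → ℂ) (K : Fin (g + 2) → ℂ) : poly (fieldVec r K) = fieldPoly r K :=
  poly_coeff_eq (degree_fieldPoly_lt r K)

lemma eval_divDiff {N : ℕ} (ρ : ℂ) (v : Fin N → ℂ) {Z : ℂ} (hZ : Z - ρ ≠ 0) :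
    (poly (divDiff ρ v)).eval Z = ((poly v).eval Z - (poly v).eval ρ) / (Z - ρ) := by
  have h := congrArg (Polynomial.eval Z) (X_sub_C_mul_poly_divDiff ρ v)
  simp only [eval_mul, eval_sub, eval_X, eval_C] at h
  rw [eq_div_iff hZ, ← h, mul_comm]

/-- The last three terms are the right side of the Whitham equation divided by `a`, with poles at
the roots. The first sum removes these poles, and the equation for r' puts it back. -/
lemma eval_fieldPoly (r : Fin g → ℂ) (K : Fin (g + 2) → ℂ) {Z : ℂ}
    (hZ : ∀ i, Z - pairRoot r i ≠ 0) :
    2 * (fieldPoly r K).eval Z =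
      1 / 2 * ∑ i, (1 + pairRoot r i ^ 2) * (poly K).eval (pairRoot r i) / (Z - pairRoot r i) -
        1 / 2 * (1 + Z ^ 2) * (poly K).eval Z * ∑ i, 1 / (Z - pairRoot r i) -
        Z * (poly K).eval Z + (1 + Z ^ 2) * (derivative (poly K)).eval Z := by
  have h : ∀ i, (1 + Z ^ 2) * (poly (divDiff (pairRoot r i) K)).eval Z +
      (poly K).eval (pairRoot r i) * (Z + pairRoot r i) =
      (1 + Z ^ 2) * (poly K).eval Z * (1 / (Z - pairRoot r i)) -
        (1 + pairRoot r i ^ 2) * (poly K).eval (pairRoot r i) / (Z - pairRoot r i) := fun i => by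
    rw [eval_divDiff _ _ (hZ i)]
    have := hZ i
    field_simp
    ring
  simp only [fieldPoly, eval_add, eval_sub, eval_mul, eval_C, eval_finsetSum, eval_pow, eval_X,
    eval_one, h, Finset.sum_sub_distrib, ← Finset.mul_sum]
  ring

lemma map_conj_poly {N : ℕ} (v : Fin N → ℂ) :
    (poly v).map (starRingEnd ℂ) = poly fun i => conj (v i) := by
  simp [poly, Polynomial.map_sum]

lemma conj_eval_of_real {N : ℕ} {v : Fin N → ℂ} (hv : (fun i => conj (v i)) = v) (z : ℂ) :
    (poly v).eval (conj z) = conj ((poly v).eval z) := by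
  rw [eval_poly, eval_poly, map_sum]
  refine Finset.sum_congr rfl fun i _ => ?_
  rw [map_mul, map_pow, congrFun hv i]

lemma conj_fieldVec {r : Fin g → ℂ} {K : Fin (g + 2) → ℂ} (hK : (fun i => conj (K i)) = K) :
    (fun i => conj (fieldVec r K i)) = fieldVec r K := by
  refine poly_injective ?_
  rw [← map_conj_poly, poly_fieldVec, fieldPoly]
  have hq : ∀ i, (poly (divDiff (pairRoot r i) K)).map (starRingEnd ℂ) =
      poly (divDiff (pairRoot r (pairSwap g i)) K) := fun i => by
    rw [map_conj_poly, pairRoot_swap]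
    conv_rhs => rw [← hK, divDiff, aeval_shift_conj, map_conj_divSymbol, conj_conj]
    rfl
  simp only [Polynomial.map_add, Polynomial.map_sub, Polynomial.map_mul, Polynomial.map_sum,
    Polynomial.map_pow, map_C, map_X, Polynomial.map_one, hq, ← Polynomial.derivative_map,
    map_conj_poly K, hK, ← conj_eval_of_real hK, ← pairRoot_swap]
  rw [Equiv.sum_comp (pairSwap g) fun i => (1 + X ^ 2) * poly (divDiff (pairRoot r i) K) +
      C ((poly K).eval (pairRoot r i)) * (X + C (pairRoot r i))]
  simp [Complex.conj_ofNat]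

/-! ### Smooth dependence on parameters -/

section Smooth

variable {E : Type*} [NormedAddCommGroup E] [NormedSpace ℝ E] {O : Set E}

/-- Evaluation of a polynomial at as many points as it has coefficients. -/
def evalEquiv (N : ℕ) : (Fin N → ℂ) ≃ₗ[ℂ] (Fin N → ℂ) :=
  LinearEquiv.ofInjectiveEndo
    { toFun := fun v k => (poly v).eval ((k : ℕ) : ℂ)
      map_add' := fun v w => by funext k; simp [poly_add]
      map_smul' := fun a v => by funext k; simp [poly_smul] }
    ((injective_iff_map_eq_zero _).2 fun v hv => by
      refine poly_injective ?_
      rw [poly_zero]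
      refine Polynomial.eq_zero_of_degree_lt_of_eval_index_eq_zero (s := Finset.univ)
        (v := fun k : Fin N => ((k : ℕ) : ℂ)) ?_ ?_ fun k _ => congrFun hv k
      · intro i _ j _ hij
        exact Fin.ext (Nat.cast_injective hij)
      · simpa using degree_poly_lt v)

lemma contDiffOn_of_eval {N : ℕ} {v : E → Fin N → ℂ}
    (h : ∀ z : ℂ, ContDiffOn ℝ ∞ (fun x => (poly (v x)).eval z) O) : ContDiffOn ℝ ∞ v O := by
  have h1 : ContDiffOn ℝ ∞ (fun x => evalEquiv N (v x)) O :=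
    contDiffOn_pi.2 fun k => h ((k : ℕ) : ℂ)
  have h2 := ((LinearMap.toContinuousLinearMap
    ((evalEquiv N).symm : (Fin N → ℂ) →ₗ[ℂ] (Fin N → ℂ))).restrictScalars
    ℝ).contDiff.comp_contDiffOn h1
  refine h2.congr fun x _ => ?_
  simp

lemma contDiffOn_linearMap {V W : Type*} [NormedAddCommGroup V] [NormedSpace ℂ V]
    [FiniteDimensional ℂ V] [NormedAddCommGroup W] [NormedSpace ℂ W] (L : V →ₗ[ℂ] W) {v : E → V}
    (hv : ContDiffOn ℝ ∞ v O) : ContDiffOn ℝ ∞ (fun x => L (v x)) O :=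
  ((LinearMap.toContinuousLinearMap L).restrictScalars ℝ).contDiff.comp_contDiffOn hv

lemma contDiffOn_pairRoot {r : E → Fin g → ℂ} (hr : ContDiffOn ℝ ∞ r O) (i : Fin g × Bool) :
    ContDiffOn ℝ ∞ (fun x => pairRoot (r x) i) O := by
  have h := contDiffOn_pi.1 hr i.1
  simp only [pairRoot]
  split_ifs
  · exact (conjCLE : ℂ →L[ℝ] ℂ).contDiff.comp_contDiffOn h
  · exact h

lemma contDiffOn_eval_poly {N : ℕ} {v : E → Fin N → ℂ} {z : E → ℂ} (hv : ContDiffOn ℝ ∞ v O)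
    (hz : ContDiffOn ℝ ∞ z O) : ContDiffOn ℝ ∞ (fun x => (poly (v x)).eval (z x)) O := by
  simp only [eval_poly]
  exact ContDiffOn.sum fun i _ => (contDiffOn_pi.1 hv i).mul (hz.pow _)

lemma contDiffOn_eval_derivative_poly {N : ℕ} {v : E → Fin N → ℂ} {z : E → ℂ}
    (hv : ContDiffOn ℝ ∞ v O) (hz : ContDiffOn ℝ ∞ z O) :
    ContDiffOn ℝ ∞ (fun x => (derivative (poly (v x))).eval (z x)) O := by
  simp only [eval_derivative_poly]
  exact ContDiffOn.sum fun i _ =>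
    (contDiffOn_pi.1 hv i).mul (contDiffOn_const.mul (hz.pow _))

lemma contDiffOn_divDiff {N : ℕ} {v : E → Fin N → ℂ} {z : E → ℂ} (hv : ContDiffOn ℝ ∞ v O)
    (hz : ContDiffOn ℝ ∞ z O) : ContDiffOn ℝ ∞ (fun x => divDiff (z x) (v x)) O := by
  have h : ∀ (ρ : ℂ) (w : Fin N → ℂ), divDiff ρ w =
      ∑ k ∈ Finset.range N, ρ ^ k • (shift ^ (k + 1)) w := fun ρ w => by
    rw [divDiff, divSymbol, map_sum, LinearMap.sum_apply]
    refine Finset.sum_congr rfl fun k _ => ?_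
    rw [map_mul, aeval_C, aeval_X_pow, Module.algebraMap_end_eq_smul_id, Module.End.mul_apply]
    rfl
  simp only [h]
  exact ContDiffOn.sum fun k _ => (hz.pow k).smul (contDiffOn_linearMap _ hv)

lemma contDiffOn_fieldVec {r : E → Fin g → ℂ} {K : E → Fin (g + 2) → ℂ}
    (hr : ContDiffOn ℝ ∞ r O) (hK : ContDiffOn ℝ ∞ K O) :
    ContDiffOn ℝ ∞ (fun x => fieldVec (r x) (K x)) O := by
  refine contDiffOn_of_eval fun z => ?_
  simp only [poly_fieldVec, fieldPoly, eval_add, eval_sub, eval_mul, eval_C, eval_finsetSum,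
    eval_pow, eval_X, eval_one]
  have hρ := contDiffOn_pairRoot hr
  have hz : ContDiffOn ℝ ∞ (fun _ : E => z) O := contDiffOn_const
  refine ContDiffOn.add (ContDiffOn.sub (contDiffOn_const.mul (ContDiffOn.sum fun i _ => ?_))
    (contDiffOn_const.mul (contDiffOn_const.mul (contDiffOn_eval_poly hK hz))))
    (contDiffOn_const.mul (contDiffOn_const.mul (contDiffOn_eval_derivative_poly hK hz)))
  exact (contDiffOn_const.mul (contDiffOn_eval_poly (contDiffOn_divDiff hK (hρ i)) hz)).add
    ((contDiffOn_eval_poly hK (hρ i)).mul (contDiffOn_const.add (hρ i)))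

lemma contDiffOn_rootScale {r : E → Fin g → ℂ} (hr : ContDiffOn ℝ ∞ r O)
    (hadm : ∀ x ∈ O, Admissible (r x)) : ContDiffOn ℝ ∞ (fun x => rootScale (r x)) O := by
  have hpos : ∀ x ∈ O, 16 * ∏ j, ‖1 + r x j ^ 2‖ ≠ 0 := fun x hx =>
    mul_ne_zero (by norm_num) (Finset.prod_ne_zero_iff.2 fun j _ => norm_ne_zero_iff.2 (hadm x hx j))
  simp only [rootScale]
  refine ContDiffOn.inv (ContDiffOn.sqrt (contDiffOn_const.mul (contDiffOn_prod fun j _ => ?_))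
    hpos) fun x hx => ?_
  · exact (contDiffOn_const.add ((contDiffOn_pi.1 hr j).pow 2)).norm ℝ fun x hx => hadm x hx j
  · exact (inv_pos.1 (hadm x hx).rootScale_pos).ne'

lemma contDiffOn_pairOf {r : E → Fin g → ℂ} {F : E → Fin (g + 2) → ℂ}
    (hr : ContDiffOn ℝ ∞ r O) (hadm : ∀ x ∈ O, Admissible (r x)) (hF : ContDiffOn ℝ ∞ F O) :
    ContDiffOn ℝ ∞ (fun x => pairOf (r x) (F x)) O := by
  have hs : ContDiffOn ℝ ∞ (fun x => (rootScale (r x) : ℂ)) O :=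
    ofRealCLM.contDiff.comp_contDiffOn (contDiffOn_rootScale hr hadm)
  refine ContDiffOn.prodMk ?_ ((hs.mul contDiffOn_const).smul
    (contDiffOn_linearMap (homogEquiv g).toLinearMap hF))
  refine contDiffOn_of_eval fun z => ?_
  have h : ∀ r : Fin g → ℂ, (poly fun i : Fin (2 * g + 1) => (aOfRoots r).coeff i) = aOfRoots r :=
    fun r => poly_coeff_eq (degree_aOfRoots_lt r)
  simp only [h, eval_aOfRoots, eval_ell]
  have hρ := contDiffOn_pairRoot hr
  refine ContDiffOn.mul (hs.pow 2).neg (contDiffOn_prod fun i _ => ?_)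
  exact ((contDiffOn_const.sub (hρ i)).mul contDiffOn_const).sub (contDiffOn_const.add (hρ i))

end Smooth

end Field

/-! ### The Whitham equation in normal form -/

section WhithamEquation

open Complex

variable {g : ℕ}

lemma hasDerivAt_prod_sub {ι 𝕜 : Type*} [NontriviallyNormedField 𝕜] [NormedAlgebra 𝕜 ℂ]
    (s : Finset ι) {Z : 𝕜 → ℂ} {Z' : ℂ} {ρ : 𝕜 → ι → ℂ} {ρ' : ι → ℂ} {t : 𝕜}
    (hZ : HasDerivAt Z Z' t) (hρ : ∀ i ∈ s, HasDerivAt (fun τ => ρ τ i) (ρ' i) t)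
    (h0 : ∀ i ∈ s, Z t - ρ t i ≠ 0) :
    HasDerivAt (fun τ => ∏ i ∈ s, (Z τ - ρ τ i))
      ((∏ i ∈ s, (Z t - ρ t i)) * ∑ i ∈ s, (Z' - ρ' i) / (Z t - ρ t i)) t := by
  classical
  refine (HasDerivAt.fun_finsetProd fun i hi => hZ.sub (hρ i hi)).congr_deriv ?_
  rw [Finset.mul_sum]
  refine Finset.sum_congr rfl fun i hi => ?_
  rw [← Finset.mul_prod_erase s _ hi, smul_eq_mul]
  have := h0 i hi
  field_simp
  exact mul_comm _ _

lemma hasDerivAt_pairRoot {r : ℝ → Fin g → ℂ} {r' : Fin g → ℂ} {t : ℝ} (hr : HasDerivAt r r' t)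
    (i : Fin g × Bool) : HasDerivAt (fun τ => pairRoot (r τ) i) (pairRoot r' i) t := by
  have h := hasDerivAt_pi.1 hr i.1
  simp only [pairRoot]
  split_ifs
  · exact (conjCLE : ℂ →L[ℝ] ℂ).hasFDerivAt.comp_hasDerivAt t h
  · exact h

lemma hasDerivAt_moebius {z : ℂ} (hz : z + 1 ≠ 0) :
    HasDerivAt moebius (2 * I / (z + 1) ^ 2) z := by
  have h1 : HasDerivAt (fun w : ℂ => I * (w - 1)) (I * 1) z :=
    ((hasDerivAt_id z).sub_const 1).const_mul I
  have h2 : HasDerivAt (fun w : ℂ => w + 1) 1 z := (hasDerivAt_id z).add_const 1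
  refine (h1.div h2 hz).congr_deriv ?_
  congr 1
  ring

lemma hasDerivAt_add_one_pow {z : ℂ} (hz : z + 1 ≠ 0) (m : ℕ) :
    HasDerivAt (fun w : ℂ => (w + 1) ^ m) ((z + 1) ^ m * (m / (z + 1))) z := by
  have h2 : HasDerivAt (fun w : ℂ => w + 1) 1 z := (hasDerivAt_id z).add_const 1
  refine (h2.pow m).congr_deriv ?_
  cases m with
  | zero => simp
  | succ m => simp only [Nat.add_sub_cancel, pow_succ]; field_simp

lemma eventually_add_one_ne_zero {z : ℂ} (hz : z + 1 ≠ 0) : ∀ᶠ w in 𝓝 z, w + 1 ≠ 0 :=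
  (continuous_id.add continuous_const).continuousAt.eventually_ne hz

lemma eval_derivative_homog (v : Fin (g + 2) → ℂ) {z : ℂ} (hz : z + 1 ≠ 0) :
    (derivative (homog v)).eval z = (z + 1) ^ (g + 1) * (((g + 1 : ℕ) : ℂ) / (z + 1) *
      (poly v).eval (moebius z) +
        (derivative (poly v)).eval (moebius z) * (2 * I / (z + 1) ^ 2)) := by
  have h1 := (hasDerivAt_add_one_pow hz (g + 1)).mul
    (((poly v).hasDerivAt (moebius z)).comp z (hasDerivAt_moebius hz))
  refine ((homog v).hasDerivAt z).unique (HasDerivAt.congr_of_eventuallyEq (h1.congr_deriv ?_) ?_)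
  · simp only [Function.comp]
    ring
  · filter_upwards [eventually_add_one_ne_zero hz] with w hw
    rw [eval_homog_eq_moebius _ hw]
    rfl

lemma eval_derivative_aOfRoots (r : Fin g → ℂ) {z : ℂ} (hz : z + 1 ≠ 0)
    (hr : ∀ i, moebius z - pairRoot r i ≠ 0) :
    (derivative (aOfRoots r)).eval z = (aOfRoots r).eval z *
      (((2 * g : ℕ) : ℂ) / (z + 1) +
        2 * I / (z + 1) ^ 2 * ∑ i, 1 / (moebius z - pairRoot r i)) := by
  have h1 := ((hasDerivAt_add_one_pow hz (2 * g)).mul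
    (hasDerivAt_prod_sub (ρ := fun _ => pairRoot r) (ρ' := fun _ => 0) Finset.univ
      (hasDerivAt_moebius hz) (fun i _ => hasDerivAt_const _ _) fun i _ => hr i)).const_mul
        (-(rootScale r : ℂ) ^ 2)
  refine ((aOfRoots r).hasDerivAt z).unique
    (HasDerivAt.congr_of_eventuallyEq (h1.congr_deriv ?_) ?_)
  · rw [eval_aOfRoots_eq_moebius _ hz]
    have h2 : ∑ i, (2 * I / (z + 1) ^ 2 - 0) / (moebius z - pairRoot r i) =
        2 * I / (z + 1) ^ 2 * ∑ i, 1 / (moebius z - pairRoot r i) := by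
      rw [Finset.mul_sum]
      exact Finset.sum_congr rfl fun i _ => by ring
    rw [h2]
    ring
  · filter_upwards [eventually_add_one_ne_zero hz] with w hw
    rw [eval_aOfRoots_eq_moebius _ hw]
    rfl

lemma isOpen_admissible : IsOpen {r : Fin g → ℂ | Admissible r} := by
  have : {r : Fin g → ℂ | Admissible r} = ⋂ j, {r : Fin g → ℂ | 1 + r j ^ 2 ≠ 0} := by
    ext r; simp [Admissible]
  rw [this]
  exact isOpen_iInter_of_finite fun j => isOpen_ne.preimage (by fun_prop)

/-- The Whitham equation for pairs in normal form. -/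
lemma whithamEq_pairOf {r : ℝ → Fin g → ℂ} {F : ℝ → Fin (g + 2) → ℂ} {r' : Fin g → ℂ}
    {F' K : Fin (g + 2) → ℂ} {t : ℝ} (hr : HasDerivAt r r' t) (hF : HasDerivAt F F' t)
    (hadm : Admissible (r t))
    (hr' : ∀ i, pairRoot r' i * (poly (F t)).eval (pairRoot (r t) i) =
      -(1 / 2) * (1 + pairRoot (r t) i ^ 2) * (poly K).eval (pairRoot (r t) i))
    (hF' : F' = fieldVec (r t) K -
      (1 / 2 : ℂ) • ∑ i, pairRoot r' i • divDiff (pairRoot (r t) i) (F t))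
    {v : PolyPair g} (hv : HasDerivAt (fun τ => pairOf (r τ) (F τ)) v t) :
    WhithamEq (homogEquiv g ((rootScale (r t) : ℂ) • K)) (pairOf (r t) (F t)) v := by
  classical
  -- Excluded are the pole of the Möbius map and the roots of `a`, where the logarithmic derivatives
  -- are undefined.
  refine eq_of_eval_eq_of_ne
    (insert (-1) (Finset.univ.image fun i => moebiusInv (pairRoot (r t) i))) fun z hz => ?_
  rw [Finset.mem_insert, not_or] at hz
  have hz1 : z + 1 ≠ 0 := fun h => hz.1 (eq_neg_of_add_eq_zero_left h)
  set Z := moebius z with hZdef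
  have hZ : ∀ i, Z - pairRoot (r t) i ≠ 0 := by
    intro i h
    refine hz.2 (Finset.mem_image.2 ⟨i, Finset.mem_univ i, ?_⟩)
    rw [← sub_eq_zero.1 h, moebiusInv_moebius hz1]
  -- The value of s' is irrelevant: `a` carries the scale squared and `b` the scale itself, so s'
  -- drops out of -2 ḃ a + b ȧ.
  obtain ⟨s', hs'⟩ : ∃ s' : ℝ, HasDerivAt (fun τ => rootScale (r τ)) s' t := by
    have h1 : DifferentiableAt ℝ (rootScale : (Fin g → ℂ) → ℝ) (r t) := by
      exact ((contDiffOn_rootScale contDiffOn_id fun x hx => hx).contDiffAt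
        (isOpen_admissible.mem_nhds hadm)).differentiableAt (by simp)
    exact ⟨_, (h1.hasFDerivAt.comp_hasDerivAt t hr)⟩
  have hs := hs'.ofReal_comp
  have hpr := hasDerivAt_pairRoot hr
  have ha1 := hasDerivAt_eval_aPoly hv z
  have hb1 := hasDerivAt_eval_bPoly hv z
  simp only [aPoly_pairOf, bPoly_pairOf, eval_mul, eval_C, eval_aOfRoots_eq_moebius _ hz1,
    eval_homog_eq_moebius _ hz1] at ha1 hb1
  have ha2 := ha1.unique (((hs.pow 2).neg).mul ((hasDerivAt_prod_sub Finset.univ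
    (hasDerivAt_const t Z) (fun i _ => hpr i) fun i _ => hZ i).const_mul ((z + 1) ^ (2 * g))))
  have hb2 := hb1.unique ((hs.mul_const I).mul
    ((hasDerivAt_eval_poly hF Z).const_mul ((z + 1) ^ (g + 1))))
  have hFZ : (poly F').eval Z = (fieldPoly (r t) K).eval Z -
      1 / 2 * (∑ i, pairRoot r' i / (Z - pairRoot (r t) i)) * (poly (F t)).eval Z -
      1 / 4 * ∑ i, (1 + pairRoot (r t) i ^ 2) * (poly K).eval (pairRoot (r t) i) /
        (Z - pairRoot (r t) i) := by
    rw [hF', poly_sub, poly_smul, poly_sum, poly_fieldVec, eval_sub, eval_mul, eval_C,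
      eval_finsetSum, sub_sub]
    congr 1
    rw [Finset.mul_sum, Finset.mul_sum, Finset.mul_sum, Finset.sum_mul, ← Finset.sum_add_distrib]
    refine Finset.sum_congr rfl fun i _ => ?_
    rw [poly_smul, eval_mul, eval_C, eval_divDiff _ _ (hZ i)]
    have h1 := hZ i
    field_simp
    linear_combination -4 * hr' i
  have hY := eval_fieldPoly (r t) K hZ
  have hneg : ∑ i, (0 - pairRoot r' i) / (Z - pairRoot (r t) i) =
      -∑ i, pairRoot r' i / (Z - pairRoot (r t) i) := by
    rw [← Finset.sum_neg_distrib]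
    exact Finset.sum_congr rfl fun i _ => by ring
  rw [hneg] at ha2
  have hc : poly (homogEquiv g ((rootScale (r t) : ℂ) • K)) = C (rootScale (r t) : ℂ) * homog K := by
    rw [map_smul, poly_smul, poly_homogEquiv]
  -- This and the next identity, z dZ/dz = i (1 + Z²) / 2, convert λ d/dλ into the Möbius
  -- coordinate.
  have hz2 : z / (z + 1) = (1 - I * Z) / 2 := by
    rw [hZdef, moebius]
    field_simp
    linear_combination (z - 1) * I_sq
  have hz3 : z * (2 * I / (z + 1) ^ 2) = I / 2 * (1 + Z ^ 2) := by
    rw [hZdef, moebius]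
    field_simp
    linear_combination -(z - 1) ^ 2 * I_sq
  have hRHS1 : z * (derivative (homog K)).eval z = (z + 1) ^ (g + 1) *
      (((g + 1 : ℕ) : ℂ) * ((1 - I * Z) / 2) * (poly K).eval Z +
        (derivative (poly K)).eval Z * (I / 2 * (1 + Z ^ 2))) := by
    rw [eval_derivative_homog K hz1, ← hz2, ← hz3]
    ring
  have hRHS2 : z * (derivative (aOfRoots (r t))).eval z = (aOfRoots (r t)).eval z *
      (((2 * g : ℕ) : ℂ) * ((1 - I * Z) / 2) +
        I / 2 * (1 + Z ^ 2) * ∑ i, 1 / (Z - pairRoot (r t) i)) := by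
    rw [eval_derivative_aOfRoots _ hz1 hZ, ← hz2, ← hz3]
    ring
  rw [eval_aOfRoots_eq_moebius _ hz1] at hRHS2
  rw [aPoly_pairOf, bPoly_pairOf, hc]
  simp only [eval_add, eval_mul, eval_neg, eval_C, eval_X, eval_ofNat, derivative_mul,
    derivative_C, zero_mul, zero_add]
  rw [ha2, hb2, hFZ, eval_aOfRoots_eq_moebius _ hz1, eval_homog_eq_moebius _ hz1,
    eval_homog_eq_moebius _ hz1]
  simp only [Pi.pow_apply, Pi.neg_apply]
  simp only [← hZdef, Nat.reduceSub, pow_one] at hRHS1 hRHS2 ⊢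
  push_cast at hRHS1 hRHS2 ⊢
  set s : ℂ := (rootScale (r t) : ℂ)
  set A : ℂ := -s ^ 2 * ((z + 1) ^ (2 * g) * ∏ i, (Z - pairRoot (r t) i)) with hA
  linear_combination -s * I * (z + 1) ^ (g + 1) * A * hY + 2 * s * A * hRHS1 -
    s * ((z + 1) ^ (g + 1) * (poly K).eval Z) * hRHS2

end WhithamEquation

/-! ### Leading order of F at the moving roots -/

section Flow

open Complex Set Filter

variable {g : ℕ}

lemma pairRoot_add (r x : Fin g → ℂ) (i : Fin g × Bool) :
    pairRoot (r + x) i = pairRoot r i + pairRoot x i := by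
  simp only [pairRoot, Pi.add_apply, map_add]
  split_ifs <;> rfl

lemma norm_pairRoot (x : Fin g → ℂ) (i : Fin g × Bool) : ‖pairRoot x i‖ = ‖x i.1‖ := by
  simp only [pairRoot]
  split_ifs <;> simp

lemma exists_eq_prod_pow_rootMultiplicity {ι : Type*} [Fintype ι] {f : ℂ[X]} (hf : f ≠ 0)
    {ρ : ι → ℂ} (hρ : Function.Injective ρ) :
    ∃ G : ℂ[X], f = (∏ i, (X - C (ρ i)) ^ f.rootMultiplicity (ρ i)) * G ∧
      ∀ i, G.eval (ρ i) ≠ 0 := by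
  classical
  have h : (∏ i, (X - C (ρ i)) ^ f.rootMultiplicity (ρ i)) ∣ f := by
    refine Finset.prod_dvd_of_coprime (fun i _ j _ hij => ?_) fun i _ =>
      pow_rootMultiplicity_dvd f (ρ i)
    exact (pairwise_coprime_X_sub_C hρ hij).pow
  obtain ⟨G, hG⟩ := h
  refine ⟨G, hG, fun i hi => ?_⟩
  refine (not_iff_not.2 (le_rootMultiplicity_iff hf)).1
    (not_le.2 (Nat.lt_succ_self (f.rootMultiplicity (ρ i)))) ?_
  obtain ⟨H, hH⟩ := dvd_iff_isRoot.2 hi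
  rw [pow_succ]
  conv_rhs => rw [hG, ← Finset.mul_prod_erase Finset.univ _ (Finset.mem_univ i), hH]
  exact ⟨(∏ j ∈ Finset.univ.erase i, (X - C (ρ j)) ^ f.rootMultiplicity (ρ j)) * H, by ring⟩

lemma norm_eval_poly_le {N : ℕ} (B : ℝ) :
    ∃ C, 0 ≤ C ∧ ∀ (w : Fin N → ℂ) (z : ℂ), ‖z‖ ≤ B → ‖(poly w).eval z‖ ≤ C * ‖w‖ := by
  refine ⟨∑ i : Fin N, |B| ^ (i : ℕ), Finset.sum_nonneg fun i _ => by positivity,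
    fun w z hz => ?_⟩
  rw [eval_poly, Finset.sum_mul]
  refine norm_sum_le_of_le _ fun i _ => ?_
  rw [norm_mul, norm_pow, mul_comm]
  gcongr
  · exact hz.trans (le_abs_self B)
  · exact norm_le_pi_norm w i

/-- The polynomial `b` in the coordinates in which the Whitham flow is desingularised. -/
def twisted (r₀ : Fin g → ℂ) (F₀ : Fin (g + 2) → ℂ) (q : (Fin g → ℂ) × (Fin (g + 2) → ℝ)) :
    Fin (g + 2) → ℂ :=
  rootTwist (fun _ => sqrtPoly (g + 2)) (pairRoot r₀) Finset.univ (pairRoot q.1)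
    fun i => F₀ i + (q.2 i : ℂ)

lemma contDiff_vec (F₀ : Fin (g + 2) → ℂ) : ContDiff ℝ ∞
    fun q : (Fin g → ℂ) × (Fin (g + 2) → ℝ) => fun i => F₀ i + (q.2 i : ℂ) := by
  refine contDiff_pi.2 fun i => contDiff_const.add (ofRealCLM.contDiff.comp ?_)
  exact (contDiff_apply ℝ ℝ i).comp contDiff_snd

lemma contDiffOn_twisted (r₀ : Fin g → ℂ) (F₀ : Fin (g + 2) → ℂ)
    (O : Set ((Fin g → ℂ) × (Fin (g + 2) → ℝ))) : ContDiffOn ℝ ∞ (twisted r₀ F₀) O :=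
  contDiffOn_rootTwist (x := fun q : (Fin g → ℂ) × (Fin (g + 2) → ℝ) => pairRoot q.1)
    (fun i _ => contDiffOn_pairRoot contDiff_fst.contDiffOn i) (contDiff_vec F₀).contDiffOn

/-- The shift q.2 of F₀ is a real vector and the twist respects conjugation, so reality of F holds
throughout the chart and need not be propagated by the flow. -/
lemma conj_twisted (r₀ : Fin g → ℂ) {F₀ : Fin (g + 2) → ℂ} (hF₀ : (fun i => conj (F₀ i)) = F₀)
    (q : (Fin g → ℂ) × (Fin (g + 2) → ℝ)) :
    (fun i => conj (twisted r₀ F₀ q i)) = twisted r₀ F₀ q := by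
  rw [twisted, ← rootTwist_conj (pairSwap g) (map_conj_sqrtPoly _) (pairRoot_swap r₀)
    (pairRoot_swap q.1)]
  congr 1
  funext i
  rw [map_add, congrFun hF₀ i, conj_ofReal]

lemma twisted_zero (r₀ : Fin g → ℂ) (F₀ : Fin (g + 2) → ℂ) : twisted r₀ F₀ 0 = F₀ := by
  have h : (sqrtPoly (g + 2)).coeff 0 = 1 := by
    rw [coeff_zero_eq_eval_zero, sqrtPoly, eval_finsetSum, Finset.sum_range_succ',
      Finset.sum_eq_zero]
    · simp [sqrtCoeff]
    · simp
  rw [twisted, rootTwist_zero (fun _ _ => h) fun i _ => by simp [pairRoot]]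
  funext i
  simp

/-- The value of `twisted` at a root in leading order. -/
lemma exists_eval_twisted_asymptotics {r₀ : Fin g → ℂ} (hinj : Function.Injective (pairRoot r₀))
    {F₀ : Fin (g + 2) → ℂ} (hF₀ : (fun i => conj (F₀ i)) = F₀) (hne : poly F₀ ≠ 0) :
    ∃ (κ : Fin g → ℂ) (k : Fin g → (Fin g → ℂ) × (Fin (g + 2) → ℝ) → ℂ),
      (∀ j, κ j ≠ 0) ∧ (∀ j, Tendsto (k j) (𝓝 0) (𝓝 (κ j))) ∧
      ∀ j, (fun q => (poly (twisted r₀ F₀ q)).eval (r₀ j + q.1 j) -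
        q.1 j ^ (poly F₀).rootMultiplicity (r₀ j) * k j q) =O[𝓝 0]
          fun q => ∑ j, ‖q.1 j‖ ^ ((poly F₀).rootMultiplicity (r₀ j) + 1) + ‖q.2‖ := by
  classical
  obtain ⟨G, hG, hG0⟩ := exists_eq_prod_pow_rootMultiplicity hne hinj
  set d : Fin g × Bool → ℕ := fun i => (poly F₀).rootMultiplicity (pairRoot r₀ i) with hd
  -- F₀ is real, so conjugate roots have equal multiplicities.
  have hdj : ∀ i, d i = (poly F₀).rootMultiplicity (r₀ i.1) := by
    rintro ⟨j, b⟩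
    cases b
    · simp [hd, pairRoot]
    · have := eq_rootMultiplicity_map (p := poly F₀) (starRingEnd ℂ).injective (r₀ j)
      rw [map_conj_poly, hF₀] at this
      simp [hd, pairRoot, this]
  set L : Fin g → (Fin g → ℂ) × (Fin (g + 2) → ℝ) → ℂ := fun j q =>
    ∏ i ∈ Finset.univ.erase (j, false),
      (truncFactor (d i) (pairRoot r₀ i) (pairRoot q.1 i)).eval (r₀ j + q.1 j) with hL
  -- The cofactor of x_j^(d_j) when the truncated twist is applied to F₀ and evaluated at r₀,j +
  -- x_j. At the origin only factors at the other roots and G survive, and none of them vanishes.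
  set k : Fin g → (Fin g → ℂ) × (Fin (g + 2) → ℝ) → ℂ := fun j q =>
    (∑ m ∈ Finset.range (d (j, false) + 1), sqrtCoeff m) * (L j q * G.eval (r₀ j + q.1 j)) with hk
  have hcont : ∀ j, Continuous (k j) := by
    intro j
    have hx : ∀ i, Continuous fun q : (Fin g → ℂ) × (Fin (g + 2) → ℝ) => pairRoot q.1 i := fun i =>
      contDiffOn_univ.1 (contDiffOn_pairRoot contDiff_fst.contDiffOn i) |>.continuous
    have hz : Continuous fun q : (Fin g → ℂ) × (Fin (g + 2) → ℝ) => r₀ j + q.1 j := by fun_prop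
    refine continuous_const.mul ((continuous_finsetProd _ fun i _ => ?_).mul
      (G.continuous.comp hz))
    exact (continuous_eval_truncFactor (d i) (pairRoot r₀ i)).comp ((hx i).prodMk hz)
  refine ⟨fun j => k j 0, k, fun j => ?_, fun j => (hcont j).tendsto 0, fun j => ?_⟩
  · have hp : pairRoot r₀ (j, false) = r₀ j := by simp [pairRoot]
    refine mul_ne_zero (sum_sqrtCoeff_ne_zero _) (mul_ne_zero ?_ ?_)
    · refine Finset.prod_ne_zero_iff.2 fun i hi => ?_
      have h0 : pairRoot (0 : (Fin g → ℂ) × (Fin (g + 2) → ℝ)).1 i = 0 := by simp [pairRoot]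
      rw [h0, truncFactor_zero]
      simp only [Prod.fst_zero, Pi.zero_apply, add_zero, eval_pow, eval_sub, eval_X, eval_C]
      refine pow_ne_zero _ (sub_ne_zero.2 fun h => Finset.ne_of_mem_erase hi (hinj ?_))
      rw [hp, h]
    · simpa [hp] using hG0 (j, false)
  · obtain ⟨B₁, hB₁0, hB₁⟩ := exists_norm_rootTwist_sub_le (N := g + 2)
      (p := fun _ => sqrtPoly (g + 2)) (q := fun i => sqrtPoly (d i)) (d := d) (pairRoot r₀)
      Finset.univ (fun i _ => by
        refine X_pow_dvd_sqrtPoly_sub ?_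
        have h1 := natDegree_le_of_dvd (pow_rootMultiplicity_dvd (poly F₀) (pairRoot r₀ i)) hne
        rw [natDegree_pow, natDegree_X_sub_C, mul_one] at h1
        refine h1.trans ?_
        exact natDegree_le_iff_coeff_eq_zero.2 fun m hm => by rw [coeff_poly, dif_neg (by omega)])
    obtain ⟨B₂, hB₂0, hB₂⟩ := exists_norm_rootTwist_le (N := g + 2)
      (fun _ => sqrtPoly (g + 2)) (pairRoot r₀) Finset.univ
    obtain ⟨B₃, hB₃0, hB₃⟩ := norm_eval_poly_le (N := g + 2) (‖r₀ j‖ + 1)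
    refine Asymptotics.IsBigO.of_bound (B₃ * (2 * B₁ * ‖F₀‖ + B₂)) ?_
    filter_upwards [Metric.ball_mem_nhds (0 : (Fin g → ℂ) × (Fin (g + 2) → ℝ)) one_pos] with q hq
    rw [mem_ball_zero_iff] at hq
    have hq1 : ∀ j, ‖q.1 j‖ ≤ 1 := fun j =>
      (norm_le_pi_norm q.1 j).trans ((norm_fst_le q).trans hq.le)
    have hq2 : ∀ i, ‖pairRoot q.1 i‖ ≤ 1 := fun i => (norm_pairRoot q.1 i).trans_le (hq1 i.1)
    set T : Module.End ℂ (Fin (g + 2) → ℂ) :=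
      rootTwist (fun _ => sqrtPoly (g + 2)) (pairRoot r₀) Finset.univ (pairRoot q.1) with hT
    set T' : Module.End ℂ (Fin (g + 2) → ℂ) :=
      rootTwist (fun i => sqrtPoly (d i)) (pairRoot r₀) Finset.univ (pairRoot q.1) with hT'
    set e : Fin (g + 2) → ℂ := fun i => (q.2 i : ℂ) with he
    have hen : ‖e‖ = ‖q.2‖ := by
      refine le_antisymm ((pi_norm_le_iff_of_nonneg (norm_nonneg _)).2 fun i => ?_)
        ((pi_norm_le_iff_of_nonneg (norm_nonneg _)).2 fun i => ?_)
      · rw [he, norm_real]; exact norm_le_pi_norm q.2 i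
      · have := norm_le_pi_norm e i
        rwa [he, norm_real] at this
    -- The first term gives the leading part exactly, the second is the truncation error, and the
    -- third is linear in e.
    have htw : twisted r₀ F₀ q = T' F₀ + ((T F₀ - T' F₀) + T e) := by
      have : twisted r₀ F₀ q = T (F₀ + e) := rfl
      rw [this, map_add]
      abel
    have hT'e : (poly (T' F₀)).eval (r₀ j + q.1 j) =
        q.1 j ^ (poly F₀).rootMultiplicity (r₀ j) * k j q := by
      have hp : pairRoot r₀ (j, false) = r₀ j := by simp [pairRoot]
      have hp' : pairRoot q.1 (j, false) = q.1 j := by simp [pairRoot]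
      have h1 := eval_truncFactor_self (d (j, false)) (pairRoot r₀ (j, false))
        (pairRoot q.1 (j, false))
      rw [hp, hp'] at h1
      rw [hT', poly_rootTwist_sqrtPoly (d := d) hG, eval_mul, eval_prod,
        ← Finset.mul_prod_erase Finset.univ _ (Finset.mem_univ (j, false)), hp, hp', h1,
        ← hdj (j, false)]
      ring
    rw [htw, poly_add, eval_add, hT'e, add_sub_cancel_left]
    have hsum : ∑ i, ‖pairRoot q.1 i‖ ^ (d i + 1) =
        2 * ∑ j, ‖q.1 j‖ ^ ((poly F₀).rootMultiplicity (r₀ j) + 1) := by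
      simp only [norm_pairRoot, hdj]
      rw [Fintype.sum_prod_type]
      simp [Finset.mul_sum, two_mul]
    set S := ∑ j, ‖q.1 j‖ ^ ((poly F₀).rootMultiplicity (r₀ j) + 1) with hS
    have hS0 : 0 ≤ S := Finset.sum_nonneg fun j _ => by positivity
    have h1 := hB₁ _ hq2 F₀
    rw [hsum] at h1
    have h2 := hB₂ _ hq2 e
    rw [hen] at h2
    refine (hB₃ _ _ ((norm_add_le _ _).trans (add_le_add_right (hq1 j) _))).trans ?_
    rw [mul_assoc, Real.norm_of_nonneg (add_nonneg hS0 (norm_nonneg _))]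
    refine mul_le_mul_of_nonneg_left ((norm_add_le_of_le h1 h2).trans ?_) hB₃0
    have h3 : 0 ≤ 2 * B₁ * ‖F₀‖ * ‖q.2‖ := by positivity
    have h4 : 0 ≤ B₂ * S := by positivity
    nlinarith

end Flow

/-! ### The flow in normal form -/

section NormalFormFlow

open Complex Set Filter

variable {g : ℕ}

/-- The coefficients of the real part of `c`, in the coordinate `moebius λ`. -/
def realCoeff (c : Fin (g + 2) → ℂ) : Fin (g + 2) → ℂ := realPart ((homogEquiv g).symm c)

lemma IsRealC.homogEquiv_realCoeff {c : Fin (g + 2) → ℂ} (hc : IsRealC g c) :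
    homogEquiv g (realCoeff c) = c := by
  rw [realCoeff, realPart_of_conj hc.conj_homogEquiv_symm, LinearEquiv.apply_symm_apply]

lemma isRealC_homogEquiv_realCoeff (c : Fin (g + 2) → ℂ) :
    IsRealC g (homogEquiv g (realCoeff c)) :=
  isRealC_homogEquiv (conj_realPart _)

lemma contDiff_realPart {N : ℕ} : ContDiff ℝ ∞ (realPart : (Fin N → ℂ) → Fin N → ℂ) :=
  contDiff_pi.2 fun i => ofRealCLM.contDiff.comp (reCLM.contDiff.comp (contDiff_apply ℝ ℂ i))

lemma contDiffOn_realCoeff {E : Type*} [NormedAddCommGroup E] [NormedSpace ℝ E] {O : Set E}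
    {c : E → Fin (g + 2) → ℂ} (hc : ContDiffOn ℝ ∞ c O) :
    ContDiffOn ℝ ∞ (fun x => realCoeff (c x)) O :=
  contDiff_realPart.comp_contDiffOn (contDiffOn_linearMap (homogEquiv g).symm.toLinearMap hc)

/-- The Whitham flow starting at a pair in normal form, for times `t ≥ 0`. -/
theorem exists_flow {r₀ : Fin g → ℂ} {F₀ : Fin (g + 2) → ℂ} (hadm : Admissible r₀)
    (hinj : Function.Injective (pairRoot r₀)) (hF₀ : (fun i => conj (F₀ i)) = F₀)
    (hne : poly F₀ ≠ 0) {U : Set (PolyPair g)} (hU : IsOpen U) (hmem : pairOf r₀ F₀ ∈ U)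
    {c : PolyPair g → Fin (g + 2) → ℂ} (hc : ContDiffOn ℝ ∞ c U)
    (hc₀ : ∀ j, (poly F₀).eval (r₀ j) = 0 →
      (poly (realCoeff (c (pairOf r₀ F₀)))).eval (r₀ j) ≠ 0)
    {W : Set ((Fin g → ℂ) × (Fin (g + 2) → ℂ))} (hW : IsOpen W) (hW₀ : (r₀, F₀) ∈ W) :
    ∃ T > 0, ∃ (r : ℝ → Fin g → ℂ) (F : ℝ → Fin (g + 2) → ℂ), r 0 = r₀ ∧ F 0 = F₀ ∧
      ContinuousOn (fun t => pairOf (r t) (F t)) (Ico 0 T) ∧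
      ContDiffOn ℝ ∞ (fun t => pairOf (r t) (F t)) (Ioo 0 T) ∧
      (∀ t ∈ Ico 0 T, (r t, F t) ∈ W ∧ Admissible (r t) ∧ (fun i => conj (F t i)) = F t ∧
        pairOf (r t) (F t) ∈ U) ∧
      ∀ t ∈ Ioo 0 T, (∀ i, (poly (F t)).eval (pairRoot (r t) i) ≠ 0) ∧
        ∃ v, HasDerivAt (fun t => pairOf (r t) (F t)) v t ∧
          WhithamEq (homogEquiv g (realCoeff (c (pairOf (r t) (F t))))) (pairOf (r t) (F t)) v := by
  classical
  let Q : Type := (Fin g → ℂ) × (Fin (g + 2) → ℝ)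
  let rr : Q → Fin g → ℂ := fun q => r₀ + q.1
  let FF : Q → Fin (g + 2) → ℂ := twisted r₀ F₀
  let pt : Q → PolyPair g := fun q => pairOf (rr q) (FF q)
  have hrr : ContDiff ℝ ∞ rr := contDiff_const.add contDiff_fst
  have hFF : ContDiff ℝ ∞ FF := contDiffOn_univ.1 (contDiffOn_twisted r₀ F₀ univ)
  have hrr0 : rr 0 = r₀ := add_zero r₀
  have hFF0 : FF 0 = F₀ := twisted_zero r₀ F₀
  have hpt0 : pt 0 = pairOf r₀ F₀ := by simp only [pt, hrr0, hFF0]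
  let O₁ : Set Q := {q | Admissible (rr q)} ∩ {q | (rr q, FF q) ∈ W}
  have hO₁ : IsOpen O₁ := (isOpen_admissible.preimage hrr.continuous).inter
    (hW.preimage (hrr.continuous.prodMk hFF.continuous))
  have hptO₁ : ContDiffOn ℝ ∞ pt O₁ :=
    contDiffOn_pairOf hrr.contDiffOn (fun q hq => hq.1) hFF.contDiffOn
  let O : Set Q := O₁ ∩ pt ⁻¹' U
  have hO : IsOpen O := hptO₁.continuousOn.isOpen_inter_preimage hO₁ hU
  have h0 : (0 : Q) ∈ O := by
    refine ⟨⟨?_, ?_⟩, ?_⟩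
    · change Admissible (rr 0)
      rwa [hrr0]
    · change (rr 0, FF 0) ∈ W
      rwa [hrr0, hFF0]
    · change pt 0 ∈ U
      rwa [hpt0]
  have hptO : ContDiffOn ℝ ∞ pt O := hptO₁.mono inter_subset_left
  -- The reality of `c` is assumed only at spectral data, which the points of the chart are not yet
  -- known to be. Taking real parts keeps the field real everywhere and changes nothing at spectral
  -- data.
  let K : Q → Fin (g + 2) → ℂ := fun q => (rootScale (rr q) : ℂ)⁻¹ • realCoeff (c (pt q))
  have hscale : ∀ q ∈ O, (rootScale (rr q) : ℂ) ≠ 0 := fun q hq => by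
    exact_mod_cast hq.1.1.rootScale_pos.ne'
  have hK : ContDiffOn ℝ ∞ K O := by
    refine ContDiffOn.smul (ContDiffOn.inv (ofRealCLM.contDiff.comp_contDiffOn
      (contDiffOn_rootScale hrr.contDiffOn fun q hq => hq.1.1)) fun q hq => hscale q hq) ?_
    exact contDiffOn_realCoeff (hc.comp hptO fun q hq => hq.2)
  have hKreal : ∀ q, (fun i => conj (K q i)) = K q := fun q => by
    funext i
    have := congrFun (conj_realPart ((homogEquiv g).symm (c (pt q)))) i
    simp only [K, realCoeff, Pi.smul_apply, smul_eq_mul, map_mul, map_inv₀, conj_ofReal, this]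
  obtain ⟨R, hR⟩ := exists_inverse_sqrtPoly (g + 2) (g + 2)
  let T : Q → Module.End ℂ (Fin (g + 2) → ℂ) := fun q =>
    rootTwist (fun _ => sqrtPoly (g + 2)) (pairRoot r₀) Finset.univ (pairRoot q.1)
  let S : Q → Module.End ℂ (Fin (g + 2) → ℂ) := fun q =>
    rootTwist (fun _ => R) (pairRoot r₀) Finset.univ (pairRoot q.1)
  have hTS : ∀ q, T q * S q = 1 := fun q => rootTwist_mul_eq_one fun _ _ => hR
  have hST : ∀ q, S q * T q = 1 := fun q => rootTwist_mul_eq_one fun _ _ => by rwa [mul_comm]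
  have hSreal : ∀ (q : Q) (v : Fin (g + 2) → ℂ), (fun i => conj (v i)) = v →
      realPart (S q v) = S q v := by
    intro q v hv
    refine realPart_of_conj ?_
    have h1 : T q (fun i => conj (S q v i)) = v := by
      have h2 := rootTwist_conj (pairSwap g) (map_conj_sqrtPoly (g + 2)) (pairRoot_swap r₀)
        (pairRoot_swap q.1) (S q v)
      have h3 : T q (S q v) = v := by rw [← Module.End.mul_apply, hTS, Module.End.one_apply]
      change T q _ = fun i => conj (T q (S q v) i) at h2
      rw [h2, h3, hv]
    calc _ = S q (T q fun i => conj (S q v i)) := by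
          rw [← Module.End.mul_apply, hST, Module.End.one_apply]
      _ = _ := by rw [h1]
  -- The equation w' = T⁻¹ `fieldVec`, free of r'. The vector is real, so taking real parts loses
  -- nothing.
  let Y : Q → Fin (g + 2) → ℝ := fun q i => (S q (fieldVec (rr q) (K q)) i).re
  have hY : ContDiffOn ℝ ∞ Y O := by
    refine contDiffOn_pi.2 fun i => reCLM.contDiff.comp_contDiffOn ?_
    have h1 : ContDiffOn ℝ ∞ (fun q => S q (fieldVec (rr q) (K q))) O :=
      contDiffOn_rootTwist (x := fun q : Q => pairRoot q.1)
        (fun i _ => contDiffOn_pairRoot contDiff_fst.contDiffOn i)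
        (contDiffOn_fieldVec hrr.contDiffOn hK)
    exact contDiffOn_pi.1 h1 i
  let β : Q → Fin g → ℂ := fun q j => (poly (FF q)).eval (rr q j)
  let N : Q → Fin g → ℂ := fun q j =>
    -(1 / 2) * (1 + rr q j ^ 2) * (poly (K q)).eval (rr q j)
  have hrrj : ∀ j, ContDiffOn ℝ ∞ (fun q => rr q j) O := fun j =>
    contDiffOn_pi.1 hrr.contDiffOn j
  have hβ : ContDiffOn ℝ ∞ β O := contDiffOn_pi.2 fun j =>
    contDiffOn_eval_poly hFF.contDiffOn (hrrj j)
  have hN : ContDiffOn ℝ ∞ N O := contDiffOn_pi.2 fun j =>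
    (contDiffOn_const.mul (contDiffOn_const.add ((hrrj j).pow 2))).mul
      (contDiffOn_eval_poly hK (hrrj j))
  obtain ⟨κ, k, hκ, hk, hβk⟩ := exists_eval_twisted_asymptotics hinj hF₀ hne
  have hN0 : ∀ j, (poly F₀).rootMultiplicity (r₀ j) ≠ 0 → N 0 j ≠ 0 := by
    intro j hj
    have h1 : (poly F₀).eval (r₀ j) = 0 := (rootMultiplicity_pos hne).1 (Nat.pos_of_ne_zero hj)
    have h2 := hscale 0 h0
    simp only [N, K, hrr0, hpt0, poly_smul, eval_mul, eval_C] at h2 ⊢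
    exact mul_ne_zero (mul_ne_zero (by norm_num) (hadm j))
      (mul_ne_zero (inv_ne_zero h2) (hc₀ j h1))
  obtain ⟨t₁, ht₁, y, hy0, hyc, hys, hy⟩ := exists_singular_solution
    (fun j => (poly F₀).rootMultiplicity (r₀ j)) hO h0 hβ hN hY hκ hN0 hk hβk
  have hyO : ∀ t ∈ Ico 0 t₁, y t ∈ O := by
    intro t ht
    rcases eq_or_lt_of_le ht.1 with h | h
    · rw [← h, hy0]; exact h0
    · exact (hy t ⟨h, ht.2⟩).1
  refine ⟨t₁, ht₁, fun t => rr (y t), fun t => FF (y t), by simp only [hy0, hrr0],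
    by simp only [hy0, hFF0], ?_, ?_, fun t ht => ?_, fun t ht => ?_⟩
  · exact hptO.continuousOn.comp hyc hyO
  · exact hptO.comp hys fun t ht => (hy t ht).1
  · have := hyO t ht
    exact ⟨this.1.2, this.1.1, conj_twisted r₀ hF₀ _, this.2⟩
  · obtain ⟨hyt, hβt, hd⟩ := hy t ht
    have hFreal : (fun i => conj (FF (y t) i)) = FF (y t) := conj_twisted r₀ hF₀ _
    have hne' : ∀ i, (poly (FF (y t))).eval (pairRoot (rr (y t)) i) ≠ 0 := by
      rintro ⟨j, b⟩
      cases b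
      · simpa [pairRoot] using hβt j
      · have := conj_eval_of_real hFreal (rr (y t) j)
        simp only [pairRoot, if_true]
        rw [this]
        simpa using hβt j
    refine ⟨hne', ?_⟩
    set x' : Fin g → ℂ := fun j => N (y t) j / β (y t) j with hx'
    have hd1 : HasDerivAt (fun τ => (y τ).1) x' t :=
      (ContinuousLinearMap.fst ℝ (Fin g → ℂ) (Fin (g + 2) → ℝ)).hasFDerivAt.comp_hasDerivAt t hd
    have hd2 : HasDerivAt (fun τ => (y τ).2) (Y (y t)) t :=
      (ContinuousLinearMap.snd ℝ (Fin g → ℂ) (Fin (g + 2) → ℝ)).hasFDerivAt.comp_hasDerivAt t hd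
    have hr : HasDerivAt (fun τ => rr (y τ)) x' t := hd1.const_add r₀
    have hw : HasDerivAt (fun τ => fun i => F₀ i + ((y τ).2 i : ℂ))
        (S (y t) (fieldVec (rr (y t)) (K (y t)))) t := by
      refine hasDerivAt_pi.2 fun i => ?_
      have h1 : S (y t) (fieldVec (rr (y t)) (K (y t))) i = ((Y (y t) i : ℝ) : ℂ) :=
        (congrFun (hSreal (y t) _ (conj_fieldVec (hKreal (y t)))) i).symm
      rw [h1]
      exact ((hasDerivAt_pi.1 hd2 i).ofReal_comp).const_add _
    -- Differentiating F = T w restores the singular divided difference terms of the Whitham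
    -- equation.
    have hF := hasDerivAt_rootTwist (N := g + 2) (r := pairRoot r₀) (s := Finset.univ)
      (x := fun τ => pairRoot (y τ).1) (fun i _ => hasDerivAt_pairRoot hd1 i) hw
    have hv := ((hptO.contDiffAt (hO.mem_nhds hyt)).differentiableAt
      (by simp)).hasFDerivAt.comp_hasDerivAt t hd
    have hKc : homogEquiv g (realCoeff (c (pt (y t)))) =
        homogEquiv g ((rootScale (rr (y t)) : ℂ) • K (y t)) := by
      simp only [K]
      rw [smul_smul, mul_inv_cancel₀ (hscale _ hyt), one_smul]
    refine ⟨_, hv, ?_⟩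
    change WhithamEq (homogEquiv g (realCoeff (c (pt (y t))))) _ _
    rw [hKc]
    have hj : ∀ j, x' j * (poly (FF (y t))).eval (rr (y t) j) =
        -(1 / 2) * (1 + rr (y t) j ^ 2) * (poly (K (y t))).eval (rr (y t) j) := fun j =>
      div_mul_cancel₀ _ (hβt j)
    have hj' : ∀ i, pairRoot x' i * (poly (FF (y t))).eval (pairRoot (rr (y t)) i) =
        -(1 / 2) * (1 + pairRoot (rr (y t)) i ^ 2) *
          (poly (K (y t))).eval (pairRoot (rr (y t)) i) := by
      rintro ⟨j, b⟩
      cases b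
      · simpa [pairRoot] using hj j
      · have h1 := congrArg (starRingEnd ℂ) (hj j)
        rw [map_mul, ← conj_eval_of_real hFreal, map_mul, ← conj_eval_of_real (hKreal (y t))] at h1
        simpa [pairRoot, Complex.conj_ofNat] using h1
    refine whithamEq_pairOf hr hF hyt.1.1 hj' ?_ hv
    have h1 : T (y t) (S (y t) (fieldVec (rr (y t)) (K (y t)))) =
        fieldVec (rr (y t)) (K (y t)) := by
      rw [← Module.End.mul_apply, hTS, Module.End.one_apply]
    simp only [T] at h1
    rw [h1]
    simp only [rr, pairRoot_add]

end NormalFormFlow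

/-! ### Spectral data along the half-flow -/

section Main

open Complex Set Filter

variable {g : ℕ}

lemma Admissible.eval_aPoly_pairOf_eq_zero_iff {r : Fin g → ℂ} (h : Admissible r)
    (F : Fin (g + 2) → ℂ) {z : ℂ} :
    (aPoly (pairOf r F)).eval z = 0 ↔ ∃ i, z = moebiusInv (pairRoot r i) := by
  rw [aPoly_pairOf, h.eval_aOfRoots_eq, mul_eq_zero, or_iff_right h.leadingCoeff_ne_zero,
    Finset.prod_eq_zero_iff]
  simp [sub_eq_zero]

lemma eval_homog_moebiusInv (F : Fin (g + 2) → ℂ) {ρ : ℂ} (hρ : I - ρ ≠ 0) :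
    (homog F).eval (moebiusInv ρ) = (moebiusInv ρ + 1) ^ (g + 1) * (poly F).eval ρ := by
  rw [eval_homog_eq_moebius _ (moebiusInv_add_one_ne_zero hρ), moebius_moebiusInv hρ]

lemma Admissible.eval_bPoly_pairOf_eq_zero_iff {r : Fin g → ℂ} (h : Admissible r)
    (F : Fin (g + 2) → ℂ) (i : Fin g × Bool) :
    (bPoly (pairOf r F)).eval (moebiusInv (pairRoot r i)) = 0 ↔
      (poly F).eval (pairRoot r i) = 0 := by
  have hs : ((rootScale r : ℂ) * I) ≠ 0 :=
    mul_ne_zero (by exact_mod_cast h.rootScale_pos.ne') I_ne_zero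
  rw [bPoly_pairOf, eval_mul, eval_C, mul_eq_zero, or_iff_right hs,
    eval_homog_moebiusInv _ (h.I_sub_pairRoot i), mul_eq_zero,
    or_iff_right (pow_ne_zero _ (moebiusInv_add_one_ne_zero (h.I_sub_pairRoot i)))]

/-- The constants make the discs of radius 4 δ disjoint and free of 0, while the discs of radius δ,
to which the moving roots are confined, miss the unit circle. -/
lemma exists_separation {ι : Type*} [Finite ι] {ρ : ι → ℂ} (hinj : Function.Injective ρ)
    (h0 : ∀ i, ρ i ≠ 0) (h1 : ∀ i, ‖ρ i‖ ≠ 1) :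
    ∃ δ > 0, (∀ i j, i ≠ j → 8 * δ ≤ ‖ρ i - ρ j‖) ∧ (∀ i, 4 * δ ≤ ‖ρ i‖) ∧
      ∀ i (z : ℂ), ‖z‖ = 1 → δ < ‖z - ρ i‖ := by
  have key : ∀ (a b : ℝ), 0 < b → ∀ᶠ δ in 𝓝[>] (0 : ℝ), a * δ < b := fun a b hb => by
    have : Tendsto (fun δ : ℝ => a * δ) (𝓝[>] 0) (𝓝 0) := by
      have := (continuous_const_mul a).tendsto (0 : ℝ)
      rw [mul_zero] at this
      exact this.mono_left nhdsWithin_le_nhds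
    exact this.eventually_lt_const hb
  have h2 : ∀ᶠ δ in 𝓝[>] (0 : ℝ), ∀ i j, i ≠ j → 8 * δ < ‖ρ i - ρ j‖ := by
    rw [eventually_all]
    intro i
    rw [eventually_all]
    intro j
    by_cases hij : i = j
    · simp [hij]
    · exact (key 8 _ (norm_pos_iff.2 (sub_ne_zero.2 (hinj.ne hij)))).mono fun δ h _ => h
  have h3 : ∀ᶠ δ in 𝓝[>] (0 : ℝ), ∀ i, 4 * δ < ‖ρ i‖ :=
    eventually_all.2 fun i => key 4 _ (norm_pos_iff.2 (h0 i))
  have h4 : ∀ᶠ δ in 𝓝[>] (0 : ℝ), ∀ i, 1 * δ < |1 - ‖ρ i‖| :=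
    eventually_all.2 fun i => key 1 _ (abs_pos.2 (sub_ne_zero.2 (h1 i).symm))
  obtain ⟨δ, ⟨⟨h2, h3⟩, h4⟩, hδ⟩ := (((h2.and h3).and h4).and self_mem_nhdsWithin).exists
  refine ⟨δ, hδ, fun i j hij => (h2 i j hij).le, fun i => (h3 i).le, fun i z hz => ?_⟩
  have := abs_norm_sub_norm_le z (ρ i)
  rw [hz] at this
  linarith [h4 i]

lemma ofReal_mul_mem_slitPlane {s : ℝ} (hs : 0 < s) {w : ℂ} (hw : w ∈ slitPlane) :
    (s : ℂ) * w ∈ slitPlane := by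
  rw [mem_slitPlane_iff, re_ofReal_mul, im_ofReal_mul] at *
  exact hw.imp (mul_pos hs) (mul_ne_zero hs.ne')

lemma exists_prod_mem_slitPlane (ι : Type*) [Fintype ι] :
    ∃ η > 0, ∀ u : ι → ℂ, (∀ i, ‖u i - 1‖ < η) → ∏ i, u i ∈ slitPlane := by
  have h1 : Continuous fun u : ι → ℂ => ∏ i, u i := by fun_prop
  have h2 := (isOpen_slitPlane.preimage h1).mem_nhds (x := 1) (by simp)
  obtain ⟨η, hη, h3⟩ := Metric.mem_nhds_iff.1 h2
  refine ⟨η, hη, fun u hu => h3 ?_⟩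
  rw [mem_ball_iff_norm, pi_norm_lt_iff hη]
  exact hu

/-- Away from the roots of `ell ρ₀` the quotient `ell ρ / ell ρ₀` is close to one. -/
lemma norm_eval_ell_div_sub_one_le {ρ ρ₀ : ℂ} (hρ₀ : I - ρ₀ ≠ 0) {δ : ℝ} (hδ : 0 < δ) {z : ℂ}
    (hz : δ < ‖z - moebiusInv ρ₀‖) :
    ‖(ell ρ).eval z / (ell ρ₀).eval z - 1‖ ≤
      ‖ρ - ρ₀‖ * ((1 + ‖moebiusInv ρ₀ + 1‖ / δ) / ‖I - ρ₀‖) := by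
  have hpos : 0 < ‖z - moebiusInv ρ₀‖ := hδ.trans hz
  have hz0 : z - moebiusInv ρ₀ ≠ 0 := norm_pos_iff.1 hpos
  have h1 : (ell ρ).eval z / (ell ρ₀).eval z - 1 =
      -(ρ - ρ₀) * ((1 + (moebiusInv ρ₀ + 1) / (z - moebiusInv ρ₀)) / (I - ρ₀)) := by
    have h2 : (ell ρ).eval z = (ell ρ₀).eval z - (ρ - ρ₀) * (z + 1) := by
      rw [eval_ell, eval_ell]; ring
    rw [h2, eval_ell_eq_moebiusInv hρ₀]
    field_simp
    ring
  rw [h1, norm_mul, norm_neg, norm_div]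
  refine mul_le_mul_of_nonneg_left (div_le_div_of_nonneg_right ?_ (norm_nonneg _)) (norm_nonneg _)
  refine (norm_add_le _ _).trans ?_
  rw [norm_one, norm_div]
  gcongr

/-- The Whitham flow for times `t ≥ 0`. -/
theorem exists_whitham_half {p₀ : PolyPair g} (hp₀ : IsSpectralData g p₀) {U : Set (PolyPair g)}
    (hU : IsOpen U) (hp₀U : p₀ ∈ U) {c : PolyPair g → Fin (g + 2) → ℂ} (hc : ContDiffOn ℝ ∞ c U)
    (hcreal : ∀ p ∈ U, IsSpectralData g p → IsRealC g (c p))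
    (hc₀ : ∀ z : ℂ, IsCommonRoot p₀ z → (poly (c p₀)).eval z ≠ 0) :
    ∃ T > 0, ∃ γ : ℝ → PolyPair g, γ 0 = p₀ ∧ ContinuousOn γ (Ico 0 T) ∧
      ContDiffOn ℝ ∞ γ (Ioo 0 T) ∧ (∀ t ∈ Ico 0 T, γ t ∈ U ∧ IsSpectralData g (γ t)) ∧
      ∀ t ∈ Ioo 0 T, (∃ v, HasDerivAt γ v t ∧ WhithamEq (c (γ t)) (γ t) v) ∧
        ∀ z : ℂ, ¬ IsCommonRoot (γ t) z := by
  classical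
  obtain ⟨r₀, F₀, hadm, hinj, hF₀, rfl⟩ := hp₀.exists_pairOf
  set ρ₀ : Fin g × Bool → ℂ := fun i => moebiusInv (pairRoot r₀ i) with hρ₀
  have hs₀ : ((rootScale r₀ : ℂ) * I) ≠ 0 :=
    mul_ne_zero (by exact_mod_cast hadm.rootScale_pos.ne') I_ne_zero
  have hb₀ : homogEquiv g F₀ (Fin.last (g + 1)) ≠ 0 := by
    intro h
    have h1 : (bPoly (pairOf r₀ F₀)).coeff (g + 1) = 0 := by
      rw [bPoly_pairOf, coeff_C_mul, ← poly_homogEquiv, coeff_poly, dif_pos (by omega)]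
      exact mul_eq_zero_of_right _ h
    rw [← hp₀.degree_b, coeff_natDegree, leadingCoeff_eq_zero] at h1
    have h2 := hp₀.degree_b
    rw [h1, natDegree_zero] at h2
    omega
  have hne : poly F₀ ≠ 0 := by
    intro h
    have : F₀ = 0 := poly_injective (h.trans poly_zero.symm)
    rw [this, map_zero] at hb₀
    exact hb₀ rfl
  have hroot₀ : ∀ i, (aPoly (pairOf r₀ F₀)).eval (ρ₀ i) = 0 := fun i =>
    (hadm.eval_aPoly_pairOf_eq_zero_iff F₀).2 ⟨i, rfl⟩
  have hmi : ∀ {r : Fin g → ℂ}, Admissible r → ∀ i j,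
      moebiusInv (pairRoot r i) = moebiusInv (pairRoot r j) → pairRoot r i = pairRoot r j :=
    fun h i j hij => by
      rw [← moebius_moebiusInv (h.I_sub_pairRoot i), ← moebius_moebiusInv (h.I_sub_pairRoot j), hij]
  obtain ⟨δ, hδ, hsep, hδ0, hcirc⟩ := exists_separation (ρ := ρ₀)
    (fun i j hij => hinj (hmi hadm i j hij)) (fun i => hp₀.ne_zero_of_root (hroot₀ i))
    (fun i => hp₀.norm_ne_one (hroot₀ i))
  have hcj : ∀ j, (poly F₀).eval (r₀ j) = 0 →
      (poly (realCoeff (c (pairOf r₀ F₀)))).eval (r₀ j) ≠ 0 := by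
    intro j hj h
    have hp : pairRoot r₀ (j, false) = r₀ j := by simp [pairRoot]
    rw [← hp] at hj h
    refine hc₀ (ρ₀ (j, false)) ⟨hroot₀ _, (hadm.eval_bPoly_pairOf_eq_zero_iff F₀ _).2 hj⟩ ?_
    rw [← (hcreal _ hp₀U hp₀).homogEquiv_realCoeff, poly_homogEquiv,
      eval_homog_moebiusInv _ (hadm.I_sub_pairRoot _), h, mul_zero]
  obtain ⟨η, hη, hslit⟩ := exists_prod_mem_slitPlane (Fin g × Bool)
  set M : Fin g × Bool → ℝ := fun i => (1 + ‖ρ₀ i + 1‖ / δ) / ‖I - pairRoot r₀ i‖ with hM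
  -- The open conditions the flow must respect: the degree of `b`, the confinement of the roots to
  -- δ-discs, and closeness of a_τ / a₀ to the positive reals outside these discs.
  have hev : ∀ᶠ q : (Fin g → ℂ) × (Fin (g + 2) → ℂ) in 𝓝 (r₀, F₀),
      homogEquiv g q.2 (Fin.last (g + 1)) ≠ 0 ∧
      ∀ i, ‖moebiusInv (pairRoot q.1 i) - ρ₀ i‖ < δ ∧
        ‖pairRoot q.1 i - pairRoot r₀ i‖ * M i < η := by
    have hpr : ∀ i, Continuous fun q : (Fin g → ℂ) × (Fin (g + 2) → ℂ) => pairRoot q.1 i :=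
      fun i => (contDiffOn_univ.1 (contDiffOn_pairRoot contDiff_fst.contDiffOn i)).continuous
    refine Filter.Eventually.and ?_ (eventually_all.2 fun i => Filter.Eventually.and ?_ ?_)
    · have h1 : Continuous fun q : (Fin g → ℂ) × (Fin (g + 2) → ℂ) =>
          homogEquiv g q.2 (Fin.last (g + 1)) :=
        (continuous_apply _).comp
          ((LinearMap.continuous_of_finiteDimensional (homogEquiv g).toLinearMap).comp
            continuous_snd)
      exact h1.continuousAt.eventually_ne hb₀
    · have h1 : ContinuousAt (fun q : (Fin g → ℂ) × (Fin (g + 2) → ℂ) =>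
          ‖moebiusInv (pairRoot q.1 i) - ρ₀ i‖) (r₀, F₀) := by
        refine ContinuousAt.norm (ContinuousAt.sub (ContinuousAt.div ?_ ?_
          (hadm.I_sub_pairRoot i)) continuousAt_const)
        · exact (continuous_const.add (hpr i)).continuousAt
        · exact (continuous_const.sub (hpr i)).continuousAt
      exact h1.eventually_lt continuousAt_const (by simpa [hρ₀] using hδ)
    · have h1 : Continuous fun q : (Fin g → ℂ) × (Fin (g + 2) → ℂ) =>
          ‖pairRoot q.1 i - pairRoot r₀ i‖ * M i :=
        ((hpr i).sub continuous_const).norm.mul continuous_const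
      exact h1.continuousAt.eventually_lt continuousAt_const (by simpa using hη)
  obtain ⟨W, hWs, hW, hW₀⟩ := eventually_nhds_iff.1 hev
  obtain ⟨T, hT, r, F, hr0, hF0, hcont, hsmooth, hall, hflow⟩ :=
    exists_flow hadm hinj hF₀ hne hU hp₀U hc hcj hW hW₀
  set γ : ℝ → PolyPair g := fun t => pairOf (r t) (F t) with hγ
  have hγ0 : γ 0 = pairOf r₀ F₀ := by simp only [hγ, hr0, hF0]
  have hprop : ∀ t ∈ Ico 0 T, homogEquiv g (F t) (Fin.last (g + 1)) ≠ 0 ∧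
      ∀ i, ‖moebiusInv (pairRoot (r t) i) - ρ₀ i‖ < δ ∧
        ‖pairRoot (r t) i - pairRoot r₀ i‖ * M i < η := by
    intro t ht
    have h := hWs _ (hall t ht).1
    dsimp only at h
    exact h
  have hspec : ∀ t ∈ Ico 0 T, IsSpectralData g (γ t) := by
    intro t ht
    rcases eq_or_lt_of_le ht.1 with h | h
    · rw [← h, hγ0]; exact hp₀
    have hsub : Icc 0 t ⊆ Ico 0 T := fun τ hτ => ⟨hτ.1, hτ.2.trans_lt ht.2⟩
    obtain ⟨-, hadt, hFt, hUt⟩ := hall t ht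
    refine isSpectralData_pairOf hadt (fun i j hij => ?_) hFt (hprop t ht).1 ?_
    · by_contra hne
      have h1 := hsep i j hne
      have h2 := ((hprop t ht).2 i).1
      have h3 := ((hprop t ht).2 j).1
      rw [hij] at h2
      have h4 : ρ₀ i - ρ₀ j = (moebiusInv (pairRoot (r t) j) - ρ₀ j) -
          (moebiusInv (pairRoot (r t) j) - ρ₀ i) := by ring
      rw [h4] at h1
      linarith [norm_sub_le (moebiusInv (pairRoot (r t) j) - ρ₀ j)
        (moebiusInv (pairRoot (r t) j) - ρ₀ i)]
    · have hcc : ContinuousOn (fun τ => homogEquiv g (realCoeff (c (γ τ)))) (Icc 0 t) := by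
        have h1 : ContDiffOn ℝ ∞ (fun p => homogEquiv g (realCoeff (c p))) U :=
          contDiffOn_linearMap (homogEquiv g).toLinearMap (contDiffOn_realCoeff hc)
        exact h1.continuousOn.comp (hcont.mono hsub) fun τ hτ => (hall τ (hsub hτ)).2.2.2
      refine exists_isMonodromyEigenvalue_of_whitham (γ := γ)
        (c := fun τ => homogEquiv g (realCoeff (c (γ τ)))) h (hcont.mono hsub) hcc
        (fun τ hτ => (hflow τ ⟨hτ.1, hτ.2.trans ht.2⟩).2) (fun τ _ z hz => ?_)
        (fun τ _ => isRealC_homogEquiv_realCoeff _) (by rw [hγ0]; exact hp₀.periodic)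
        hδ hsep hδ0 hcirc (fun i => ((hprop t ht).2 i).1) hadt.leadingCoeff_ne_zero
        (fun z => ?_) fun τ hτ z hz => ?_
      · simp only [hγ, aPoly_pairOf]
        exact pow_mul_conj_eval_aOfRoots _ hz
      · simp only [hγ, aPoly_pairOf]
        exact hadt.eval_aOfRoots_eq z
      · have hadτ := (hall τ (hsub hτ)).2.1
        -- A positive number times a product of factors close to 1, hence off the negative real
        -- axis.
        have h1 : (aPoly (γ τ)).eval z / (aPoly (γ 0)).eval z =
            ((rootScale (r τ) ^ 2 / rootScale r₀ ^ 2 : ℝ) : ℂ) *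
              ∏ i, (ell (pairRoot (r τ) i)).eval z / (ell (pairRoot r₀ i)).eval z := by
          rw [hγ0]
          simp only [hγ, aPoly_pairOf]
          rw [eval_aOfRoots, eval_aOfRoots, mul_div_mul_comm, Finset.prod_div_distrib,
            neg_div_neg_eq]
          push_cast
          rfl
        rw [h1]
        refine ofReal_mul_mem_slitPlane (div_pos (pow_pos hadτ.rootScale_pos 2)
          (pow_pos hadm.rootScale_pos 2)) (hslit _ fun i => ?_)
        exact (norm_eval_ell_div_sub_one_le (hadm.I_sub_pairRoot i) hδ (hz i)).trans_lt
          ((hprop τ (hsub hτ)).2 i).2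
  refine ⟨T, hT, γ, hγ0, hcont, hsmooth, fun t ht => ⟨(hall t ht).2.2.2, hspec t ht⟩,
    fun t ht => ?_⟩
  have ht' : t ∈ Ico 0 T := ⟨ht.1.le, ht.2⟩
  obtain ⟨hne', v, hv, hWv⟩ := hflow t ht
  refine ⟨⟨v, hv, ?_⟩, fun z hz => ?_⟩
  · have := (hcreal _ (hall t ht').2.2.2 (hspec t ht')).homogEquiv_realCoeff
    rwa [this] at hWv
  · obtain ⟨i, rfl⟩ := ((hall t ht').2.1.eval_aPoly_pairOf_eq_zero_iff (F t)).1 hz.1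
    exact hne' i (((hall t ht').2.1.eval_bPoly_pairOf_eq_zero_iff (F t) i).1 hz.2)

lemma WhithamEq.neg {c : Fin (g + 2) → ℂ} {p v : PolyPair g} (h : WhithamEq (-c) p v) :
    WhithamEq c p (-v) := by
  have ha : aPoly (-v) = -aPoly v := poly_neg _
  have hb : bPoly (-v) = -bPoly v := poly_neg _
  rw [WhithamEq, poly_neg, derivative_neg] at h
  rw [WhithamEq, ha, hb]
  linear_combination -h

lemma IsRealC.neg {c : Fin (g + 2) → ℂ} (h : IsRealC g c) : IsRealC g (-c) := by
  intro z hz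
  rw [poly_neg, eval_neg, eval_neg, map_neg, mul_neg, h z hz]

end Main

end WhithamFlow

end

theorem mainTheorem7 (g : ℕ) (p₀ : WhithamFlow.PolyPair g)
    (hp₀ : WhithamFlow.IsSpectralData g p₀)
    (hcommon : ∃ z : ℂ, WhithamFlow.IsCommonRoot p₀ z)
    (U : Set (WhithamFlow.PolyPair g)) (hU : IsOpen U) (hp₀U : p₀ ∈ U)
    (c : WhithamFlow.PolyPair g → (Fin (g + 2) → ℂ))
    (hc : ContDiffOn ℝ ∞ c U)
    (hcreal : ∀ p ∈ U, WhithamFlow.IsSpectralData g p → WhithamFlow.IsRealC g (c p))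
    (hc₀ : ∀ z : ℂ, WhithamFlow.IsCommonRoot p₀ z → (WhithamFlow.poly (c p₀)).eval z ≠ 0) :
    ∃ ε : ℝ, 0 < ε ∧ ∃ γ : ℝ → WhithamFlow.PolyPair g,
      γ 0 = p₀ ∧
      ContinuousOn γ (Set.Ioo (-ε) ε) ∧
      ContDiffOn ℝ ∞ γ (Set.Ioo (-ε) ε \ {0}) ∧
      (∀ t ∈ Set.Ioo (-ε) ε, γ t ∈ U ∧ WhithamFlow.IsSpectralData g (γ t)) ∧
      (∀ t ∈ Set.Ioo (-ε) ε, t ≠ 0 →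
        ∃ v : WhithamFlow.PolyPair g,
          HasDerivAt γ v t ∧ WhithamFlow.WhithamEq (c (γ t)) (γ t) v) ∧
      (∀ t ∈ Set.Ioo (-ε) ε, t ≠ 0 → ∀ z : ℂ, ¬ WhithamFlow.IsCommonRoot (γ t) z) := by
  obtain ⟨T₁, hT₁, γ₁, h10, h1c, h1s, h1p, h1f⟩ :=
    WhithamFlow.exists_whitham_half hp₀ hU hp₀U hc hcreal hc₀
  -- Reversing time in the flow of `-c` gives a flow of `c`, because the Whitham equation is linear
  -- in the pair formed by the velocity and `c`.
  obtain ⟨T₂, hT₂, γ₂, h20, h2c, h2s, h2p, h2f⟩ :=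
    WhithamFlow.exists_whitham_half hp₀ hU hp₀U (c := fun p => -c p) hc.neg
      (fun p hp hs => (hcreal p hp hs).neg) fun z hz => by
        rw [WhithamFlow.poly_neg, eval_neg, neg_ne_zero]
        exact hc₀ z hz
  -- One summand always equals p₀. Written this way, continuity at 0 follows from that of the two
  -- halves on their half-open intervals.
  set γ : ℝ → WhithamFlow.PolyPair g := fun t => γ₁ (max t 0) + γ₂ (max (-t) 0) - p₀ with hγ
  have hpos : ∀ t, 0 ≤ t → γ t = γ₁ t := fun t ht => by
    simp only [hγ, max_eq_left ht, max_eq_right (neg_nonpos.2 ht), h20, add_sub_cancel_right]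
  have hneg : ∀ t, t ≤ 0 → γ t = γ₂ (-t) := fun t ht => by
    simp only [hγ, max_eq_right ht, max_eq_left (neg_nonneg.2 ht), h10, add_sub_cancel_left]
  have hpos' : ∀ t, 0 < t → γ =ᶠ[𝓝 t] γ₁ := fun t ht =>
    (lt_mem_nhds ht).mono fun s hs => hpos s (le_of_lt hs)
  have hneg' : ∀ t, t < 0 → γ =ᶠ[𝓝 t] fun s => γ₂ (-s) := fun t ht =>
    (gt_mem_nhds ht).mono fun s hs => hneg s (le_of_lt hs)
  have hε₁ : min T₁ T₂ ≤ T₁ := min_le_left _ _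
  have hε₂ : min T₁ T₂ ≤ T₂ := min_le_right _ _
  have hcase : ∀ t ∈ Set.Ioo (-min T₁ T₂) (min T₁ T₂), t ≠ 0 →
      (t ∈ Set.Ioo 0 T₁) ∨ (t < 0 ∧ -t ∈ Set.Ioo 0 T₂) := by
    intro t ht h0
    rcases lt_or_gt_of_ne h0 with h | h
    · exact Or.inr ⟨h, by linarith, by linarith [ht.1]⟩
    · exact Or.inl ⟨h, by linarith [ht.2]⟩
  refine ⟨min T₁ T₂, lt_min hT₁ hT₂, γ, by rw [hpos 0 le_rfl, h10], ?_, ?_, ?_, ?_, ?_⟩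
  · refine ContinuousOn.sub (ContinuousOn.add ?_ ?_) continuousOn_const
    · refine h1c.comp (by fun_prop) fun t ht => ⟨le_max_right _ _, max_lt ?_ hT₁⟩
      linarith [ht.2]
    · refine h2c.comp (by fun_prop) fun t ht => ⟨le_max_right _ _, max_lt ?_ hT₂⟩
      linarith [ht.1]
  · rintro t ⟨ht, h0⟩
    rcases hcase t ht h0 with h | ⟨h, h'⟩
    · exact ((h1s.contDiffAt (Ioo_mem_nhds h.1 h.2)).congr_of_eventuallyEq
        (hpos' t h.1)).contDiffWithinAt
    · exact (((h2s.contDiffAt (Ioo_mem_nhds h'.1 h'.2)).comp t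
        contDiff_neg.contDiffAt).congr_of_eventuallyEq (hneg' t h)).contDiffWithinAt
  · intro t ht
    rcases le_total 0 t with h | h
    · rw [hpos t h]
      exact h1p t ⟨h, by linarith [ht.2]⟩
    · rw [hneg t h]
      exact h2p (-t) ⟨by linarith, by linarith [ht.1]⟩
  · intro t ht h0
    rcases hcase t ht h0 with h | ⟨h, h'⟩
    · obtain ⟨v, hv, hW⟩ := (h1f t h).1
      rw [hpos t h.1.le]
      exact ⟨v, hv.congr_of_eventuallyEq (hpos' t h.1), hW⟩
    · obtain ⟨v, hv, hW⟩ := (h2f (-t) h').1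
      rw [hneg t h.le]
      refine ⟨-v, HasDerivAt.congr_of_eventuallyEq ?_ (hneg' t h), hW.neg⟩
      exact (hv.scomp t (hasDerivAt_neg t)).congr_deriv (by simp)
  · intro t ht h0
    rcases hcase t ht h0 with h | ⟨h, h'⟩
    · rw [hpos t h.1.le]
      exact (h1f t h).2
    · rw [hneg t h.le]
      exact (h2f (-t) h').2
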